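/- Let $\phi_0\in\mathscr S(\mathbb R^3)$ satisfy $0\le\phi_0\le1$, $\operatorname{supp}\phi_0\subset\{2^{-1}\le|\xi|\le2\}$ and $\sum_{j\in\mathbb Z}\phi_j(\xi)=1$ for all $\xi\ne0$, where $\phi_j(\xi):=\phi_0(2^{-j}\xi)$. Put $\Delta_jf:=\mathscr F^{-1}[\phi_j\widehat f\,]$, where $\widehat f(\xi)=\int_{\mathbb R^3}e^{-ix\cdot\xi}f(x)\,dx$ (extended to $\mathscr S'(\mathbb R^3)$). Let $$\lambda^{\pm}(\xi):=\tfrac12\Big(\sqrt{|\xi|^2+2\xi_3+1}\pm\sqrt{|\xi|^2-2\xi_3+1}\Big),\qquad \xi\in\mathbb R^3,$$ and for $f\in\mathscr S'(\mathbb R^3)$ with $\Delta_jf\in L^2(\mathbb R^3)$ let $\Delta_je^{it\lambda^\pm(D)}f:=\mathscr F^{-1}[e^{it\lambda^\pm(\xi)}\phi_j(\xi)\widehat f(\xi)]\in L^2(\mathbb R^3)$. Let $2\le q,r\le\infty$ satisfy $\frac1q+\frac1r\le\frac12$ and $(q,r)\ne(\infty,2)$. Then there exists a constant $C>0$, depending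 only on $q$, $r$ (and on the fixed function $\phi_0$), such that $$\left\|\Delta_je^{it\lambda^\pm(D)}f\right\|_{L^r(\mathbb R;L^q(\mathbb R^3))}\le\begin{cases}C\,2^{3(\frac12-\frac1q-\frac1r)j}\|\Delta_jf\|_{L^2(\mathbb R^3)}&(j\le0),\\ C\,2^{3(\frac12-\frac1q)j}\|\Delta_jf\|_{L^2(\mathbb R^3)}&(j>0)\end{cases}$$ for both signs, all $j\in\mathbb Z$ and all $f\in\mathscr S'(\mathbb R^3)$ with $\Delta_jf\in L^2(\mathbb R^3)$. -/

import Mathlib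

open MeasureTheory SchwartzMap FourierTransform
open scoped ENNReal

noncomputable section

/-- Euclidean space `ℝ³`; the coordinates `ξ₁, ξ₂, ξ₃` are `ξ 0, ξ 1, ξ 2`. -/
abbrev R3 : Type := EuclideanSpace ℝ (Fin 3)

/-- Generator `φ₀` of a Littlewood-Paley decomposition: a Schwartz function with `0 ≤ φ₀ ≤ 1`,
supported in the annulus `2⁻¹ ≤ |ξ| ≤ 2`, such that `∑_{j ∈ ℤ} φ₀(2^{-j} ξ) = 1` for `ξ ≠ 0`. -/
structure IsLittlewoodPaley (φ₀ : 𝓢(R3, ℝ)) : Prop where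
  nonneg : ∀ ξ, 0 ≤ φ₀ ξ
  le_one : ∀ ξ, φ₀ ξ ≤ 1
  tsupport_subset : tsupport (φ₀ : R3 → ℝ) ⊆ {ξ | (2 : ℝ)⁻¹ ≤ ‖ξ‖ ∧ ‖ξ‖ ≤ 2}
  hasSum_one : ∀ ξ : R3, ξ ≠ 0 → HasSum (fun j : ℤ => φ₀ ((2 : ℝ) ^ (-j) • ξ)) 1

/-- The dyadic symbol `φ_j(ξ) = φ₀(2^{-j} ξ)`. -/
def dyadicSymbol (φ₀ : 𝓢(R3, ℝ)) (j : ℤ) (ξ : R3) : ℝ := φ₀ ((2 : ℝ) ^ (-j) • ξ)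

/-- The Littlewood-Paley projection `Δ_j f = 𝓕⁻¹ [φ_j 𝓕 f]` of a tempered distribution.
Symbols `m(D)` are written in the convention `𝓕 f(ξ) = ∫ e^{-i x·ξ} f(x) dx`. As the Fourier
transform of Mathlib has the kernel `e^{-2πi x·ξ}`, the operator `m(D)` is multiplication by
`m(2πξ)` on its side. -/
def lpProj (φ₀ : 𝓢(R3, ℝ)) (j : ℤ) (f : 𝓢'(R3, ℂ)) : 𝓢'(R3, ℂ) :=
  TemperedDistribution.fourierMultiplierCLM ℂ
    (fun ξ : R3 => (dyadicSymbol φ₀ j ((2 * Real.pi) • ξ) : ℂ)) f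

/-- `η^σ(ξ) = √(|ξ|² + 2 σ ξ₃ + 1)`, for a sign `σ = ±1`. -/
def etaPM (σ : ℝ) (ξ : R3) : ℝ := Real.sqrt (‖ξ‖ ^ 2 + 2 * σ * ξ 2 + 1)

/-- `λ^σ(ξ) = (η⁺(ξ) + σ η⁻(ξ)) / 2`, for a sign `σ = ±1`. -/
def lambdaPM (σ : ℝ) (ξ : R3) : ℝ := (etaPM 1 ξ + σ * etaPM (-1) ξ) / 2

/-- The symbol `e^{i t λ^σ(ξ)}`. -/
def flowSymbol (σ t : ℝ) (ξ : R3) : ℂ := Complex.exp (Complex.I * t * lambdaPM σ ξ)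

theorem continuous_flowSymbol (σ t : ℝ) : Continuous (flowSymbol σ t) := by
  unfold flowSymbol lambdaPM etaPM
  fun_prop

theorem norm_flowSymbol (σ t : ℝ) (ξ : R3) : ‖flowSymbol σ t ξ‖ = 1 := by
  have h : Complex.I * t * lambdaPM σ ξ = ((t * lambdaPM σ ξ : ℝ) : ℂ) * Complex.I := by
    push_cast; ring
  rw [flowSymbol, h, Complex.norm_exp_ofReal_mul_I]

theorem memLp_flowSymbol_mul (σ t : ℝ) (h : Lp (α := R3) ℂ 2) :
    MemLp (fun ξ : R3 => flowSymbol σ t ((2 * Real.pi) • ξ) * h ξ) 2 volume := by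
  refine (Lp.memLp h).of_le ?_ ?_
  · exact ((continuous_flowSymbol σ t).comp
      (continuous_const_smul _)).aestronglyMeasurable.mul (Lp.aestronglyMeasurable h)
  · filter_upwards with ξ
    rw [norm_mul, norm_flowSymbol, one_mul]

/-- The unitary group `e^{i t λ^σ(D)} g = 𝓕⁻¹ [e^{i t λ^σ(ξ)} 𝓕 g]` on `L²(ℝ³)`, with the `L²`
Fourier transform and the frequency convention of `lpProj`. -/
def evolution (σ t : ℝ) (g : Lp (α := R3) ℂ 2) : Lp (α := R3) ℂ 2 :=
  𝓕⁻ ((memLp_flowSymbol_mul σ t (𝓕 g)).toLp _)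

/-- The mixed norm `‖u‖_{L^r(ℝ; L^q(ℝ³))}`, with values in `[0, ∞]`. -/
def mixedNorm (q r : ℝ≥0∞) (u : ℝ → R3 → ℂ) : ℝ≥0∞ :=
  eLpNorm (fun t : ℝ => eLpNorm (u t) q volume) r volume

end

noncomputable section

/-! Write `u` for `λ⁺` and `v` for `λ⁻`. Then `ξ₃ = u v` and `|ξ|² = u² + v² - 1`, so `u ≥ 1 ≥ |v|`
and the level sets are confocal ellipsoids and hyperboloids: `λ^±` are prolate spheroidal
coordinates. The map `spheroidal` sends the sphere of radius `p` to the ellipsoid `u = √(1 + p²)`,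
with `v` the cosine of the polar angle. In these variables both phases depend on one coordinate
only.

The estimate rests on `1/|t|` decay of the kernel of `e^{itλ^±(D)}` cut off to `λ⁺ ≤ R`, with
constant of order `R³` (`norm_integral_weight_mul_exp_le`). The cut-off need not equal 1 on the
frequencies in play; being bounded, nonnegative and at least `1/2` there suffices.
`spheroidalWeight` is chosen so that its product with the Jacobian is a trigonometric polynomial in
`v`. The angular integral is then a combination of Fourier transforms of the unit sphere, that is,
of `sinc` of an explicit length `phaseLen` (`sphereFT_eq`, `integral_weight_mul_exp`). What remains
is an integral in `u` alone, with a factor `e^{iτu}` for `λ⁺` (`norm_integral_exp_sinc_le`), or with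
a displacement `c` in the length for `λ⁻` (`abs_integral_sinc_le`). Both are estimated by
integration by parts, uniformly in `x`.

The passage from dispersion to space-time bounds is the TT* argument. Interpolation of the `L¹ →
L^∞` and `L²` bounds gives decay `|t|^{-(1 - 2/q)}` in `L^{q'} → L^q`, and Hardy-Littlewood-Sobolev
in time gives the sharp line `1/q + 1/r = 1/2` with `2 < q < ∞`, at the cost `R^{3/r}`
(`mixedNorm_wave_le`).

On the frequencies `|ξ| ≤ 2^{j+1}` one takes `R = 4 · 2^{max(j,0)}`: no loss for `j ≤ 0`, a loss
`2^{3j/r}` for `j > 0`. Bernstein's inequality (`exists_eLpNorm_fourierInv_le`) moves from the sharp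
line to larger `q` and accounts for the other powers of `2^j`. For `r = ∞` it is applied directly to
the conserved `L²` norm. -/

/-! ### Oscillatory integrals in the level `u` -/

open Set in
/-- Integration by parts against a bounded primitive: the integral is controlled by the size of the
primitive and the variation of the amplitude, the latter being dominated by that of `g`. -/
theorem norm_integral_mul_deriv_le {A : Type*} [NormedRing A] [NormedAlgebra ℝ A]
    [CompleteSpace A] {a a' F f : ℝ → A} {g g' : ℝ → ℝ} {α β M : ℝ} (hαβ : α ≤ β)
    (ha : ∀ x ∈ Icc α β, HasDerivAt a (a' x) x) (hF : ∀ x ∈ Icc α β, HasDerivAt F (f x) x)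
    (hg : ∀ x ∈ Icc α β, HasDerivAt g (g' x) x) (ha' : ContinuousOn a' (Icc α β))
    (hf : ContinuousOn f (Icc α β)) (hg' : ContinuousOn g' (Icc α β))
    (hle : ∀ x ∈ Icc α β, ‖a' x‖ ≤ g' x) (hM : ∀ x ∈ Icc α β, ‖F x‖ ≤ M) :
    ‖∫ x in α..β, a x * f x‖ ≤ M * (‖a α‖ + ‖a β‖ + (g β - g α)) := by
  have hα : α ∈ Icc α β := left_mem_Icc.2 hαβ
  have hβ : β ∈ Icc α β := right_mem_Icc.2 hαβ
  rw [← uIcc_of_le hαβ] at *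
  have hM0 : 0 ≤ M := (norm_nonneg _).trans (hM α hα)
  rw [intervalIntegral.integral_mul_deriv_eq_deriv_mul ha hF ha'.intervalIntegrable
    hf.intervalIntegrable]
  have h1 : ‖∫ x in α..β, a' x * F x‖ ≤ ∫ x in α..β, M * g' x := by
    refine intervalIntegral.norm_integral_le_of_norm_le hαβ ?_
      (hg'.intervalIntegrable.const_mul M)
    filter_upwards with x hx
    have hx : x ∈ uIcc α β := by rw [uIcc_of_le hαβ]; exact Ioc_subset_Icc_self hx
    calc ‖a' x * F x‖ ≤ ‖a' x‖ * ‖F x‖ := norm_mul_le _ _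
      _ ≤ g' x * M := mul_le_mul (hle x hx) (hM x hx) (norm_nonneg _)
          ((norm_nonneg _).trans (hle x hx))
      _ = M * g' x := mul_comm _ _
  rw [intervalIntegral.integral_const_mul,
    intervalIntegral.integral_eq_sub_of_hasDerivAt hg hg'.intervalIntegrable] at h1
  have h2 : ‖a β * F β‖ ≤ ‖a β‖ * M :=
    (norm_mul_le _ _).trans (mul_le_mul_of_nonneg_left (hM β hβ) (norm_nonneg _))
  have h3 : ‖a α * F α‖ ≤ ‖a α‖ * M :=
    (norm_mul_le _ _).trans (mul_le_mul_of_nonneg_left (hM α hα) (norm_nonneg _))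
  calc _ ≤ ‖a β * F β‖ + ‖a α * F α‖ + ‖∫ x in α..β, a' x * F x‖ :=
        (norm_sub_le _ _).trans (add_le_add_left (norm_sub_le _ _) _)
    _ ≤ ‖a β‖ * M + ‖a α‖ * M + M * (g β - g α) := by gcongr
    _ = _ := by ring

/-- The squared length of the frequency vector `(√(u² - 1) X, u z + c)`. -/
def phaseSq (X z c u : ℝ) : ℝ := (u ^ 2 - 1) * X ^ 2 + (u * z + c) ^ 2

/-- The length of the frequency vector `(√(u² - 1) X, u z + c)`. -/
def phaseLen (X z c u : ℝ) : ℝ := √(phaseSq X z c u)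

section phase

variable {X z c u : ℝ}

theorem phaseSq_pos (hX : 0 < X) (hu : 1 < u) : 0 < phaseSq X z c u := by
  have : 0 < u ^ 2 - 1 := by nlinarith
  unfold phaseSq; positivity

theorem phaseLen_pos (hX : 0 < X) (hu : 1 < u) : 0 < phaseLen X z c u :=
  Real.sqrt_pos.2 (phaseSq_pos hX hu)

theorem sq_phaseLen (hX : 0 < X) (hu : 1 < u) : phaseLen X z c u ^ 2 = phaseSq X z c u :=
  Real.sq_sqrt (phaseSq_pos hX hu).le

theorem continuous_phaseLen : Continuous (phaseLen X z c) := by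
  unfold phaseLen phaseSq; fun_prop

theorem hasDerivAt_phaseLen (hX : 0 < X) (hu : 1 < u) :
    HasDerivAt (phaseLen X z c) (((X ^ 2 + z ^ 2) * u + c * z) / phaseLen X z c u) u := by
  have h : HasDerivAt (phaseSq X z c) (2 * ((X ^ 2 + z ^ 2) * u + c * z)) u := by
    have h1 : HasDerivAt (fun u : ℝ => (u ^ 2 - 1) * X ^ 2 + (u * z + c) ^ 2)
        ((2 * u) * X ^ 2 + 2 * (u * z + c) * z) u := by
      have := ((((hasDerivAt_id u).pow 2).sub_const 1).mul_const (X ^ 2)).add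
        ((((hasDerivAt_id u).mul_const z).add_const c).pow 2)
      convert! this using 1
      simp
    convert! h1 using 1
    ring
  convert! h.sqrt (phaseSq_pos hX hu).ne' using 1
  rw [phaseLen]; field_simp

theorem abs_le_phaseLen (hu : 1 ≤ u) : |u * z + c| ≤ phaseLen X z c u := by
  rw [← Real.sqrt_sq_eq_abs]
  apply Real.sqrt_le_sqrt
  have : 0 ≤ u ^ 2 - 1 := by nlinarith
  unfold phaseSq
  nlinarith [mul_nonneg this (sq_nonneg X)]

end phase

theorem abs_sinc_le_inv {x : ℝ} (hx : 0 < x) : |Real.sinc x| ≤ x⁻¹ := by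
  rw [Real.sinc_of_ne_zero hx.ne', abs_div, abs_of_pos hx, div_eq_mul_inv]
  exact mul_le_of_le_one_left (by positivity) (Real.abs_sin_le_one x)

theorem abs_integral_le_of_abs_le {f : ℝ → ℝ} {α β M : ℝ} (hαβ : α ≤ β)
    (h : ∀ x ∈ Set.Icc α β, |f x| ≤ M) : |∫ x in α..β, f x| ≤ M * (β - α) := by
  have := intervalIntegral.norm_integral_le_of_norm_le_const (a := α) (b := β) (f := f) (C := M)
    (fun x hx => h x (by
      rw [Set.uIoc_of_le hαβ] at hx; exact Set.Ioc_subset_Icc_self hx))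
  rwa [abs_of_nonneg (sub_nonneg.2 hαβ)] at this

-- Put `ρ` for `phaseLen`. Since `ρ ρ' = r² (u - v)`, with `v` the critical point of `ρ²`, one has
-- `r² (u - v) sinc ρ = (-cos ρ)'`. Integrating by parts against the bounded primitive `-cos ρ`
-- costs no negative power of `ρ`, and at distance `r⁻¹` from `v` the amplitude `b / (r² (u - v))`
-- is at most `B / r`.
open Set in
theorem abs_integral_sinc_away {X z c α β B r v : ℝ} {b b' : ℝ → ℝ} (hX : 0 < X)
    (hα : 1 < α) (hαβ : α ≤ β) (hr : 0 < r) (hr2 : r ^ 2 = X ^ 2 + z ^ 2)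
    (hv : r ^ 2 * v = - (c * z))
    (hb : ∀ u, HasDerivAt b (b' u) u) (hb'c : Continuous b')
    (hb'0 : ∀ u ∈ Icc α β, 0 ≤ b' u) (hb0 : ∀ u ∈ Icc α β, 0 ≤ b u)
    (hbB : ∀ u ∈ Icc α β, b u ≤ B) (haway : ∀ u ∈ Icc α β, r⁻¹ ≤ |u - v|) :
    |∫ u in α..β, b u * Real.sinc (phaseLen X z c u)| ≤ 5 * B / r := by
  have hαm : α ∈ Icc α β := left_mem_Icc.2 hαβ
  have hβm : β ∈ Icc α β := right_mem_Icc.2 hαβ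
  have hB : 0 ≤ B := (hb0 α hαm).trans (hbB α hαm)
  have hne : ∀ u ∈ Icc α β, u - v ≠ 0 := fun u hu h => by
    have := haway u hu
    rw [h, abs_zero] at this
    exact absurd this (not_le.2 (inv_pos.2 hr))
  have hinv : ∀ u ∈ Icc α β, |(u - v)⁻¹| ≤ r := fun u hu => by
    rw [abs_inv]
    exact inv_le_of_inv_le₀ hr (haway u hu)
  have hbc : Continuous b := continuous_iff_continuousAt.2 fun u => (hb u).continuousAt
  have hinvd : ∀ u ∈ Icc α β, HasDerivAt (fun u => (u - v)⁻¹) (-((u - v)⁻¹) ^ 2) u := by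
    intro u hu
    convert! ((hasDerivAt_id u).sub_const v).inv (hne u hu) using 1
    simp [div_eq_mul_inv]
  have hinvc : ContinuousOn (fun u => (u - v)⁻¹) (Icc α β) := fun u hu =>
    (hinvd u hu).continuousAt.continuousWithinAt
  have key := norm_integral_mul_deriv_le (A := ℝ) (M := 1) hαβ
    (a := fun u => b u * (r ^ 2)⁻¹ * (u - v)⁻¹)
    (a' := fun u => b' u * (r ^ 2)⁻¹ * (u - v)⁻¹ + b u * (r ^ 2)⁻¹ * (-((u - v)⁻¹) ^ 2))
    (F := fun u => - Real.cos (phaseLen X z c u))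
    (f := fun u => r ^ 2 * (u - v) * Real.sinc (phaseLen X z c u))
    -- A function with nonnegative derivative whose increase dominates the variation of the
    -- amplitude: at most `B / r` from `b` and `2B / r` from `(u - v)⁻¹`. With the two boundary
    -- terms this makes the factor 5.
    (g := fun u => r⁻¹ * b u - B * (r ^ 2)⁻¹ * (u - v)⁻¹)
    (g' := fun u => r⁻¹ * b' u - B * (r ^ 2)⁻¹ * (-((u - v)⁻¹) ^ 2))
    (fun u hu => ((hb u).mul_const _).mul (hinvd u hu))
    (fun u hu => by
      have hu1 : 1 < u := hα.trans_le hu.1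
      have hp := phaseLen_pos (z := z) (c := c) hX hu1
      convert! (hasDerivAt_phaseLen (z := z) (c := c) hX hu1).cos.neg using 1
      rw [Real.sinc_of_ne_zero hp.ne', mul_sub, hv, hr2]
      field_simp
      ring)
    (fun u hu => ((hb u).const_mul _).sub ((hinvd u hu).const_mul _))
    (((hb'c.continuousOn.mul continuousOn_const).mul hinvc).add
      ((hbc.continuousOn.mul continuousOn_const).mul (hinvc.pow 2).neg))
    (by
      have := Real.continuous_sinc.comp (continuous_phaseLen (X := X) (z := z) (c := c))
      exact (Continuous.mul (by fun_prop) this).continuousOn)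
    ((continuousOn_const.mul hb'c.continuousOn).sub
      (continuousOn_const.mul (hinvc.pow 2).neg))
    (fun u hu => by
      have h1 := hinv u hu
      have h2 : |b' u * (r ^ 2)⁻¹ * (u - v)⁻¹| ≤ r⁻¹ * b' u := by
        rw [abs_mul, abs_mul, abs_of_nonneg (hb'0 u hu), abs_of_pos (inv_pos.2 (pow_pos hr 2))]
        calc _ ≤ b' u * (r ^ 2)⁻¹ * r := by
              have := hb'0 u hu
              gcongr
          _ = _ := by field_simp
      have h3 : |b u * (r ^ 2)⁻¹ * (-((u - v)⁻¹) ^ 2)| ≤ B * (r ^ 2)⁻¹ * ((u - v)⁻¹) ^ 2 := by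
        rw [mul_neg, abs_neg, abs_mul, abs_mul, abs_of_nonneg (hb0 u hu),
          abs_of_pos (inv_pos.2 (pow_pos hr 2)), abs_of_nonneg (sq_nonneg _)]
        have := hbB u hu
        gcongr
      refine (abs_add_le _ _).trans ((add_le_add h2 h3).trans (le_of_eq ?_))
      ring)
    (fun u hu => by
      rw [norm_neg]
      exact Real.abs_cos_le_one _)
  have hint : (∫ u in α..β, b u * (r ^ 2)⁻¹ * (u - v)⁻¹ *
        (r ^ 2 * (u - v) * Real.sinc (phaseLen X z c u))) =
      ∫ u in α..β, b u * Real.sinc (phaseLen X z c u) := by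
    refine intervalIntegral.integral_congr fun u hu => ?_
    rw [uIcc_of_le hαβ] at hu
    have := hne u hu
    field_simp
  rw [hint] at key
  have ha : ∀ u ∈ Icc α β, |b u * (r ^ 2)⁻¹ * (u - v)⁻¹| ≤ B / r := fun u hu => by
    rw [abs_mul, abs_mul, abs_of_nonneg (hb0 u hu), abs_of_pos (inv_pos.2 (pow_pos hr 2))]
    calc _ ≤ B * (r ^ 2)⁻¹ * r := by
          have := hbB u hu
          have := hinv u hu
          gcongr
      _ = _ := by field_simp
  have hB' : ∀ u ∈ Icc α β, |B * (r ^ 2)⁻¹ * (u - v)⁻¹| ≤ B / r := fun u hu => by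
    rw [abs_mul, abs_mul, abs_of_nonneg hB, abs_of_pos (inv_pos.2 (pow_pos hr 2))]
    calc _ ≤ B * (r ^ 2)⁻¹ * r := by
          have := hinv u hu
          gcongr
      _ = _ := by field_simp
  have hbr : r⁻¹ * b β ≤ B / r := by
    rw [div_eq_inv_mul]
    have := hbB β hβm
    gcongr
  have hbr' : 0 ≤ r⁻¹ * b α := mul_nonneg (inv_pos.2 hr).le (hb0 α hαm)
  have e1 := ha α hαm
  have e2 := ha β hβm
  have e3 := abs_le.1 (hB' α hαm)
  have e4 := abs_le.1 (hB' β hβm)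
  simp only [Real.norm_eq_abs] at key
  have : 5 * B / r = 5 * (B / r) := by ring
  linarith [e3.1, e3.2, e4.1, e4.2]

-- The two sides of the critical point give `5B / r` each; the window of length `2 / r` around it
-- gives `2B / r` from `|sinc| ≤ 1`.
open Set in
theorem abs_integral_sinc_le_div {X z c α R B r : ℝ} {b b' : ℝ → ℝ} (hX : 0 < X)
    (hα : 1 < α) (hαR : α ≤ R) (hr : 0 < r) (hr2 : r ^ 2 = X ^ 2 + z ^ 2)
    (hb : ∀ u, HasDerivAt b (b' u) u) (hb'c : Continuous b')
    (hb'0 : ∀ u ∈ Icc α R, 0 ≤ b' u) (hb0 : ∀ u ∈ Icc α R, 0 ≤ b u)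
    (hbB : ∀ u ∈ Icc α R, b u ≤ B) :
    |∫ u in α..R, b u * Real.sinc (phaseLen X z c u)| ≤ 12 * B / r := by
  have hB : 0 ≤ B := (hb0 α (left_mem_Icc.2 hαR)).trans (hbB α (left_mem_Icc.2 hαR))
  have hri := inv_pos.2 hr
  have hBr : 0 ≤ B / r := by positivity
  set v := -(c * z) / r ^ 2 with hvdef
  have hv : r ^ 2 * v = - (c * z) := by rw [hvdef]; field_simp
  -- The ends of the window around `v`, clamped to `[α, R]`, so that every position of `v` is
  -- treated at once, with some pieces possibly degenerate.
  set p := max α (min R (v - r⁻¹)) with hp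
  set p' := max α (min R (v + r⁻¹)) with hp'
  have hαp : α ≤ p := le_max_left _ _
  have hpR : p ≤ R := max_le hαR (min_le_left _ _)
  have hαp' : α ≤ p' := le_max_left _ _
  have hpR' : p' ≤ R := max_le hαR (min_le_left _ _)
  have hpp : p ≤ p' := max_le_max le_rfl (min_le_min le_rfl (by linarith))
  have hlen : p' - p ≤ 2 * r⁻¹ := by
    rw [hp, hp']
    rcases le_total R (v - r⁻¹) with h | h <;> rcases le_total R (v + r⁻¹) with h' | h' <;>
    simp only [min_eq_left h, min_eq_right h, min_eq_left h', min_eq_right h', max_def] <;>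
    split_ifs <;> linarith
  have hbc : Continuous b := continuous_iff_continuousAt.2 fun u => (hb u).continuousAt
  have hI : ∀ s t, IntervalIntegrable (fun u => b u * Real.sinc (phaseLen X z c u))
      volume s t := fun s t =>
    (hbc.mul (Real.continuous_sinc.comp continuous_phaseLen)).intervalIntegrable _ _
  rw [← intervalIntegral.integral_add_adjacent_intervals (hI α p) (hI p R),
    ← intervalIntegral.integral_add_adjacent_intervals (hI p p') (hI p' R)]
  have h1 : |∫ u in α..p, b u * Real.sinc (phaseLen X z c u)| ≤ 5 * (B / r) := by
    rcases hαp.eq_or_lt with h | h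
    · rw [← h, intervalIntegral.integral_same, abs_zero]; positivity
    rw [← mul_div_assoc]
    refine abs_integral_sinc_away hX hα hαp hr hr2 hv hb hb'c
      (fun u hu => hb'0 u ⟨hu.1, hu.2.trans hpR⟩) (fun u hu => hb0 u ⟨hu.1, hu.2.trans hpR⟩)
      (fun u hu => hbB u ⟨hu.1, hu.2.trans hpR⟩) fun u hu => ?_
    have : p ≤ v - r⁻¹ := by
      rcases le_max_iff.1 (le_refl p) with h' | h'
      · exact absurd h (not_lt.2 h')
      · exact h'.trans (min_le_right _ _)
    rw [abs_sub_comm]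
    exact le_trans (by linarith [hu.2]) (le_abs_self _)
  have h3 : |∫ u in p'..R, b u * Real.sinc (phaseLen X z c u)| ≤ 5 * (B / r) := by
    rcases hpR'.eq_or_lt with h | h
    · rw [h, intervalIntegral.integral_same, abs_zero]; positivity
    rw [← mul_div_assoc]
    refine abs_integral_sinc_away hX (hα.trans_le hαp') hpR' hr hr2 hv hb hb'c
      (fun u hu => hb'0 u ⟨hαp'.trans hu.1, hu.2⟩) (fun u hu => hb0 u ⟨hαp'.trans hu.1, hu.2⟩)
      (fun u hu => hbB u ⟨hαp'.trans hu.1, hu.2⟩) fun u hu => ?_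
    have : v + r⁻¹ ≤ p' := by
      rcases min_le_iff.1 (le_of_eq (rfl : min R (v + r⁻¹) = min R (v + r⁻¹))) with h' | h'
      · exact absurd ((h'.trans (le_max_right α _))) (not_le.2 h)
      · exact h'.trans (le_max_right _ _)
    exact le_trans (by linarith [hu.1]) (le_abs_self _)
  have h2 : |∫ u in p..p', b u * Real.sinc (phaseLen X z c u)| ≤ 2 * (B / r) := by
    refine (abs_integral_le_of_abs_le (M := B) hpp fun u hu => ?_).trans ?_
    · have hu' : u ∈ Icc α R := ⟨hαp.trans hu.1, hu.2.trans hpR'⟩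
      rw [abs_mul, abs_of_nonneg (hb0 u hu')]
      exact (mul_le_of_le_one_right (hb0 u hu') (Real.abs_sinc_le_one _)).trans (hbB u hu')
    · calc _ ≤ B * (2 * r⁻¹) := by gcongr
        _ = _ := by ring
  have : 12 * B / r = 12 * (B / r) := by ring
  rw [this]
  refine (abs_add_le _ _).trans ?_
  have := abs_add_le (∫ u in p..p', b u * Real.sinc (phaseLen X z c u))
    (∫ u in p'..R, b u * Real.sinc (phaseLen X z c u))
  linarith

open Set in
/-- Decay in `c` of the `u`-integral of the Fourier transform of the sphere. -/
theorem abs_integral_sinc_le {X z c α R B : ℝ} {b b' : ℝ → ℝ} (hX : 0 < X)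
    (hα : 1 < α) (hαR : α ≤ R) (hc : c ≠ 0)
    (hb : ∀ u, HasDerivAt b (b' u) u) (hb'c : Continuous b')
    (hb'0 : ∀ u ∈ Icc α R, 0 ≤ b' u) (hb0 : ∀ u ∈ Icc α R, 0 ≤ b u)
    (hbB : ∀ u ∈ Icc α R, b u ≤ B) :
    |∫ u in α..R, b u * Real.sinc (phaseLen X z c u)| ≤ 24 * B * R / |c| := by
  have hB : 0 ≤ B := (hb0 α (left_mem_Icc.2 hαR)).trans (hbB α (left_mem_Icc.2 hαR))
  have hc' := abs_pos.2 hc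
  have hR : 1 < R := hα.trans_le hαR
  -- If `z` is small then `|u z + c| ≥ |c| / 2`, which bounds the length from below and `sinc` by `2
  -- / |c|`. Otherwise `r ≥ |z| > |c| / (2R)`, and decay in `r` is decay in `c`.
  by_cases hz : |z| * R ≤ |c| / 2
  · refine (abs_integral_le_of_abs_le (M := B * (2 / |c|)) hαR fun u hu => ?_).trans ?_
    · have hu1 : 1 < u := hα.trans_le hu.1
      have h1 : |c| / 2 ≤ phaseLen X z c u := by
        refine le_trans ?_ (abs_le_phaseLen hu1.le)
        have h2 : |u * z| ≤ |z| * R := by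
          rw [abs_mul, abs_of_pos (by linarith), mul_comm]
          have := hu.2
          gcongr
        have h3 := abs_sub_abs_le_abs_sub c (-(u * z))
        rw [abs_neg, sub_neg_eq_add, add_comm c] at h3
        linarith
      rw [abs_mul, abs_of_nonneg (hb0 u hu)]
      refine mul_le_mul (hbB u hu) ?_ (abs_nonneg _) hB
      refine (abs_sinc_le_inv (phaseLen_pos hX hu1)).trans ?_
      rw [inv_le_comm₀ (phaseLen_pos hX hu1) (by positivity), inv_div]
      exact h1
    · calc B * (2 / |c|) * (R - α) ≤ B * (2 / |c|) * R := by gcongr; linarith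
        _ = 2 * B * R / |c| := by ring
        _ ≤ _ := by gcongr; norm_num
  · push Not at hz
    have hr : 0 < √(X ^ 2 + z ^ 2) := Real.sqrt_pos.2 (by positivity)
    refine (abs_integral_sinc_le_div hX hα hαR hr (Real.sq_sqrt (by positivity)) hb hb'c hb'0
      hb0 hbB).trans ?_
    have hzr : |z| ≤ √(X ^ 2 + z ^ 2) := by
      rw [← Real.sqrt_sq_eq_abs]
      exact Real.sqrt_le_sqrt (by nlinarith [sq_nonneg X])
    rw [div_le_div_iff₀ hr hc']
    have : |c| ≤ 2 * (R * √(X ^ 2 + z ^ 2)) := by nlinarith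
    nlinarith [mul_le_mul_of_nonneg_left this hB]

theorem integral_exp_mul_sinc (x : ℝ) :
    ∫ θ in (-1 : ℝ)..1, Complex.exp ((θ * x : ℝ) * Complex.I) = 2 * Real.sinc x := by
  rcases eq_or_ne x 0 with rfl | hx
  · simp; norm_num
  have h := intervalIntegral.integral_comp_mul_right (a := -1) (b := 1)
    (fun t : ℝ => Complex.exp (t * Complex.I)) hx
  rw [h, neg_one_mul, one_mul, integral_exp_mul_I_eq_sinc, Complex.real_smul]
  have : (x : ℂ) ≠ 0 := by exact_mod_cast hx
  push_cast
  field_simp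

-- `sinc ρ` is the mean of `e^{iθρ}` over `θ ∈ [-1, 1]`, so a bound uniform in `θ` passes to it by
-- Fubini. This turns the `sinc` into genuine phases `τu + θρ`.
open Set in
theorem norm_integral_mul_sinc_le {A : ℝ → ℂ} {ρ : ℝ → ℝ} {α β M : ℝ} (hA : Continuous A)
    (hρ : Continuous ρ)
    (hM : ∀ θ ∈ Icc (-1 : ℝ) 1, ‖∫ u in α..β, A u * Complex.exp ((θ * ρ u : ℝ) * Complex.I)‖ ≤ M) :
    ‖∫ u in α..β, A u * (Real.sinc (ρ u) : ℂ)‖ ≤ M := by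
  have h1 : ∀ u, A u * (Real.sinc (ρ u) : ℂ) =
      2⁻¹ * ∫ θ in (-1 : ℝ)..1, A u * Complex.exp ((θ * ρ u : ℝ) * Complex.I) := fun u => by
    rw [intervalIntegral.integral_const_mul, integral_exp_mul_sinc]; ring
  simp_rw [h1]
  rw [intervalIntegral.integral_const_mul, intervalIntegral_intervalIntegral_swap]
  · have := intervalIntegral.norm_integral_le_of_norm_le_const (a := -1) (b := 1) (C := M)
      (f := fun θ : ℝ => ∫ u in α..β, A u * Complex.exp ((θ * ρ u : ℝ) * Complex.I))
      (fun θ hθ => hM θ (by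
        rw [uIoc_of_le (by norm_num)] at hθ; exact Ioc_subset_Icc_self hθ))
    rw [norm_mul]
    norm_num at this ⊢
    linarith
  · have hc : Continuous (Function.uncurry fun u θ : ℝ =>
        A u * Complex.exp ((θ * ρ u : ℝ) * Complex.I)) := by fun_prop
    exact ((hc.continuousOn.integrableOn_compact
      (isCompact_uIcc.prod isCompact_uIcc)).mono_set
        (prod_mono uIoc_subset_uIcc uIoc_subset_uIcc))

section phase

variable {X z c u : ℝ}

/-- Purpose: the second derivative of the length has a sign, so the length is concave in `u` as soon
as `c² ≤ X² + z²`. Monotonicity of its slope replaces a second-derivative test. -/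
theorem hasDerivAt_phaseLen_deriv (hX : 0 < X) (hu : 1 < u) :
    HasDerivAt (fun u => ((X ^ 2 + z ^ 2) * u + c * z) / phaseLen X z c u)
      (-(X ^ 2 * (X ^ 2 + z ^ 2 - c ^ 2) / phaseLen X z c u ^ 3)) u := by
  have hp := phaseLen_pos (z := z) (c := c) hX hu
  have h1 : HasDerivAt (fun u : ℝ => (X ^ 2 + z ^ 2) * u + c * z) (X ^ 2 + z ^ 2) u := by
    simpa using ((hasDerivAt_id u).const_mul (X ^ 2 + z ^ 2)).add_const (c * z)
  convert! h1.div (hasDerivAt_phaseLen (z := z) (c := c) hX hu) hp.ne' using 1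
  have hs := sq_phaseLen (z := z) (c := c) hX hu
  have h3 : phaseLen X z c u ^ 3 = phaseLen X z c u * phaseSq X z c u := by rw [← hs]; ring
  have hq := (phaseSq_pos (z := z) (c := c) hX hu).ne'
  rw [h3, hs]
  field_simp
  rw [hs, phaseSq]
  ring

end phase

theorem hasDerivAt_exp_ofReal_mul_I {f : ℝ → ℝ} {f' x : ℝ} (hf : HasDerivAt f f' x) :
    HasDerivAt (fun x => Complex.exp ((f x : ℝ) * Complex.I))
      ((f' : ℂ) * Complex.I * Complex.exp ((f x : ℝ) * Complex.I)) x := by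
  convert! (hf.ofReal_comp.mul_const Complex.I).cexp using 1
  ring

open Set in
/-- Nonstationary regime: where the derivative of the length is at most half of the frequency. -/
theorem norm_integral_exp_phaseLen_le {X z c τ α β B θ : ℝ} {b b' : ℝ → ℝ} (hX : 0 < X)
    (hτ : 0 < τ) (hα : 1 < α) (hαβ : α ≤ β) (hcr : c ^ 2 ≤ X ^ 2 + z ^ 2)
    (hθ : θ ∈ Icc (-1 : ℝ) 1)
    (hb : ∀ u, HasDerivAt b (b' u) u) (hb'c : Continuous b')
    (hb'0 : ∀ u ∈ Icc α β, 0 ≤ b' u) (hb0 : ∀ u ∈ Icc α β, 0 ≤ b u)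
    (hbB : ∀ u ∈ Icc α β, b u ≤ B)
    (hq0 : ∀ u ∈ Icc α β, 0 ≤ ((X ^ 2 + z ^ 2) * u + c * z) / phaseLen X z c u)
    (hq : ∀ u ∈ Icc α β, ((X ^ 2 + z ^ 2) * u + c * z) / phaseLen X z c u ≤ τ / 2) :
    ‖∫ u in α..β, (b u : ℂ) * Complex.exp ((τ * u + θ * phaseLen X z c u : ℝ) * Complex.I)‖ ≤
      8 * B / τ := by
  have hαm : α ∈ Icc α β := left_mem_Icc.2 hαβ
  have hβm : β ∈ Icc α β := right_mem_Icc.2 hαβ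
  have hB : 0 ≤ B := (hb0 α hαm).trans (hbB α hαm)
  set q : ℝ → ℝ := fun u => ((X ^ 2 + z ^ 2) * u + c * z) / phaseLen X z c u with hqdef
  set q' : ℝ → ℝ := fun u => -(X ^ 2 * (X ^ 2 + z ^ 2 - c ^ 2) / phaseLen X z c u ^ 3) with hq'def
  have h1 : ∀ u ∈ Icc α β, 1 < u := fun u hu => hα.trans_le hu.1
  have hpos : ∀ u ∈ Icc α β, 0 < phaseLen X z c u := fun u hu => phaseLen_pos hX (h1 u hu)
  have hq'0 : ∀ u ∈ Icc α β, q' u ≤ 0 := fun u hu => by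
    have := hpos u hu
    have : 0 ≤ X ^ 2 + z ^ 2 - c ^ 2 := by linarith
    exact neg_nonpos.2 (by positivity)
  have hqd : ∀ u ∈ Icc α β, HasDerivAt q (q' u) u := fun u hu =>
    hasDerivAt_phaseLen_deriv hX (h1 u hu)
  have hqc : ContinuousOn q (Icc α β) := fun u hu => (hqd u hu).continuousAt.continuousWithinAt
  have hq'c : ContinuousOn q' (Icc α β) :=
    (continuousOn_const.div (continuous_phaseLen.continuousOn.pow 3)
      fun u hu => (pow_pos (hpos u hu) 3).ne').neg
  have hbc : Continuous b := continuous_iff_continuousAt.2 fun u => (hb u).continuousAt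
  have hφ : ∀ u ∈ Icc α β, τ / 2 ≤ τ + θ * q u := fun u hu => by
    have h2 : -q u ≤ θ * q u := by nlinarith [hθ.1, hq0 u hu]
    have := hq u hu
    simp only [hqdef] at h2 ⊢
    linarith
  have hφ0 : ∀ u ∈ Icc α β, τ + θ * q u ≠ 0 := fun u hu => by
    exact (lt_of_lt_of_le (by positivity) (hφ u hu)).ne'
  have hinv : ∀ u ∈ Icc α β, (τ + θ * q u)⁻¹ ≤ 2 / τ := fun u hu => by
    rw [inv_le_comm₀ (lt_of_lt_of_le (by positivity) (hφ u hu)) (by positivity), inv_div]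
    exact hφ u hu
  have hinv0 : ∀ u ∈ Icc α β, 0 < (τ + θ * q u)⁻¹ := fun u hu =>
    inv_pos.2 (lt_of_lt_of_le (by positivity) (hφ u hu))
  have hinvd : ∀ u ∈ Icc α β, HasDerivAt (fun u => (τ + θ * q u)⁻¹)
      (-(θ * q' u) * ((τ + θ * q u)⁻¹) ^ 2) u := fun u hu => by
    convert! (((hqd u hu).const_mul θ).const_add τ).inv (hφ0 u hu) using 1
    simp [div_eq_mul_inv]
  have hinvc : ContinuousOn (fun u => (τ + θ * q u)⁻¹) (Icc α β) := fun u hu =>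
    (hinvd u hu).continuousAt.continuousWithinAt
  have key := norm_integral_mul_deriv_le (A := ℂ) (M := 1) hαβ
    (a := fun u => ((b u * (τ + θ * q u)⁻¹ : ℝ) : ℂ))
    (a' := fun u => ((b' u * (τ + θ * q u)⁻¹ +
      b u * (-(θ * q' u) * ((τ + θ * q u)⁻¹) ^ 2) : ℝ) : ℂ))
    (F := fun u => -Complex.I * Complex.exp ((τ * u + θ * phaseLen X z c u : ℝ) * Complex.I))
    (f := fun u => ((τ + θ * q u : ℝ) : ℂ) *
      Complex.exp ((τ * u + θ * phaseLen X z c u : ℝ) * Complex.I))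
    -- As the slope `q` decreases from at most `τ/2` to at least `0`, the term `-B (2/τ)² q`
    -- increases by at most `2B/τ`; the term with `b` and the two boundary terms are each at most
    -- `2B/τ` as well, hence `8B/τ`.
    (g := fun u => 2 / τ * b u - B * (2 / τ) ^ 2 * q u)
    (g' := fun u => 2 / τ * b' u - B * (2 / τ) ^ 2 * q' u)
    (fun u hu => ((hb u).mul (hinvd u hu)).ofReal_comp)
    (fun u hu => by
      have := (hasDerivAt_exp_ofReal_mul_I (((hasDerivAt_id u).const_mul τ).add
        ((hasDerivAt_phaseLen (z := z) (c := c) hX (h1 u hu)).const_mul θ))).const_mul (-Complex.I)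
      convert! this using 1
      rw [mul_one]
      change _ = -Complex.I * (((τ + θ * q u : ℝ) : ℂ) * Complex.I *
        Complex.exp ((τ * u + θ * phaseLen X z c u : ℝ) * Complex.I))
      linear_combination (((τ + θ * q u : ℝ) : ℂ) *
        Complex.exp ((τ * u + θ * phaseLen X z c u : ℝ) * Complex.I)) * Complex.I_sq)
    (fun u hu => ((hb u).const_mul _).sub ((hqd u hu).const_mul _))
    (Complex.continuous_ofReal.comp_continuousOn
      ((hb'c.continuousOn.mul hinvc).add (hbc.continuousOn.mul
        ((continuousOn_const.mul hq'c).neg.mul (hinvc.pow 2)))))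
    ((Complex.continuous_ofReal.comp_continuousOn
      (continuousOn_const.add (continuousOn_const.mul hqc))).mul
      (by
        have : Continuous (phaseLen X z c) := continuous_phaseLen
        exact Continuous.continuousOn (by fun_prop)))
    ((continuousOn_const.mul hb'c.continuousOn).sub (continuousOn_const.mul hq'c))
    (fun u hu => by
      have h2 := hinv u hu
      have h3 := (hinv0 u hu).le
      rw [Complex.norm_real, Real.norm_eq_abs]
      have e1 : |b' u * (τ + θ * q u)⁻¹| ≤ 2 / τ * b' u := by
        rw [abs_mul, abs_of_nonneg (hb'0 u hu), abs_of_nonneg h3, mul_comm]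
        exact mul_le_mul_of_nonneg_right h2 (hb'0 u hu)
      have e2 : |b u * (-(θ * q' u) * ((τ + θ * q u)⁻¹) ^ 2)| ≤ B * (2 / τ) ^ 2 * (-q' u) := by
        rw [abs_mul, abs_mul, abs_neg, abs_mul, abs_of_nonneg (hb0 u hu),
          abs_of_nonpos (hq'0 u hu), abs_of_nonneg (sq_nonneg (τ + θ * q u)⁻¹)]
        have h4 := neg_nonneg.2 (hq'0 u hu)
        have h5 : |θ| ≤ 1 := abs_le.2 hθ
        calc b u * (|θ| * -q' u * ((τ + θ * q u)⁻¹) ^ 2)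
            ≤ B * (1 * -q' u * (2 / τ) ^ 2) := by
              have := hbB u hu
              gcongr
          _ = _ := by ring
      refine (abs_add_le _ _).trans ((add_le_add e1 e2).trans (le_of_eq ?_))
      ring)
    (fun u hu => by
      rw [norm_mul, Complex.norm_exp_ofReal_mul_I]; simp)
  have hint : (∫ u in α..β, ((b u * (τ + θ * q u)⁻¹ : ℝ) : ℂ) * (((τ + θ * q u : ℝ) : ℂ) *
      Complex.exp ((τ * u + θ * phaseLen X z c u : ℝ) * Complex.I))) =
      ∫ u in α..β, (b u : ℂ) *
        Complex.exp ((τ * u + θ * phaseLen X z c u : ℝ) * Complex.I) := by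
    refine intervalIntegral.integral_congr fun u hu => ?_
    rw [uIcc_of_le hαβ] at hu
    rw [← mul_assoc, ← Complex.ofReal_mul, mul_assoc, inv_mul_cancel₀ (hφ0 u hu), mul_one]
  rw [hint] at key
  have ha : ∀ u ∈ Icc α β, ‖((b u * (τ + θ * q u)⁻¹ : ℝ) : ℂ)‖ ≤ 2 / τ * B := fun u hu => by
    rw [Complex.norm_real, Real.norm_eq_abs, abs_mul, abs_of_nonneg (hb0 u hu),
      abs_of_pos (hinv0 u hu), mul_comm]
    exact mul_le_mul (hinv u hu) (hbB u hu) (hb0 u hu) (by positivity)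
  have e1 := ha α hαm
  have e2 := ha β hβm
  have e3 : 2 / τ * b β ≤ 2 / τ * B := by have := hbB β hβm; gcongr
  have e4 : 0 ≤ 2 / τ * b α := mul_nonneg (by positivity) (hb0 α hαm)
  have e5 : B * (2 / τ) ^ 2 * q α ≤ 2 / τ * B := by
    have := hq α hαm
    calc B * (2 / τ) ^ 2 * q α ≤ B * (2 / τ) ^ 2 * (τ / 2) := by gcongr
      _ = _ := by field_simp
  have e6 : 0 ≤ B * (2 / τ) ^ 2 * q β := mul_nonneg (by positivity) (hq0 β hβm)
  have : 8 * B / τ = 4 * (2 / τ * B) := by ring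
  rw [one_mul] at key
  linarith

open Set in
/-- Regime where the derivative of the length is large: the decay of the sphere suffices. -/
theorem norm_integral_sinc_le_of_le_deriv {X z c τ α β R B : ℝ} {b : ℝ → ℝ} {e : ℝ → ℂ}
    (hX : 0 < X) (hτ : 0 < τ) (hα : 1 < α) (hαβ : α ≤ β) (hβR : β ≤ R)
    (hcz : |c * z| ≤ (X ^ 2 + z ^ 2) / 2) (hb0 : ∀ u ∈ Icc α β, 0 ≤ b u)
    (hbB : ∀ u ∈ Icc α β, b u ≤ B) (he : ∀ u, ‖e u‖ ≤ 1)
    (hq : τ / 2 ≤ ((X ^ 2 + z ^ 2) * β + c * z) / phaseLen X z c β) :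
    ‖∫ u in α..β, e u * ((u * b u : ℝ) : ℂ) * (Real.sinc (phaseLen X z c u) : ℂ)‖ ≤
      6 * B * R / τ := by
  have hαm : α ∈ Icc α β := left_mem_Icc.2 hαβ
  have hβm : β ∈ Icc α β := right_mem_Icc.2 hαβ
  have hB : 0 ≤ B := (hb0 α hαm).trans (hbB α hαm)
  have hr : 0 < X ^ 2 + z ^ 2 := by positivity
  have h1 : ∀ u ∈ Icc α β, 1 < u := fun u hu => hα.trans_le hu.1
  have hpos : ∀ u ∈ Icc α β, 0 < phaseLen X z c u := fun u hu => phaseLen_pos hX (h1 u hu)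
  set q : ℝ → ℝ := fun u => ((X ^ 2 + z ^ 2) * u + c * z) / phaseLen X z c u with hqdef
  -- This lets `u / ρ` be dominated by `2ρ' / (X² + z²)`, which integrates exactly. The slope
  -- hypothesis at the endpoint `β` then bounds `ρ(β)` by `3 (X² + z²) R / τ`.
  have hlow : ∀ u ∈ Icc α β, (X ^ 2 + z ^ 2) * u / 2 ≤ (X ^ 2 + z ^ 2) * u + c * z := fun u hu => by
    have := (abs_le.1 hcz).1
    nlinarith [h1 u hu]
  have hqc : ContinuousOn q (Icc α β) :=
    Continuous.continuousOn (by fun_prop) |>.div continuous_phaseLen.continuousOn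
      fun u hu => (hpos u hu).ne'
  have hle : ‖∫ u in α..β, e u * ((u * b u : ℝ) : ℂ) * (Real.sinc (phaseLen X z c u) : ℂ)‖ ≤
      ∫ u in α..β, (2 * B / (X ^ 2 + z ^ 2)) * q u := by
    refine intervalIntegral.norm_integral_le_of_norm_le hαβ ?_
      (continuousOn_const.mul (by rwa [uIcc_of_le hαβ])).intervalIntegrable
    filter_upwards with u hu
    have hu := Ioc_subset_Icc_self hu
    have hu1 := h1 u hu
    have hp := hpos u hu
    rw [norm_mul, norm_mul, Complex.norm_real, Complex.norm_real, Real.norm_eq_abs,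
      Real.norm_eq_abs, abs_of_nonneg (mul_nonneg (by linarith) (hb0 u hu))]
    have e1 := abs_sinc_le_inv hp
    calc ‖e u‖ * (u * b u) * |Real.sinc (phaseLen X z c u)|
        ≤ 1 * (u * B) * (phaseLen X z c u)⁻¹ := by
          have := he u
          have := hbB u hu
          have := hb0 u hu
          gcongr
      _ = (2 * B / (X ^ 2 + z ^ 2)) * (((X ^ 2 + z ^ 2) * u / 2) / phaseLen X z c u) := by
          field_simp
      _ ≤ _ := by
          have := hlow u hu
          simp only [hqdef]
          gcongr
  refine hle.trans ?_
  rw [intervalIntegral.integral_const_mul, intervalIntegral.integral_eq_sub_of_hasDerivAt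
    (f := phaseLen X z c) (fun u hu => hasDerivAt_phaseLen hX (h1 u (by rwa [uIcc_of_le hαβ] at hu)))
    (by rw [← uIcc_of_le hαβ] at hqc; exact hqc.intervalIntegrable)]
  have hβ : phaseLen X z c β * (τ / 2) ≤ 3 / 2 * ((X ^ 2 + z ^ 2) * R) := by
    rw [le_div_iff₀ (hpos β hβm), mul_comm] at hq
    have := (abs_le.1 hcz).2
    have h2 := h1 β hβm
    nlinarith
  have hα0 := (hpos α hαm).le
  have : phaseLen X z c β ≤ 3 * ((X ^ 2 + z ^ 2) * R) / τ := by
    rw [le_div_iff₀ hτ]; linarith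
  calc _ ≤ 2 * B / (X ^ 2 + z ^ 2) * (3 * ((X ^ 2 + z ^ 2) * R) / τ) := by gcongr; linarith
    _ = _ := by field_simp; ring

/-- The slope is the inner product of a unit vector with the derivative of `(√(u² - 1) X, u z + c)`.
The bound is singular at `u = 1`, but integrable there, with primitive `X √(u² - 1) + |z| u`. -/
theorem abs_phaseLen_deriv_le {X z c u : ℝ} (hX : 0 < X) (hu : 1 < u) :
    |((X ^ 2 + z ^ 2) * u + c * z) / phaseLen X z c u| ≤ X * (u / √(u ^ 2 - 1)) + |z| := by
  have hp := phaseLen_pos (z := z) (c := c) hX hu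
  have hs2 : 0 < u ^ 2 - 1 := by nlinarith
  have hs := Real.sqrt_pos.2 hs2
  have hss := Real.sq_sqrt hs2.le
  have h1 : √(u ^ 2 - 1) * X ≤ phaseLen X z c u := by
    refine Real.le_sqrt_of_sq_le ?_
    rw [mul_pow, hss, phaseSq]
    nlinarith [sq_nonneg (u * z + c)]
  have h2 := abs_le_phaseLen (X := X) (z := z) (c := c) hu.le
  rw [abs_div, abs_of_pos hp, div_le_iff₀ hp]
  have e : (X ^ 2 + z ^ 2) * u + c * z = X * (u / √(u ^ 2 - 1)) * (√(u ^ 2 - 1) * X) +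
      z * (u * z + c) := by
    field_simp; ring
  rw [e, add_mul]
  refine (abs_add_le _ _).trans (add_le_add ?_ ?_)
  · rw [abs_of_nonneg (by positivity)]
    gcongr
  · rw [abs_mul]; gcongr

open Set in
/-- Regime of bounded `(X, z)`: the length has bounded variation. -/
theorem norm_integral_exp_phaseLen_le_of_bounded {X z c τ α β R B θ : ℝ} {b b' : ℝ → ℝ}
    (hX : 0 < X) (hτ : 0 < τ) (hα : 1 < α) (hαβ : α ≤ β) (hβR : β ≤ R)
    (hθ : θ ∈ Icc (-1 : ℝ) 1)
    (hb : ∀ u, HasDerivAt b (b' u) u) (hb'c : Continuous b')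
    (hb'0 : ∀ u ∈ Icc α β, 0 ≤ b' u) (hb0 : ∀ u ∈ Icc α β, 0 ≤ b u)
    (hbB : ∀ u ∈ Icc α β, b u ≤ B) :
    ‖∫ u in α..β, (b u : ℂ) * Complex.exp ((τ * u + θ * phaseLen X z c u : ℝ) * Complex.I)‖ ≤
      B * (3 + (X + |z|) * R) / τ := by
  have hαm : α ∈ Icc α β := left_mem_Icc.2 hαβ
  have hβm : β ∈ Icc α β := right_mem_Icc.2 hαβ
  have hB : 0 ≤ B := (hb0 α hαm).trans (hbB α hαm)
  have h1 : ∀ u ∈ Icc α β, 1 < u := fun u hu => hα.trans_le hu.1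
  have hpos : ∀ u ∈ Icc α β, 0 < phaseLen X z c u := fun u hu => phaseLen_pos hX (h1 u hu)
  have hs : ∀ u ∈ Icc α β, 0 < u ^ 2 - 1 := fun u hu => by nlinarith [h1 u hu]
  set q : ℝ → ℝ := fun u => ((X ^ 2 + z ^ 2) * u + c * z) / phaseLen X z c u with hqdef
  have hqc : ContinuousOn q (Icc α β) :=
    Continuous.continuousOn (by fun_prop) |>.div continuous_phaseLen.continuousOn
      fun u hu => (hpos u hu).ne'
  have hbc : Continuous b := continuous_iff_continuousAt.2 fun u => (hb u).continuousAt
  have hpc : Continuous (phaseLen X z c) := continuous_phaseLen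
  have hexp : Continuous fun u => Complex.exp ((θ * phaseLen X z c u : ℝ) * Complex.I) := by
    fun_prop
  have key := norm_integral_mul_deriv_le (A := ℂ) (M := τ⁻¹) hαβ
    (a := fun u => (b u : ℂ) * Complex.exp ((θ * phaseLen X z c u : ℝ) * Complex.I))
    (a' := fun u => (b' u : ℂ) * Complex.exp ((θ * phaseLen X z c u : ℝ) * Complex.I) +
      (b u : ℂ) * (((θ * q u : ℝ) : ℂ) * Complex.I *
        Complex.exp ((θ * phaseLen X z c u : ℝ) * Complex.I)))
    (F := fun u => -Complex.I * (τ : ℂ)⁻¹ * Complex.exp ((τ * u : ℝ) * Complex.I))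
    (f := fun u => Complex.exp ((τ * u : ℝ) * Complex.I))
    -- Only `e^{iτu}` is integrated, with primitive of size `1/τ`; the factor `e^{iθρ}` stays in the
    -- amplitude, and its variation is controlled by this primitive.
    (g := fun u => b u + B * (X * √(u ^ 2 - 1) + |z| * u))
    (g' := fun u => b' u + B * (X * (u / √(u ^ 2 - 1)) + |z|))
    (fun u hu => (hb u).ofReal_comp.mul (hasDerivAt_exp_ofReal_mul_I
      ((hasDerivAt_phaseLen (z := z) (c := c) hX (h1 u hu)).const_mul θ)))
    (fun u hu => by
      have := (hasDerivAt_exp_ofReal_mul_I ((hasDerivAt_id u).const_mul τ)).const_mul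
        (-Complex.I * (τ : ℂ)⁻¹)
      convert! this using 1
      have hτ' : (τ : ℂ) ≠ 0 := by exact_mod_cast hτ.ne'
      change _ = -Complex.I * (τ : ℂ)⁻¹ * (((τ * 1 : ℝ) : ℂ) * Complex.I *
        Complex.exp ((τ * u : ℝ) * Complex.I))
      rw [mul_one]
      linear_combination (Complex.exp ((τ * u : ℝ) * Complex.I) * (τ : ℂ)⁻¹ * τ) * Complex.I_sq -
        Complex.exp ((τ * u : ℝ) * Complex.I) * inv_mul_cancel₀ hτ')
    (fun u hu => by
      have hsq : HasDerivAt (fun u : ℝ => √(u ^ 2 - 1)) (u / √(u ^ 2 - 1)) u := by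
        convert! (((hasDerivAt_id u).pow 2).sub_const 1).sqrt (hs u hu).ne' using 1
        have := (Real.sqrt_pos.2 (hs u hu)).ne'
        simp
        field_simp
      convert! (hb u).add (((hsq.const_mul X).add ((hasDerivAt_id u).const_mul |z|)).const_mul B)
        using 1
      simp)
    (((Complex.continuous_ofReal.comp hb'c).mul hexp).continuousOn.add
      ((Complex.continuous_ofReal.comp hbc).continuousOn.mul
        (((Complex.continuous_ofReal.comp_continuousOn (continuousOn_const.mul hqc)).mul
          continuousOn_const).mul hexp.continuousOn)))
    (Continuous.continuousOn (by fun_prop))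
    (hb'c.continuousOn.add (continuousOn_const.mul ((continuousOn_const.mul
      (continuousOn_id.div (Continuous.continuousOn (by fun_prop))
        fun u hu => (Real.sqrt_pos.2 (hs u hu)).ne')).add continuousOn_const)))
    (fun u hu => by
      refine (norm_add_le _ _).trans (add_le_add ?_ ?_)
      · rw [norm_mul, Complex.norm_exp_ofReal_mul_I, mul_one, Complex.norm_real, Real.norm_eq_abs,
          abs_of_nonneg (hb'0 u hu)]
      · rw [norm_mul, norm_mul, norm_mul, Complex.norm_exp_ofReal_mul_I, mul_one, Complex.norm_I,
          mul_one, Complex.norm_real, Complex.norm_real, Real.norm_eq_abs, Real.norm_eq_abs,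
          abs_of_nonneg (hb0 u hu), abs_mul]
        have h5 : |θ| ≤ 1 := abs_le.2 hθ
        have h6 := abs_phaseLen_deriv_le (z := z) (c := c) hX (h1 u hu)
        refine mul_le_mul (hbB u hu) ?_ (by positivity) hB
        exact (mul_le_of_le_one_left (abs_nonneg _) h5).trans h6)
    (fun u hu => by
      rw [norm_mul, Complex.norm_exp_ofReal_mul_I]; simp [abs_of_pos hτ])
  have hint : (∫ u in α..β, (b u : ℂ) * Complex.exp ((θ * phaseLen X z c u : ℝ) * Complex.I) *
      Complex.exp ((τ * u : ℝ) * Complex.I)) =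
      ∫ u in α..β, (b u : ℂ) *
        Complex.exp ((τ * u + θ * phaseLen X z c u : ℝ) * Complex.I) := by
    refine intervalIntegral.integral_congr fun u hu => ?_
    rw [mul_assoc, ← Complex.exp_add]
    congr 2
    push_cast; ring
  rw [hint] at key
  have ha : ∀ u ∈ Icc α β, ‖(b u : ℂ) * Complex.exp ((θ * phaseLen X z c u : ℝ) * Complex.I)‖
      ≤ B := fun u hu => by
    rw [norm_mul, Complex.norm_exp_ofReal_mul_I, mul_one, Complex.norm_real, Real.norm_eq_abs,
          abs_of_nonneg (hb0 u hu)]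
    exact hbB u hu
  refine key.trans ?_
  rw [div_eq_inv_mul]
  refine mul_le_mul_of_nonneg_left ?_ (inv_pos.2 hτ).le
  have e1 := ha α hαm
  have e2 := ha β hβm
  have e3 := hbB β hβm
  have e4 := hb0 α hαm
  have e5 : X * √(β ^ 2 - 1) + |z| * β ≤ (X + |z|) * R := by
    have : √(β ^ 2 - 1) ≤ β := Real.sqrt_le_iff.2 ⟨by linarith [h1 β hβm], by linarith⟩
    have : √(β ^ 2 - 1) ≤ R := this.trans hβR
    calc X * √(β ^ 2 - 1) + |z| * β ≤ X * R + |z| * R := by gcongr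
      _ = _ := by ring
  have e6 : 0 ≤ X * √(α ^ 2 - 1) + |z| * α := by
    have := h1 α hαm
    positivity
  nlinarith [mul_le_mul_of_nonneg_left e5 hB, mul_nonneg hB e6]

open Set in
/-- Decay in `τ` of the oscillatory `u`-integral of the Fourier transform of the sphere. -/
theorem norm_integral_exp_sinc_le_of_pos {X z c τ α R : ℝ} {b b' : ℝ → ℝ}
    (hX : 0 < X) (hc : |c| ≤ Real.pi / 2) (hτ : 0 < τ) (hα : 1 < α) (hαR : α ≤ R)
    (hb : ∀ u, HasDerivAt b (b' u) u) (hb'c : Continuous b')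
    (hb'0 : ∀ u ∈ Icc α R, 0 ≤ b' u) (hb0 : ∀ u ∈ Icc α R, 0 ≤ b u)
    (hbB : ∀ u ∈ Icc α R, b u ≤ R) :
    ‖∫ u in α..R, Complex.exp ((τ * u : ℝ) * Complex.I) * ((u * b u : ℝ) : ℂ) *
      (Real.sinc (phaseLen X z c u) : ℂ)‖ ≤ 20 * R ^ 3 / τ := by
  have hR : 1 < R := hα.trans_le hαR
  have hπ := Real.pi_pos
  have hbc : Continuous b := continuous_iff_continuousAt.2 fun u => (hb u).continuousAt
  have hpc : Continuous (phaseLen X z c) := continuous_phaseLen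
  have hsc : Continuous fun u => (Real.sinc (phaseLen X z c u) : ℂ) :=
    Complex.continuous_ofReal.comp (Real.continuous_sinc.comp hpc)
  set B : ℝ → ℝ := fun u => u * b u
  set B' : ℝ → ℝ := fun u => 1 * b u + u * b' u
  have hB : ∀ u, HasDerivAt B (B' u) u := fun u => (hasDerivAt_id u).mul (hb u)
  have hBc : Continuous B := by fun_prop
  have hB'c : Continuous B' := by fun_prop
  have hB'0 : ∀ u ∈ Icc α R, 0 ≤ B' u := fun u hu => by
    have := hb0 u hu
    have := hb'0 u hu
    have : 0 < u := by linarith [hu.1]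
    positivity
  have hB0 : ∀ u ∈ Icc α R, 0 ≤ B u := fun u hu =>
    mul_nonneg (by linarith [hu.1]) (hb0 u hu)
  have hBB : ∀ u ∈ Icc α R, B u ≤ R ^ 2 := fun u hu => by
    rw [sq]; exact mul_le_mul hu.2 (hbB u hu) (hb0 u hu) (by linarith)
  have hcont : Continuous fun u => Complex.exp ((τ * u : ℝ) * Complex.I) * (B u : ℂ) := by
    fun_prop
  have hexp : ∀ θ u : ℝ, Complex.exp ((τ * u : ℝ) * Complex.I) * ((u * b u : ℝ) : ℂ) *
      Complex.exp ((θ * phaseLen X z c u : ℝ) * Complex.I) = ((u * b u : ℝ) : ℂ) *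
        Complex.exp ((τ * u + θ * phaseLen X z c u : ℝ) * Complex.I) := fun θ u => by
    rw [mul_comm (Complex.exp _), mul_assoc, ← Complex.exp_add]
    congr 2
    push_cast; ring
  -- For `√(X² + z²) ≤ π` the length has bounded variation. Beyond that, `|c| ≤ π/2` gives `c² ≤ X²
  -- + z²` and `|c z| ≤ (X² + z²)/2`, so the length is increasing and concave.
  by_cases hr : X ^ 2 + z ^ 2 ≤ Real.pi ^ 2
  · refine norm_integral_mul_sinc_le hcont hpc fun θ hθ => ?_
    simp_rw [hexp]
    refine (norm_integral_exp_phaseLen_le_of_bounded hX hτ hα hαR le_rfl hθ hB hB'c hB'0 hB0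
      hBB).trans ?_
    have h1 : X ≤ Real.pi := by nlinarith [sq_nonneg z]
    have h2 : |z| ≤ Real.pi := abs_le_of_sq_le_sq (by nlinarith) hπ.le
    have h3 := Real.pi_lt_four
    refine div_le_div_of_nonneg_right ?_ hτ.le
    calc R ^ 2 * (3 + (X + |z|) * R) ≤ R ^ 2 * (3 * R + (4 + 4) * R) := by
          gcongr <;> linarith
      _ ≤ 20 * R ^ 3 := by nlinarith [pow_pos (by linarith : 0 < R) 3]
  · push Not at hr
    have hcr : c ^ 2 ≤ X ^ 2 + z ^ 2 := by
      have : c ^ 2 ≤ (Real.pi / 2) ^ 2 := sq_le_sq' (abs_le.1 hc).1 (abs_le.1 hc).2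
      nlinarith
    have hcz : |c * z| ≤ (X ^ 2 + z ^ 2) / 2 := by
      have h1 : Real.pi ≤ √(X ^ 2 + z ^ 2) := Real.le_sqrt_of_sq_le hr.le
      have h2 : |z| ≤ √(X ^ 2 + z ^ 2) := by
        rw [← Real.sqrt_sq_eq_abs]
        exact Real.sqrt_le_sqrt (by nlinarith [sq_nonneg X])
      have h3 : 0 ≤ X ^ 2 + z ^ 2 := by positivity
      rw [abs_mul]
      calc |c| * |z| ≤ (√(X ^ 2 + z ^ 2) / 2) * √(X ^ 2 + z ^ 2) := by
            gcongr; linarith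
        _ = _ := by rw [div_mul_eq_mul_div, Real.mul_self_sqrt h3]
    set q : ℝ → ℝ := fun u => ((X ^ 2 + z ^ 2) * u + c * z) / phaseLen X z c u with hqdef
    have hpos : ∀ u ∈ Icc α R, 0 < phaseLen X z c u := fun u hu =>
      phaseLen_pos hX (hα.trans_le hu.1)
    have hqd : ∀ u ∈ Icc α R, HasDerivAt q
        (-(X ^ 2 * (X ^ 2 + z ^ 2 - c ^ 2) / phaseLen X z c u ^ 3)) u := fun u hu =>
      hasDerivAt_phaseLen_deriv hX (hα.trans_le hu.1)
    have hqc : ContinuousOn q (Icc α R) := fun u hu => (hqd u hu).continuousAt.continuousWithinAt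
    have hanti : AntitoneOn q (Icc α R) := by
      refine antitoneOn_of_deriv_nonpos (convex_Icc α R) hqc
        (fun u hu => (hqd u (interior_subset hu)).differentiableAt.differentiableWithinAt) ?_
      intro u hu
      rw [(hqd u (interior_subset hu)).deriv]
      have := hpos u (interior_subset hu)
      have : 0 ≤ X ^ 2 + z ^ 2 - c ^ 2 := by linarith
      exact neg_nonpos.2 (by positivity)
    have hq0 : ∀ u ∈ Icc α R, 0 ≤ q u := fun u hu => by
      have h1 := hpos u hu
      have h2 := (abs_le.1 hcz).1
      refine div_nonneg ?_ h1.le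
      nlinarith [hu.1]
    -- The slope is decreasing, so it crosses `τ/2` at most in one place: before `p` it is large and
    -- the decay of `sinc` suffices; after `p` the phase `τu + θρ` is nonstationary. If there is no
    -- crossing, `p` is an endpoint and one piece is empty.
    obtain ⟨p, hp, hpl, hpr⟩ : ∃ p ∈ Icc α R, (p = α ∨ τ / 2 ≤ q p) ∧ (p = R ∨ q p ≤ τ / 2) := by
      rcases le_total (q α) (τ / 2) with h | h
      · exact ⟨α, left_mem_Icc.2 hαR, Or.inl rfl, Or.inr h⟩
      rcases le_total (q R) (τ / 2) with h' | h'
      · obtain ⟨p, hp, hpe⟩ := intermediate_value_Icc' hαR hqc ⟨h', h⟩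
        exact ⟨p, hp, Or.inr hpe.ge, Or.inr hpe.le⟩
      · exact ⟨R, right_mem_Icc.2 hαR, Or.inr h', Or.inl rfl⟩
    have hI : ∀ s t, IntervalIntegrable (fun u => Complex.exp ((τ * u : ℝ) * Complex.I) *
        ((u * b u : ℝ) : ℂ) * (Real.sinc (phaseLen X z c u) : ℂ)) volume s t := fun s t =>
      (hcont.mul hsc).intervalIntegrable _ _
    rw [← intervalIntegral.integral_add_adjacent_intervals (hI α p) (hI p R)]
    have h1 : ‖∫ u in α..p, Complex.exp ((τ * u : ℝ) * Complex.I) *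
        ((u * b u : ℝ) : ℂ) * (Real.sinc (phaseLen X z c u) : ℂ)‖ ≤ 6 * R * R / τ := by
      rcases hpl with h | h
      · rw [h, intervalIntegral.integral_same, norm_zero]; positivity
      · exact norm_integral_sinc_le_of_le_deriv hX hτ hα hp.1 hp.2 hcz
          (fun u hu => hb0 u ⟨hu.1, hu.2.trans hp.2⟩) (fun u hu => hbB u ⟨hu.1, hu.2.trans hp.2⟩)
          (fun u => (Complex.norm_exp_ofReal_mul_I _).le) h
    have h2 : ‖∫ u in p..R, Complex.exp ((τ * u : ℝ) * Complex.I) *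
        ((u * b u : ℝ) : ℂ) * (Real.sinc (phaseLen X z c u) : ℂ)‖ ≤ 8 * R ^ 2 / τ := by
      rcases hpr with h | h
      · rw [h, intervalIntegral.integral_same, norm_zero]; positivity
      · refine norm_integral_mul_sinc_le hcont hpc fun θ hθ => ?_
        simp_rw [hexp]
        exact norm_integral_exp_phaseLen_le hX hτ (hα.trans_le hp.1) hp.2 hcr hθ hB hB'c
          (fun u hu => hB'0 u ⟨hp.1.trans hu.1, hu.2⟩) (fun u hu => hB0 u ⟨hp.1.trans hu.1, hu.2⟩)
          (fun u hu => hBB u ⟨hp.1.trans hu.1, hu.2⟩) (fun u hu => hq0 u ⟨hp.1.trans hu.1, hu.2⟩)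
          (fun u hu => (hanti hp ⟨hp.1.trans hu.1, hu.2⟩ hu.1).trans h)
    refine (norm_add_le _ _).trans ((add_le_add h1 h2).trans ?_)
    rw [← add_div]
    gcongr
    nlinarith [pow_pos (by linarith : 0 < R) 2]

-- Complex conjugation exchanges `τ` and `-τ`, because `b` and `sinc` are real.
open Set in
theorem norm_integral_exp_sinc_le {X z c τ α R : ℝ} {b b' : ℝ → ℝ}
    (hX : 0 < X) (hc : |c| ≤ Real.pi / 2) (hτ : τ ≠ 0) (hα : 1 < α) (hαR : α ≤ R)
    (hb : ∀ u, HasDerivAt b (b' u) u) (hb'c : Continuous b')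
    (hb'0 : ∀ u ∈ Icc α R, 0 ≤ b' u) (hb0 : ∀ u ∈ Icc α R, 0 ≤ b u)
    (hbB : ∀ u ∈ Icc α R, b u ≤ R) :
    ‖∫ u in α..R, Complex.exp ((τ * u : ℝ) * Complex.I) * ((u * b u : ℝ) : ℂ) *
      (Real.sinc (phaseLen X z c u) : ℂ)‖ ≤ 20 * R ^ 3 / |τ| := by
  rcases hτ.lt_or_gt with h | h
  · have := norm_integral_exp_sinc_le_of_pos (z := z) hX hc (neg_pos.2 h) hα hαR hb hb'c hb'0
      hb0 hbB
    rw [abs_of_neg h]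
    refine le_trans (le_of_eq ?_) this
    rw [← RCLike.norm_conj, ← intervalIntegral.intervalIntegral_conj]
    congr 1
    refine intervalIntegral.integral_congr fun u _ => ?_
    simp only [map_mul, Complex.conj_ofReal, ← Complex.exp_conj, Complex.conj_I]
    congr 3
    push_cast; ring
  · rw [abs_of_pos h]
    exact norm_integral_exp_sinc_le_of_pos hX hc h hα hαR hb hb'c hb'0 hb0 hbB

/-! ### Polar coordinates and the Fourier transform of the sphere -/

theorem finrank_R3 : Module.finrank ℝ R3 = 3 := finrank_euclideanSpace_fin

open Set Metric in
/-- Polar coordinates in `ℝ³`. -/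
theorem integral_eq_integral_sphere {F : R3 → ℂ} (hF : Integrable F) :
    ∫ x, F x = ∫ p in Ioi (0 : ℝ), (p : ℂ) ^ 2 *
      ∫ ω : sphere (0 : R3) 1, F (p • (ω : R3)) ∂(volume : Measure R3).toSphere := by
  have hmp := (volume : Measure R3).measurePreserving_homeomorphUnitSphereProd
  have hemb := (homeomorphUnitSphereProd R3).measurableEmbedding
  set G : sphere (0 : R3) 1 × Ioi (0 : ℝ) → ℂ := fun q => F ((q.2 : ℝ) • (q.1 : R3)) with hG
  have hcomp : ∀ x : ({0}ᶜ : Set R3), G (homeomorphUnitSphereProd R3 x) = F x := fun x => by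
    have hx : ‖(x : R3)‖ ≠ 0 := norm_ne_zero_iff.2 x.2
    simp only [hG, homeomorphUnitSphereProd_apply_snd_coe, homeomorphUnitSphereProd_apply_fst_coe]
    rw [smul_smul, mul_inv_cancel₀ hx, one_smul]
  have hmeas : MeasurableSet ({0}ᶜ : Set R3) := (measurableSet_singleton _).compl
  have hGi : Integrable G ((volume : Measure R3).toSphere.prod
      (Measure.volumeIoiPow (Module.finrank ℝ R3 - 1))) := by
    rw [← hmp.integrable_comp_emb hemb]
    have : G ∘ homeomorphUnitSphereProd R3 = F ∘ Subtype.val := funext hcomp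
    rw [this, ← integrableOn_iff_comap_subtypeVal hmeas]
    exact hF.integrableOn
  calc ∫ x, F x = ∫ x : ({0}ᶜ : Set R3), F x ∂(volume.comap Subtype.val) := by
        rw [integral_subtype_comap hmeas, restrict_compl_singleton]
    _ = ∫ q, G q ∂((volume : Measure R3).toSphere.prod
          (Measure.volumeIoiPow (Module.finrank ℝ R3 - 1))) := by
        rw [← hmp.integral_comp hemb]
        exact integral_congr_ae (Filter.Eventually.of_forall fun x => (hcomp x).symm)
    _ = ∫ p, ∫ ω, G (ω, p) ∂(volume : Measure R3).toSphere
          ∂(Measure.volumeIoiPow (Module.finrank ℝ R3 - 1)) := integral_prod_symm _ hGi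
    _ = _ := by
        simp only [Measure.volumeIoiPow, ENNReal.ofReal, finrank_R3]
        rw [integral_withDensity_eq_integral_smul
          (measurable_subtype_coe.pow_const _).real_toNNReal,
          integral_subtype_comap measurableSet_Ioi fun a : ℝ => Real.toNNReal (a ^ (3 - 1)) •
            ∫ ω : sphere (0 : R3) 1, F (a • (ω : R3)) ∂(volume : Measure R3).toSphere]
        refine setIntegral_congr_fun measurableSet_Ioi fun x hx => ?_
        rw [NNReal.smul_def, Real.coe_toNNReal _ (pow_nonneg hx.out.le _), Complex.real_smul]
        push_cast
        rfl

/-- The Fourier transform of the surface measure of the unit sphere. -/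
def sphereFT (y : R3) : ℂ :=
  ∫ ω : Metric.sphere (0 : R3) 1, Complex.exp ((inner ℝ y (ω : R3) : ℝ) * Complex.I)
    ∂(volume : Measure R3).toSphere

-- The integrand is extended to the ball as a function homogeneous of degree zero, the factor 3
-- undoing `∫₀¹ p² dp`. Rotation invariance on the sphere is thus inherited from that of Lebesgue
-- measure.
open Set Metric in
theorem sphereFT_eq_integral_ball (y : R3) :
    sphereFT y = 3 * ∫ x in ball (0 : R3) 1,
      Complex.exp (((inner ℝ y x / ‖x‖ : ℝ) : ℂ) * Complex.I) := by
  have hmeas : Measurable fun x : R3 =>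
      Complex.exp (((inner ℝ y x / ‖x‖ : ℝ) : ℂ) * Complex.I) := by fun_prop
  rw [← integral_indicator measurableSet_ball, integral_eq_integral_sphere]
  · have h : ∀ p ∈ Ioi (0 : ℝ), (p : ℂ) ^ 2 * ∫ ω : sphere (0 : R3) 1,
        (ball (0 : R3) 1).indicator (fun x => Complex.exp (((inner ℝ y x / ‖x‖ : ℝ) : ℂ) *
          Complex.I)) (p • (ω : R3)) ∂(volume : Measure R3).toSphere =
        (Ioo (0 : ℝ) 1).indicator (fun p => (p : ℂ) ^ 2 * sphereFT y) p := fun p hp => by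
      have hp : 0 < p := hp
      have hn : ∀ ω : sphere (0 : R3) 1, ‖p • (ω : R3)‖ = p := fun ω => by
        rw [norm_smul, norm_eq_of_mem_sphere, mul_one, Real.norm_eq_abs, abs_of_pos hp]
      by_cases h1 : p < 1
      · rw [indicator_of_mem (show p ∈ Ioo (0 : ℝ) 1 from ⟨hp, h1⟩)]
        congr 1
        refine integral_congr_ae (Filter.Eventually.of_forall fun ω => ?_)
        simp only
        rw [indicator_of_mem (by rw [mem_ball_zero_iff, hn]; exact h1), hn, inner_smul_right,
          mul_div_cancel_left₀ _ hp.ne']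
      · rw [indicator_of_notMem (fun h => h1 h.2), mul_eq_zero]
        right
        refine integral_eq_zero_of_ae (Filter.Eventually.of_forall fun ω => ?_)
        exact indicator_of_notMem (by rw [mem_ball_zero_iff, hn]; exact h1) _
    rw [setIntegral_congr_fun measurableSet_Ioi h, setIntegral_indicator measurableSet_Ioo,
      inter_eq_right.2 (fun x hx => hx.1), ← integral_Ioc_eq_integral_Ioo,
      ← intervalIntegral.integral_of_le zero_le_one, intervalIntegral.integral_mul_const]
    have : ∫ p in (0 : ℝ)..1, (p : ℂ) ^ 2 = 1 / 3 := by
      have h2 : ∀ p : ℝ, (p : ℂ) ^ 2 = ((p ^ 2 : ℝ) : ℂ) := fun p => by push_cast; rfl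
      simp_rw [h2]
      rw [intervalIntegral.integral_ofReal, integral_pow]
      norm_num
    rw [this]; ring
  · rw [integrable_indicator_iff measurableSet_ball]
    refine IntegrableOn.of_bound (C := 1) measure_ball_lt_top hmeas.aestronglyMeasurable
      (Filter.Eventually.of_forall fun x => ?_)
    rw [Complex.norm_exp_ofReal_mul_I]

open Set Metric in
theorem sphereFT_map (A : R3 ≃ₗᵢ[ℝ] R3) (y : R3) : sphereFT (A y) = sphereFT y := by
  rw [sphereFT_eq_integral_ball, sphereFT_eq_integral_ball]
  congr 1
  rw [← A.measurePreserving.setIntegral_preimage_emb A.toHomeomorph.measurableEmbedding]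
  have : A ⁻¹' ball (0 : R3) 1 = ball 0 1 := by ext x; simp
  rw [this]
  simp

/-- Expanding the exponential shows that the characteristic function of a bounded variable is
determined by its moments. -/
theorem hasSum_integral_exp {α : Type*} [MeasurableSpace α] {μ : Measure α} [IsFiniteMeasure μ]
    {h : α → ℝ} (hm : Measurable h) (hb : ∀ x, |h x| ≤ 1) (k : ℝ) :
    HasSum (fun n : ℕ => (k * Complex.I) ^ n / (n.factorial : ℂ) * ((∫ x, h x ^ n ∂μ : ℝ) : ℂ))
      (∫ x, Complex.exp ((k * h x : ℝ) * Complex.I) ∂μ) := by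
  have hint : ∀ n : ℕ, Integrable (fun x => h x ^ n) μ := fun n =>
    Integrable.of_bound (C := 1) (hm.pow_const n).aestronglyMeasurable
      (Filter.Eventually.of_forall fun x => by
        rw [norm_pow]; exact pow_le_one₀ (norm_nonneg _) (hb x))
  have hbound : ∀ n : ℕ, ∫ x, ‖(k * Complex.I) ^ n / (n.factorial : ℂ) * ((h x ^ n : ℝ) : ℂ)‖ ∂μ ≤
      |k| ^ n / n.factorial * μ.real Set.univ := fun n => by
    have : ∀ x, ‖(k * Complex.I) ^ n / (n.factorial : ℂ) * ((h x ^ n : ℝ) : ℂ)‖ ≤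
        |k| ^ n / n.factorial := fun x => by
      rw [norm_mul, norm_div, norm_pow, norm_mul, Complex.norm_I, mul_one, Complex.norm_real,
        Complex.norm_real, Complex.norm_natCast, norm_pow]
      exact mul_le_of_le_one_right (by positivity) (pow_le_one₀ (norm_nonneg _) (hb x))
    calc _ ≤ ∫ _, |k| ^ n / n.factorial ∂μ := integral_mono_of_nonneg
          (Filter.Eventually.of_forall fun _ => norm_nonneg _) (integrable_const _)
          (Filter.Eventually.of_forall this)
      _ = _ := by rw [integral_const, smul_eq_mul, mul_comm]
  have key := hasSum_integral_of_summable_integral_norm (μ := μ)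
    (F := fun (n : ℕ) x => (k * Complex.I) ^ n / (n.factorial : ℂ) * ((h x ^ n : ℝ) : ℂ))
    (fun n => (hint n).ofReal.const_mul _)
    (Summable.of_nonneg_of_le (fun n => integral_nonneg fun _ => norm_nonneg _) hbound
      ((Real.summable_pow_div_factorial |k|).mul_right _))
  convert! key using 1
  · funext n
    rw [integral_const_mul, integral_complex_ofReal]
  · refine integral_congr_ae (Filter.Eventually.of_forall fun x => ?_)
    simp only
    rw [Complex.exp_eq_exp_ℂ, NormedSpace.exp_eq_tsum_div]
    refine tsum_congr fun n => ?_
    push_cast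
    ring

theorem integral_Ioi_pow_mul_exp (n : ℕ) :
    ∫ x in Set.Ioi (0 : ℝ), x ^ n * Real.exp (-x ^ 2) = 1 / 2 * Real.Gamma ((n + 1) / 2) := by
  rw [← integral_rpow_mul_exp_neg_rpow (p := 2) (q := n) (by norm_num)
    (by have : (0 : ℝ) ≤ n := n.cast_nonneg; linarith)]
  simp

theorem integral_Ioi_pow_add_two_mul_exp (n : ℕ) :
    ∫ x in Set.Ioi (0 : ℝ), x ^ (n + 2) * Real.exp (-x ^ 2) =
      (n + 1) / 2 * ∫ x in Set.Ioi (0 : ℝ), x ^ n * Real.exp (-x ^ 2) := by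
  have h : (0 : ℝ) < (n + 1) / 2 := by positivity
  rw [integral_Ioi_pow_mul_exp, integral_Ioi_pow_mul_exp]
  have : ((n + 2 : ℕ) + 1 : ℝ) / 2 = (n + 1) / 2 + 1 := by push_cast; ring
  rw [this, Real.Gamma_add_one h.ne']
  ring

theorem integral_pow_mul_exp (n : ℕ) :
    ∫ x : ℝ, x ^ n * Real.exp (-x ^ 2) =
      (1 + (-1) ^ n) * ∫ x in Set.Ioi (0 : ℝ), x ^ n * Real.exp (-x ^ 2) := by
  rcases n.even_or_odd with h | h
  · rw [h.neg_one_pow, one_add_one_eq_two, ← integral_comp_abs]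
    simp_rw [h.pow_abs, sq_abs]
  · rw [h.neg_one_pow, add_neg_cancel, zero_mul]
    have := integral_neg_eq_self (fun x : ℝ => x ^ n * Real.exp (-x ^ 2)) volume
    simp_rw [h.neg_pow, neg_sq, neg_mul] at this
    rw [integral_neg] at this
    linarith

theorem integrable_pow_mul_exp (n : ℕ) :
    Integrable fun x : ℝ => x ^ n * Real.exp (-x ^ 2) := by
  have := integrable_rpow_mul_exp_neg_mul_sq (b := 1) one_pos (s := n)
    (by have : (0 : ℝ) ≤ n := n.cast_nonneg; linarith)
  simpa using this

open Set Metric in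
/-- Moments of a coordinate on the unit sphere. -/
theorem integral_sphere_pow (n : ℕ) :
    ∫ ω : sphere (0 : R3) 1, (ω : R3) 2 ^ n ∂(volume : Measure R3).toSphere =
      2 * Real.pi * ∫ θ in (-1 : ℝ)..1, θ ^ n := by
  -- The integral of `x₂ⁿ e^{-|x|²}` over space is computed both by Fubini and in polar coordinates.
  -- By the recursion for `Γ` the two radial integrals are proportional, and the moment on the
  -- sphere is read off.
  set f : Fin 3 → ℝ → ℝ := ![fun x => x ^ 0 * Real.exp (-x ^ 2), fun x => x ^ 0 * Real.exp (-x ^ 2),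
    fun x => x ^ n * Real.exp (-x ^ 2)] with hf
  have hfi : ∀ i, Integrable (f i) := by
    intro i
    fin_cases i
    · exact integrable_pow_mul_exp 0
    · exact integrable_pow_mul_exp 0
    · exact integrable_pow_mul_exp n
  have hprod : ∀ x : R3, ∏ i, f i (x i) = x 2 ^ n * Real.exp (-‖x‖ ^ 2) := fun x => by
    rw [EuclideanSpace.norm_sq_eq, Fin.sum_univ_three, Fin.prod_univ_three]
    simp only [hf, Real.norm_eq_abs, sq_abs, neg_add, Real.exp_add]
    simp
    ring
  have hmp := PiLp.volume_preserving_ofLp (Fin 3)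
  have hemb : MeasurableEmbedding (WithLp.ofLp : R3 → (Fin 3 → ℝ)) :=
    (MeasurableEquiv.toLp 2 (Fin 3 → ℝ)).symm.measurableEmbedding
  have hI : Integrable fun x : R3 => x 2 ^ n * Real.exp (-‖x‖ ^ 2) := by
    simp_rw [← hprod]
    exact (hmp.integrable_comp_emb hemb).2 (Integrable.fintype_prod hfi)
  have h1 : ∫ x : R3, x 2 ^ n * Real.exp (-‖x‖ ^ 2) =
      Real.pi * ∫ x : ℝ, x ^ n * Real.exp (-x ^ 2) := by
    simp_rw [← hprod]
    rw [hmp.integral_comp hemb (fun y : Fin 3 → ℝ => ∏ i, f i (y i)),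
      integral_fintype_prod_volume_eq_prod, Fin.prod_univ_three]
    have h0 : ∫ x : ℝ, x ^ 0 * Real.exp (-x ^ 2) = √Real.pi := by
      simpa using integral_gaussian 1
    simp only [hf, Matrix.cons_val_zero, Matrix.cons_val_one, Matrix.cons_val]
    rw [h0, Real.mul_self_sqrt Real.pi_pos.le]
  have h2 := integral_eq_integral_sphere
    (F := fun x => ((x 2 ^ n * Real.exp (-‖x‖ ^ 2) : ℝ) : ℂ)) hI.ofReal
  rw [integral_complex_ofReal, h1, integral_pow_mul_exp] at h2
  set M := ∫ ω : sphere (0 : R3) 1, (ω : R3) 2 ^ n ∂(volume : Measure R3).toSphere with hM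
  have h3 : ∀ p ∈ Ioi (0 : ℝ), (p : ℂ) ^ 2 * ∫ ω : sphere (0 : R3) 1,
      (((p • (ω : R3)) 2 ^ n * Real.exp (-‖p • (ω : R3)‖ ^ 2) : ℝ) : ℂ)
        ∂(volume : Measure R3).toSphere =
      ((p ^ (n + 2) * Real.exp (-p ^ 2) * M : ℝ) : ℂ) := fun p hp => by
    have hp : 0 < p := hp
    rw [integral_complex_ofReal]
    have : ∀ ω : sphere (0 : R3) 1, (p • (ω : R3)) 2 ^ n * Real.exp (-‖p • (ω : R3)‖ ^ 2) =
        p ^ n * Real.exp (-p ^ 2) * (ω : R3) 2 ^ n := fun ω => by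
      rw [norm_smul, norm_eq_of_mem_sphere, mul_one, Real.norm_eq_abs, abs_of_pos hp]
      simp only [PiLp.smul_apply, smul_eq_mul, mul_pow]
      ring
    simp_rw [this]
    rw [integral_const_mul]
    push_cast
    ring
  rw [setIntegral_congr_fun measurableSet_Ioi h3, integral_complex_ofReal, integral_mul_const,
    integral_Ioi_pow_add_two_mul_exp] at h2
  have h4 := Complex.ofReal_injective h2
  have hJ : 0 < ∫ x in Set.Ioi (0 : ℝ), x ^ n * Real.exp (-x ^ 2) := by
    rw [integral_Ioi_pow_mul_exp]
    have := Real.Gamma_pos_of_pos (s := ((n : ℝ) + 1) / 2) (by positivity)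
    positivity
  rw [integral_pow]
  have hn : (0 : ℝ) < n + 1 := by positivity
  have h5 : Real.pi * (1 + (-1) ^ n) = (n + 1) / 2 * M := by
    apply mul_right_cancel₀ hJ.ne'
    linarith
  rw [one_pow, pow_succ, mul_neg_one, sub_neg_eq_add]
  field_simp
  linarith

-- Archimedes: a coordinate on the sphere has the same moments as `2π dθ` on `[-1, 1]`, so the two
-- Fourier transforms have the same power series.
open Metric in
theorem sphereFT_single (k : ℝ) :
    sphereFT (EuclideanSpace.single 2 k) = 4 * Real.pi * Real.sinc k := by
  have hm : Measurable fun ω : sphere (0 : R3) 1 => (ω : R3) 2 := by fun_prop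
  have hb : ∀ ω : sphere (0 : R3) 1, |(ω : R3) 2| ≤ 1 := fun ω =>
    (PiLp.norm_apply_le (ω : R3) 2).trans_eq (norm_eq_of_mem_sphere ω)
  have h1 := hasSum_integral_exp (μ := (volume : Measure R3).toSphere) hm hb k
  have h2 := hasSum_integral_exp (μ := (volume : Measure ℝ).restrict (Set.Ioc (-1) 1))
    -- The variable is clamped so that `|h| ≤ 1` holds everywhere; on the interval of integration it
    -- is `θ`.
    (h := fun θ => max (-1) (min 1 θ)) (by fun_prop)
    (fun θ => abs_le.2 ⟨le_max_left _ _, max_le (by norm_num) (min_le_left _ _)⟩) k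
  have e : ∀ θ ∈ Set.Ioc (-1 : ℝ) 1, max (-1) (min 1 θ) = θ := fun θ hθ => by
    rw [min_eq_right hθ.2, max_eq_right hθ.1.le]
  have e1 : ∀ n : ℕ, ∫ θ in Set.Ioc (-1 : ℝ) 1, (max (-1) (min 1 θ)) ^ n =
      ∫ θ in (-1 : ℝ)..1, θ ^ n := fun n => by
    rw [intervalIntegral.integral_of_le (by norm_num)]
    exact setIntegral_congr_fun measurableSet_Ioc fun θ hθ => by simp only [e θ hθ]
  have e2 : ∫ θ in Set.Ioc (-1 : ℝ) 1, Complex.exp ((k * max (-1) (min 1 θ) : ℝ) * Complex.I) =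
      2 * Real.sinc k := by
    rw [← integral_exp_mul_sinc, intervalIntegral.integral_of_le (by norm_num)]
    exact setIntegral_congr_fun measurableSet_Ioc fun θ hθ => by
      simp only [e θ hθ, mul_comm k]
  simp_rw [e1] at h2
  rw [e2] at h2
  simp_rw [integral_sphere_pow] at h1
  have h3 := h2.mul_left (2 * Real.pi : ℂ)
  have h4 : sphereFT (EuclideanSpace.single 2 k) = ∫ ω : sphere (0 : R3) 1,
      Complex.exp ((k * (ω : R3) 2 : ℝ) * Complex.I) ∂(volume : Measure R3).toSphere := by
    simp only [sphereFT, EuclideanSpace.inner_single_left]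
    simp
  rw [h4]
  refine (h1.unique ?_).trans (by ring : 2 * (Real.pi : ℂ) * (2 * Real.sinc k) = _)
  convert! h3 using 1
  funext n
  push_cast
  ring

/-- The Fourier transform of the surface measure of the unit sphere is a cardinal sine. -/
theorem sphereFT_eq (y : R3) : sphereFT y = 4 * Real.pi * Real.sinc ‖y‖ := by
  have h : ‖y‖ = ‖(EuclideanSpace.single 2 ‖y‖ : R3)‖ := by simp
  -- A reflection carries `y` to the vector of the same length on the third axis.
  rw [← sphereFT_single, ← Submodule.reflection_sub h, sphereFT_map]

/-! ### Spheroidal coordinates -/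

theorem R3_norm_sq (x : R3) : ‖x‖ ^ 2 = x 0 ^ 2 + x 1 ^ 2 + x 2 ^ 2 := by
  rw [EuclideanSpace.norm_sq_eq, Fin.sum_univ_three]
  simp only [Real.norm_eq_abs, sq_abs]

theorem R3_inner (x y : R3) : inner ℝ x y = x 0 * y 0 + x 1 * y 1 + x 2 * y 2 := by
  rw [PiLp.inner_apply, Fin.sum_univ_three]
  simp only [RCLike.inner_apply, conj_trivial]
  ring

theorem R3_abs_apply_le (x : R3) (i : Fin 3) : |x i| ≤ ‖x‖ := PiLp.norm_apply_le x i

/-- The level `√(1 + |η|²)` of `λ⁺` parametrized by the radius. -/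
def levelOf (p : ℝ) : ℝ := √(1 + p ^ 2)

theorem sq_levelOf (p : ℝ) : levelOf p ^ 2 = 1 + p ^ 2 := Real.sq_sqrt (by positivity)

theorem one_le_levelOf (p : ℝ) : 1 ≤ levelOf p := Real.one_le_sqrt.2 (by nlinarith [sq_nonneg p])

theorem levelOf_pos (p : ℝ) : 0 < levelOf p := one_pos.trans_le (one_le_levelOf p)

/-- The parametrization of frequency space carrying spheres to the ellipsoids `λ⁺ = const` and
the cones `η₃ = v |η|` to the hyperboloids `λ⁻ = v`. -/
def spheroidal (η : R3) : R3 :=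
  η + (√(1 + (‖η‖ ^ 2)⁻¹) * η 2 - η 2) • EuclideanSpace.single 2 (1 : ℝ)

theorem spheroidal_apply_zero (η : R3) : spheroidal η 0 = η 0 := by simp [spheroidal]

theorem spheroidal_apply_one (η : R3) : spheroidal η 1 = η 1 := by simp [spheroidal]

theorem sqrt_one_add_inv_sq {p : ℝ} (hp : 0 < p) : √(1 + (p ^ 2)⁻¹) = levelOf p / p := by
  rw [levelOf, ← Real.sqrt_sq hp.le, ← Real.sqrt_div (by positivity), Real.sqrt_sq hp.le]
  congr 1
  field_simp
  ring

theorem spheroidal_apply_two {η : R3} (hη : η ≠ 0) :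
    spheroidal η 2 = levelOf ‖η‖ * (η 2 / ‖η‖) := by
  simp only [spheroidal, PiLp.add_apply, PiLp.smul_apply, PiLp.single_apply, smul_eq_mul,
    if_true, mul_one]
  rw [sqrt_one_add_inv_sq (norm_pos_iff.2 hη)]
  ring

theorem abs_div_norm_le_one (η : R3) : |η 2 / ‖η‖| ≤ 1 := by
  rw [abs_div, abs_norm]
  exact div_le_one_of_le₀ (R3_abs_apply_le η 2) (norm_nonneg _)

theorem norm_sq_spheroidal {η : R3} (hη : η ≠ 0) :
    ‖spheroidal η‖ ^ 2 = levelOf ‖η‖ ^ 2 + (η 2 / ‖η‖) ^ 2 - 1 := by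
  have hp := norm_pos_iff.2 hη
  have h := R3_norm_sq η
  have h2 : η 2 = η 2 / ‖η‖ * ‖η‖ := by field_simp
  set v := η 2 / ‖η‖
  rw [R3_norm_sq, spheroidal_apply_zero, spheroidal_apply_one, spheroidal_apply_two hη, mul_pow,
    sq_levelOf]
  rw [h2] at h
  linear_combination -h

/-- With `|ξ|² = u² + v² - 1` and `ξ₃ = u v` the radicand is the square of `u + σ v`, and `u ≥ 1 ≥
|v|` fixes the sign of the root. -/
theorem etaPM_spheroidal {η : R3} (hη : η ≠ 0) {σ : ℝ} (hσ : σ = 1 ∨ σ = -1) :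
    etaPM σ (spheroidal η) = levelOf ‖η‖ + σ * (η 2 / ‖η‖) := by
  have h1 := one_le_levelOf ‖η‖
  have h2 := abs_le.1 (abs_div_norm_le_one η)
  rw [etaPM, norm_sq_spheroidal hη, spheroidal_apply_two hη]
  have hσ2 : σ ^ 2 = 1 := by rcases hσ with rfl | rfl <;> norm_num
  have : levelOf ‖η‖ ^ 2 + (η 2 / ‖η‖) ^ 2 - 1 + 2 * σ * (levelOf ‖η‖ * (η 2 / ‖η‖)) + 1 =
      (levelOf ‖η‖ + σ * (η 2 / ‖η‖)) ^ 2 := by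
    linear_combination -(η 2 / ‖η‖) ^ 2 * hσ2
  rw [this, Real.sqrt_sq]
  rcases hσ with rfl | rfl <;> linarith [h2.1, h2.2]

theorem lambdaPM_one_spheroidal {η : R3} (hη : η ≠ 0) :
    lambdaPM 1 (spheroidal η) = levelOf ‖η‖ := by
  rw [lambdaPM, etaPM_spheroidal hη (Or.inl rfl), etaPM_spheroidal hη (Or.inr rfl)]
  ring

theorem lambdaPM_neg_one_spheroidal {η : R3} (hη : η ≠ 0) :
    lambdaPM (-1) (spheroidal η) = η 2 / ‖η‖ := by
  rw [lambdaPM, etaPM_spheroidal hη (Or.inl rfl), etaPM_spheroidal hη (Or.inr rfl)]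
  ring

theorem sq_etaPM {σ : ℝ} (hσ : σ = 1 ∨ σ = -1) (ξ : R3) :
    etaPM σ ξ ^ 2 = ‖ξ‖ ^ 2 + 2 * σ * ξ 2 + 1 := by
  refine Real.sq_sqrt ?_
  rw [R3_norm_sq]
  have hσ2 : σ ^ 2 = 1 := by rcases hσ with rfl | rfl <;> norm_num
  nlinarith [sq_nonneg (ξ 2 + σ), sq_nonneg (ξ 0), sq_nonneg (ξ 1)]

theorem etaPM_nonneg (σ : ℝ) (ξ : R3) : 0 ≤ etaPM σ ξ := Real.sqrt_nonneg _

theorem lambdaPM_one_mul_neg_one (ξ : R3) : lambdaPM 1 ξ * lambdaPM (-1) ξ = ξ 2 := by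
  have h1 := sq_etaPM (Or.inl rfl) ξ
  have h2 := sq_etaPM (Or.inr rfl) ξ
  simp only [lambdaPM]
  linear_combination (1 / 4) * h1 - (1 / 4) * h2

theorem lambdaPM_sq_add_sq (ξ : R3) :
    lambdaPM 1 ξ ^ 2 + lambdaPM (-1) ξ ^ 2 = ‖ξ‖ ^ 2 + 1 := by
  have h1 := sq_etaPM (Or.inl rfl) ξ
  have h2 := sq_etaPM (Or.inr rfl) ξ
  simp only [lambdaPM]
  linear_combination (1 / 2) * h1 + (1 / 2) * h2

theorem lambdaPM_one_nonneg (ξ : R3) : 0 ≤ lambdaPM 1 ξ := by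
  have := etaPM_nonneg 1 ξ
  have := etaPM_nonneg (-1) ξ
  unfold lambdaPM
  linarith

theorem abs_lambdaPM_neg_one_le (ξ : R3) : |lambdaPM (-1) ξ| ≤ lambdaPM 1 ξ := by
  have := etaPM_nonneg 1 ξ
  have := etaPM_nonneg (-1) ξ
  rw [abs_le]
  unfold lambdaPM
  constructor <;> linarith

/-- This identity has a nonnegative right-hand side, which is what separates `λ⁺ ≥ 1` from `|λ⁻| ≤
1`. -/
theorem lambdaPM_product (ξ : R3) :
    (lambdaPM 1 ξ ^ 2 - 1) * (1 - lambdaPM (-1) ξ ^ 2) = ξ 0 ^ 2 + ξ 1 ^ 2 := by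
  have h1 := lambdaPM_sq_add_sq ξ
  have h2 := lambdaPM_one_mul_neg_one ξ
  rw [R3_norm_sq] at h1
  linear_combination h1 - (lambdaPM 1 ξ * lambdaPM (-1) ξ + ξ 2) * h2

theorem one_le_lambdaPM_one (ξ : R3) : 1 ≤ lambdaPM 1 ξ := by
  have h1 := lambdaPM_product ξ
  have h2 := sq_le_sq' (by linarith [(abs_le.1 (abs_lambdaPM_neg_one_le ξ)).1])
    (abs_le.1 (abs_lambdaPM_neg_one_le ξ)).2
  have h3 := lambdaPM_sq_add_sq ξ
  by_contra h
  push Not at h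
  have h4 : lambdaPM 1 ξ ^ 2 < 1 := by nlinarith [lambdaPM_one_nonneg ξ]
  nlinarith [sq_nonneg (ξ 0), sq_nonneg (ξ 1), mul_pos (sub_pos.2 h4)
    (by linarith : 0 < 1 - lambdaPM (-1) ξ ^ 2)]

theorem abs_lambdaPM_neg_one_le_one (ξ : R3) : |lambdaPM (-1) ξ| ≤ 1 := by
  have h1 := one_le_lambdaPM_one ξ
  have h2 := lambdaPM_product ξ
  rcases h1.eq_or_lt with h | h
  · exact (abs_lambdaPM_neg_one_le ξ).trans_eq h.symm
  · have h4 : 0 < lambdaPM 1 ξ ^ 2 - 1 := by nlinarith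
    have h5 : 0 ≤ 1 - lambdaPM (-1) ξ ^ 2 := by
      by_contra hn
      push Not at hn
      nlinarith [sq_nonneg (ξ 0), sq_nonneg (ξ 1), mul_pos h4 (neg_pos.2 hn)]
    exact abs_le_of_sq_le_sq (by linarith) zero_le_one

/-- The Jacobian of `spheroidal`. -/
def spheroidalJac (η : R3) : ℝ :=
  (levelOf ‖η‖ ^ 2 - (η 2 / ‖η‖) ^ 2) / (‖η‖ * levelOf ‖η‖)

theorem one_lt_levelOf {p : ℝ} (hp : 0 < p) : 1 < levelOf p :=
  Real.lt_sqrt_of_sq_lt (by nlinarith)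

theorem spheroidalJac_pos {η : R3} (hη : η ≠ 0) : 0 < spheroidalJac η := by
  have hp := norm_pos_iff.2 hη
  have h1 := one_lt_levelOf hp
  have h2 : (η 2 / ‖η‖) ^ 2 ≤ 1 := by
    rw [← sq_abs]; exact pow_le_one₀ (abs_nonneg _) (abs_div_norm_le_one η)
  have : 0 < levelOf ‖η‖ ^ 2 - (η 2 / ‖η‖) ^ 2 := by nlinarith
  have := levelOf_pos ‖η‖
  unfold spheroidalJac
  positivity

/-- Only the third coordinate is moved, so the derivative is the identity plus a rank-one map and
its determinant is `1` plus a single partial derivative. -/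
theorem exists_hasFDerivAt_spheroidal {η : R3} (hη : η ≠ 0) :
    ∃ f' : R3 →L[ℝ] R3, HasFDerivAt spheroidal f' η ∧ f'.det = spheroidalJac η := by
  have hp := norm_pos_iff.2 hη
  have hN : HasFDerivAt (fun x : R3 => ‖x‖ ^ 2) (2 • innerSL ℝ η) η :=
    (hasStrictFDerivAt_norm_sq η).hasFDerivAt
  have h2 : HasFDerivAt (fun x : R3 => x 2) (EuclideanSpace.proj (𝕜 := ℝ) (2 : Fin 3)) η :=
    (EuclideanSpace.proj (𝕜 := ℝ) (2 : Fin 3) : R3 →L[ℝ] ℝ).hasFDerivAt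
  have hs : HasFDerivAt (fun x : R3 => √(1 + (‖x‖ ^ 2)⁻¹)) _ η :=
    (((hasDerivAt_inv (pow_pos hp 2).ne').comp_hasFDerivAt η hN).const_add 1).sqrt
      (by simp only [Function.comp]; positivity)
  have hg := (hs.mul h2).sub h2
  refine ⟨_, (hasFDerivAt_id η).add (hg.smul_const (EuclideanSpace.single 2 (1 : ℝ))), ?_⟩
  have htr : ∀ g' : R3 →L[ℝ] ℝ, (ContinuousLinearMap.id ℝ R3 +
      g'.smulRight (EuclideanSpace.single 2 (1 : ℝ))).det =
        1 + g' (EuclideanSpace.single 2 (1 : ℝ)) := fun g' =>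
    LinearMap.transvection.det g'.toLinearMap (EuclideanSpace.single 2 (1 : ℝ) : R3)
  rw [htr]
  have hin : inner ℝ η (EuclideanSpace.single 2 (1 : ℝ)) = η 2 := by
    rw [EuclideanSpace.inner_single_right]; simp
  have hpr : (EuclideanSpace.proj (𝕜 := ℝ) (2 : Fin 3) : R3 →L[ℝ] ℝ)
      (EuclideanSpace.single 2 (1 : ℝ)) = 1 := by simp
  simp only [Function.comp, sub_apply, add_apply, smul_apply, innerSL_apply_apply, hin, hpr, sqrt_one_add_inv_sq hp, smul_eq_mul, nsmul_eq_mul]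
  have hl := levelOf_pos ‖η‖
  have hl2 := sq_levelOf ‖η‖
  rw [spheroidalJac]
  push_cast
  field_simp
  ring

/-- The complement of the plane `η₀ = 0`. -/
def offPlane : Set R3 := {η | η 0 ≠ 0}

theorem measurableSet_offPlane : MeasurableSet offPlane :=
  (measurableSet_eq_fun (by fun_prop) measurable_const).compl

theorem ae_mem_offPlane : ∀ᵐ η : R3, η ∈ offPlane := by
  have h : (volume : Measure R3) ((LinearMap.ker (EuclideanSpace.proj (𝕜 := ℝ) (0 : Fin 3) :
      R3 →L[ℝ] ℝ).toLinearMap : Submodule ℝ R3) : Set R3) = 0 := by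
    refine Measure.addHaar_submodule _ _ fun h => ?_
    have h1 : (EuclideanSpace.single 0 (1 : ℝ) : R3) ∈ LinearMap.ker
        (EuclideanSpace.proj (𝕜 := ℝ) (0 : Fin 3) : R3 →L[ℝ] ℝ).toLinearMap := h ▸ trivial
    simp at h1
  refine measure_mono_null (fun η hη => ?_) h
  simpa [offPlane] using hη

theorem ne_zero_of_mem_offPlane {η : R3} (hη : η ∈ offPlane) : η ≠ 0 := by
  rintro rfl
  exact hη rfl

/-- `λ⁺` recovers `|η|`, then `λ⁻` recovers `η₃`; the other coordinates are unchanged. For this last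
reason `offPlane` is a convenient domain: it is preserved, has full measure, and avoids the axis
where the coordinates degenerate. -/
theorem spheroidal_injOn : Set.InjOn spheroidal offPlane := by
  intro η hη η' hη' h
  have h0 := ne_zero_of_mem_offPlane hη
  have h0' := ne_zero_of_mem_offPlane hη'
  have e1 := congrArg (lambdaPM 1) h
  have e2 := congrArg (lambdaPM (-1)) h
  rw [lambdaPM_one_spheroidal h0, lambdaPM_one_spheroidal h0'] at e1
  rw [lambdaPM_neg_one_spheroidal h0, lambdaPM_neg_one_spheroidal h0'] at e2
  have e3 : ‖η‖ = ‖η'‖ := by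
    have := sq_levelOf ‖η‖
    rw [e1, sq_levelOf] at this
    exact (pow_left_inj₀ (norm_nonneg _) (norm_nonneg _) two_ne_zero).1 (by linarith)
  rw [e3, div_left_inj' (norm_ne_zero_iff.2 h0')] at e2
  ext i
  fin_cases i
  · simpa [spheroidal_apply_zero] using congrArg (fun x : R3 => x 0) h
  · simpa [spheroidal_apply_one] using congrArg (fun x : R3 => x 1) h
  · exact e2

/-- The preimage keeps `ξ₁, ξ₂` and has third coordinate `√(u² - 1) v`; `lambdaPM_product` shows
that its norm is `√(u² - 1)`. -/
theorem spheroidal_image : spheroidal '' offPlane = offPlane := by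
  apply Set.Subset.antisymm
  · rintro _ ⟨η, hη, rfl⟩
    simpa [offPlane, spheroidal_apply_zero] using hη
  · intro ξ hξ
    set u := lambdaPM 1 ξ with hu
    set v := lambdaPM (-1) ξ with hv
    have hprod := lambdaPM_product ξ
    have huv := lambdaPM_one_mul_neg_one ξ
    rw [← hu, ← hv] at hprod huv
    have hu1 : 0 ≤ u ^ 2 - 1 := by
      have := one_le_lambdaPM_one ξ
      nlinarith
    have hs := Real.sq_sqrt hu1
    set η : R3 := !₂[ξ 0, ξ 1, √(u ^ 2 - 1) * v] with hη
    have h0 : η 0 = ξ 0 := rfl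
    have h1 : η 1 = ξ 1 := rfl
    have h2 : η 2 = √(u ^ 2 - 1) * v := rfl
    have hmem : η ∈ offPlane := by
      change η 0 ≠ 0
      rw [h0]; exact hξ
    have hne := ne_zero_of_mem_offPlane hmem
    have hnorm : ‖η‖ ^ 2 = u ^ 2 - 1 := by
      rw [R3_norm_sq, h0, h1, h2, mul_pow, hs]
      linarith
    have hnorm' : ‖η‖ = √(u ^ 2 - 1) := by rw [← hnorm, Real.sqrt_sq (norm_nonneg _)]
    have hlev : levelOf ‖η‖ = u := by
      rw [levelOf, hnorm, add_sub_cancel, Real.sqrt_sq (lambdaPM_one_nonneg ξ)]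
    refine ⟨η, hmem, ?_⟩
    ext i
    fin_cases i
    · exact (spheroidal_apply_zero η).trans h0
    · exact (spheroidal_apply_one η).trans h1
    · refine (spheroidal_apply_two hne).trans ?_
      have : √(u ^ 2 - 1) ≠ 0 := by rw [← hnorm']; exact norm_ne_zero_iff.2 hne
      rw [hlev, h2, hnorm', mul_div_cancel_left₀ _ this, huv]
      rfl

/-- The change of variables to spheroidal coordinates. -/
theorem integral_spheroidal {G : R3 → ℂ} :
    ∫ ξ, G ξ = ∫ η, (spheroidalJac η : ℂ) * G (spheroidal η) := by
  choose! f' hf' hdet using fun (η : R3) (hη : η ∈ offPlane) =>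
    exists_hasFDerivAt_spheroidal (ne_zero_of_mem_offPlane hη)
  have key := integral_image_eq_integral_abs_det_fderiv_smul volume measurableSet_offPlane
    (fun η hη => (hf' η hη).hasFDerivWithinAt) spheroidal_injOn G
  have hr : (volume : Measure R3).restrict offPlane = volume :=
    Measure.restrict_eq_self_of_ae_mem ae_mem_offPlane
  rw [spheroidal_image, hr] at key
  rw [key]
  refine integral_congr_ae ?_
  filter_upwards [ae_mem_offPlane] with η hη
  rw [hdet η hη, abs_of_pos (spheroidalJac_pos (ne_zero_of_mem_offPlane hη)), Complex.real_smul]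

theorem integrable_spheroidal {G : R3 → ℂ} (hG : Integrable G) :
    Integrable fun η => (spheroidalJac η : ℂ) * G (spheroidal η) := by
  choose! f' hf' hdet using fun (η : R3) (hη : η ∈ offPlane) =>
    exists_hasFDerivAt_spheroidal (ne_zero_of_mem_offPlane hη)
  have key := integrableOn_image_iff_integrableOn_abs_det_fderiv_smul volume measurableSet_offPlane
    (fun η hη => (hf' η hη).hasFDerivWithinAt) spheroidal_injOn G
  have hr : (volume : Measure R3).restrict offPlane = volume :=
    Measure.restrict_eq_self_of_ae_mem ae_mem_offPlane
  rw [spheroidal_image, IntegrableOn, IntegrableOn, hr] at key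
  refine (key.1 hG).congr ?_
  filter_upwards [ae_mem_offPlane] with η hη
  rw [hdet η hη, abs_of_pos (spheroidalJac_pos (ne_zero_of_mem_offPlane hη)), Complex.real_smul]

/-! ### The weight adapted to the Jacobian -/

/-- A bounded weight, bounded below on `{λ⁺ ≤ R}` and vanishing elsewhere, whose product with the
Jacobian of spheroidal coordinates is a trigonometric polynomial in `λ⁻`. -/
def spheroidalWeight (R : ℝ) (ξ : R3) : ℝ :=
  if lambdaPM 1 ξ ≤ R then
    lambdaPM 1 ξ * (lambdaPM 1 ξ - 1 + Real.cos (Real.pi / 2 * lambdaPM (-1) ξ)) /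
      (lambdaPM 1 ξ ^ 2 - lambdaPM (-1) ξ ^ 2)
  else 0

theorem continuous_lambdaPM (σ : ℝ) : Continuous (lambdaPM σ) := by
  unfold lambdaPM etaPM
  fun_prop

theorem measurable_spheroidalWeight (R : ℝ) : Measurable (spheroidalWeight R) := by
  have h1 := (continuous_lambdaPM 1).measurable
  have h2 := (continuous_lambdaPM (-1)).measurable
  unfold spheroidalWeight
  exact Measurable.ite (measurableSet_le h1 measurable_const) (by fun_prop) measurable_const

theorem one_sub_abs_le_cos {v : ℝ} (hv : |v| ≤ 1) : 1 - |v| ≤ Real.cos (Real.pi / 2 * v) := by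
  have hπ := Real.pi_pos
  rw [← Real.cos_abs, abs_mul, abs_of_pos (by positivity : 0 < Real.pi / 2)]
  have := Real.one_sub_mul_le_cos (x := Real.pi / 2 * |v|) (by positivity)
    (by nlinarith [abs_nonneg v])
  refine le_trans (le_of_eq ?_) this
  field_simp

theorem cos_le_mul_one_sub_abs (v : ℝ) (hv : |v| ≤ 1) :
    Real.cos (Real.pi / 2 * v) ≤ Real.pi / 2 * (1 - |v|) := by
  have hπ := Real.pi_pos
  rw [← Real.cos_abs, abs_mul, abs_of_pos (by positivity : 0 < Real.pi / 2),
    ← Real.sin_pi_div_two_sub]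
  refine (Real.sin_le (by nlinarith)).trans (le_of_eq (by ring))

/-- On `|v| ≤ 1`, `cos(πv/2)` lies between `1 - |v|` and `2 (1 - |v|)`, so the numerator compares to
`u (u - |v|)`; the denominator is `(u - |v|)(u + |v|)` with `u ≤ u + |v| ≤ 2u`. The cosine is thus a
trigonometric substitute for `1 - |v|`. -/
theorem spheroidalWeight_bounds {u v : ℝ} (hu : 1 ≤ u) (hv : |v| ≤ 1) (huv : |v| < u) :
    1 / 2 ≤ u * (u - 1 + Real.cos (Real.pi / 2 * v)) / (u ^ 2 - v ^ 2) ∧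
      u * (u - 1 + Real.cos (Real.pi / 2 * v)) / (u ^ 2 - v ^ 2) ≤ 2 := by
  have h1 := one_sub_abs_le_cos hv
  have h2 := cos_le_mul_one_sub_abs v hv
  have hπ := Real.pi_lt_four
  have h0 := abs_nonneg v
  have hd : u ^ 2 - v ^ 2 = (u - |v|) * (u + |v|) := by rw [← sq_abs v]; ring
  have hd0 : 0 < u ^ 2 - v ^ 2 := by rw [hd]; exact mul_pos (by linarith) (by linarith)
  rw [le_div_iff₀ hd0, div_le_iff₀ hd0, hd]
  have h3 : u - |v| ≤ u - 1 + Real.cos (Real.pi / 2 * v) := by linarith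
  have h4 : u - 1 + Real.cos (Real.pi / 2 * v) ≤ 2 * (u - |v|) := by nlinarith
  constructor
  · nlinarith [mul_le_mul_of_nonneg_left h3 (by linarith : 0 ≤ u), mul_nonneg
      (by linarith : 0 ≤ u - |v|) (by linarith : 0 ≤ u - |v|)]
  · nlinarith [mul_le_mul_of_nonneg_left h4 (by linarith : 0 ≤ u), mul_nonneg
      (by linarith : 0 ≤ u - |v|) h0]

theorem spheroidalWeight_nonneg (R : ℝ) (ξ : R3) : 0 ≤ spheroidalWeight R ξ := by
  have h1 := one_le_lambdaPM_one ξ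
  have h2 := abs_lambdaPM_neg_one_le_one ξ
  unfold spheroidalWeight
  split_ifs
  -- If `|λ⁻| = λ⁺`, the denominator vanishes and the quotient takes its default value `0`.
  · rcases (abs_lambdaPM_neg_one_le ξ).eq_or_lt with h | h
    · rw [← sq_abs (lambdaPM (-1) ξ), h, sub_self, div_zero]
    · exact le_trans (by norm_num) (spheroidalWeight_bounds h1 h2 h).1
  · exact le_rfl

theorem spheroidalWeight_le (R : ℝ) (ξ : R3) : spheroidalWeight R ξ ≤ 2 := by
  have h1 := one_le_lambdaPM_one ξ
  have h2 := abs_lambdaPM_neg_one_le_one ξ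
  unfold spheroidalWeight
  split_ifs
  · rcases (abs_lambdaPM_neg_one_le ξ).eq_or_lt with h | h
    · rw [← sq_abs (lambdaPM (-1) ξ), h, sub_self, div_zero]; norm_num
    · exact (spheroidalWeight_bounds h1 h2 h).2
  · norm_num

theorem half_le_spheroidalWeight {R : ℝ} {ξ : R3} (hξ : ξ ∈ offPlane) (hR : lambdaPM 1 ξ ≤ R) :
    1 / 2 ≤ spheroidalWeight R ξ := by
  rw [spheroidalWeight, if_pos hR]
  refine (spheroidalWeight_bounds (one_le_lambdaPM_one ξ) (abs_lambdaPM_neg_one_le_one ξ) ?_).1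
  -- Equality `|λ⁻| = λ⁺` would make the left side of `lambdaPM_product` nonpositive and put `ξ` on
  -- the third axis.
  refine lt_of_le_of_ne (abs_lambdaPM_neg_one_le ξ) fun h => hξ ?_
  have h1 := lambdaPM_product ξ
  rw [← h, sq_abs] at h1
  have h2 : ξ 0 ^ 2 + ξ 1 ^ 2 ≤ 0 := by
    rw [← h1]; nlinarith [sq_nonneg (lambdaPM (-1) ξ ^ 2 - 1)]
  nlinarith [sq_nonneg (ξ 0), sq_nonneg (ξ 1)]

theorem norm_le_of_lambdaPM_le {R : ℝ} {ξ : R3} (hR : lambdaPM 1 ξ ≤ R) : ‖ξ‖ ≤ R := by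
  have h1 := lambdaPM_sq_add_sq ξ
  have h2 := abs_lambdaPM_neg_one_le_one ξ
  have h3 : lambdaPM (-1) ξ ^ 2 ≤ 1 := by rw [← sq_abs]; exact pow_le_one₀ (abs_nonneg _) h2
  have h4 : ‖ξ‖ ≤ lambdaPM 1 ξ := by
    refine (le_abs_self _).trans (abs_le_of_sq_le_sq ?_ (lambdaPM_one_nonneg ξ))
    linarith
  exact h4.trans hR

theorem lambdaPM_one_le (ξ : R3) : lambdaPM 1 ξ ≤ 1 + ‖ξ‖ := by
  have h1 := lambdaPM_sq_add_sq ξ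
  refine (le_abs_self _).trans (abs_le_of_sq_le_sq ?_ (by positivity))
  nlinarith [norm_nonneg ξ, sq_nonneg (lambdaPM (-1) ξ)]

theorem integrable_spheroidalWeight (R : ℝ) : Integrable (spheroidalWeight R) := by
  have h : Integrable ((Metric.closedBall (0 : R3) R).indicator fun _ => (2 : ℝ)) :=
    (integrable_indicator_iff Metric.isClosed_closedBall.measurableSet).2
      (integrableOn_const (measure_closedBall_lt_top).ne)
  refine h.mono' (measurable_spheroidalWeight R).aestronglyMeasurable
    (Filter.Eventually.of_forall fun ξ => ?_)
  rw [Real.norm_eq_abs, abs_of_nonneg (spheroidalWeight_nonneg R ξ)]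
  by_cases hξ : ξ ∈ Metric.closedBall (0 : R3) R
  · rw [Set.indicator_of_mem hξ]; exact spheroidalWeight_le R ξ
  · rw [Set.indicator_of_notMem hξ, spheroidalWeight, if_neg]
    exact fun h => hξ (mem_closedBall_zero_iff.2 (norm_le_of_lambdaPM_le h))

/-- The factor `u² - v²` of the Jacobian cancels the denominator of the weight; this is what the
weight was built for. -/
theorem spheroidalJac_mul_weight {R : ℝ} {η : R3} (hη : η ≠ 0) :
    spheroidalJac η * spheroidalWeight R (spheroidal η) =
      if levelOf ‖η‖ ≤ R then
        (levelOf ‖η‖ - 1 + Real.cos (Real.pi / 2 * (η 2 / ‖η‖))) / ‖η‖ else 0 := by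
  have hp := norm_pos_iff.2 hη
  have hl := levelOf_pos ‖η‖
  have hj := spheroidalJac_pos hη
  rw [spheroidalWeight, lambdaPM_one_spheroidal hη, lambdaPM_neg_one_spheroidal hη]
  split_ifs
  · rw [spheroidalJac] at hj ⊢
    have hd : levelOf ‖η‖ ^ 2 - (η 2 / ‖η‖) ^ 2 ≠ 0 := by
      intro h; rw [h, zero_div] at hj; exact lt_irrefl _ hj
    set d := levelOf ‖η‖ ^ 2 - (η 2 / ‖η‖) ^ 2
    set w := Real.cos (Real.pi / 2 * (η 2 / ‖η‖))
    field_simp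
  · rw [mul_zero]

/-! ### The kernel as a one-dimensional integral, and its decay -/

/-- The profile on the ellipsoid `λ⁺ = u`. -/
def kernelProfile (X z τ c u : ℝ) : ℂ :=
  Complex.exp ((τ * u : ℝ) * Complex.I) *
    (((u - 1) * Real.sinc (phaseLen X z c u) +
      (Real.sinc (phaseLen X z (c + Real.pi / 2) u) +
        Real.sinc (phaseLen X z (c - Real.pi / 2) u)) / 2 : ℝ) : ℂ)

-- The whole phase is linear in `ω`, with frequency vector `Y c`. Splitting the cosine into
-- exponentials shifts `c` by `±π/2`, so three values of `sphereFT` appear.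
open Metric in
theorem integral_sphere_profile (x : R3) (τ c p : ℝ) :
    ∫ ω : sphere (0 : R3) 1, ((levelOf p - 1 + Real.cos (Real.pi / 2 * (ω : R3) 2) : ℝ) : ℂ) *
      Complex.exp ((τ * levelOf p + c * (ω : R3) 2 + (p * (x 0 * (ω : R3) 0 + x 1 * (ω : R3) 1) +
        x 2 * (levelOf p * (ω : R3) 2)) : ℝ) * Complex.I) ∂(volume : Measure R3).toSphere =
      4 * Real.pi * kernelProfile (√(x 0 ^ 2 + x 1 ^ 2)) (x 2) τ c (levelOf p) := by
  set Y : ℝ → R3 := fun c => !₂[p * x 0, p * x 1, levelOf p * x 2 + c] with hY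
  have hnorm : ∀ c, ‖Y c‖ = phaseLen (√(x 0 ^ 2 + x 1 ^ 2)) (x 2) c (levelOf p) := fun c => by
    rw [phaseLen, phaseSq, sq_levelOf, Real.sq_sqrt (by positivity), ← Real.sqrt_sq (norm_nonneg _),
      R3_norm_sq]
    congr 1
    simp [hY]
    ring
  have hexp : ∀ (c : ℝ), Integrable (fun ω : sphere (0 : R3) 1 =>
      Complex.exp ((inner ℝ (Y c) (ω : R3) : ℝ) * Complex.I)) (volume : Measure R3).toSphere :=
    fun c => Integrable.of_bound (C := 1) (by fun_prop)
      (Filter.Eventually.of_forall fun ω => (Complex.norm_exp_ofReal_mul_I _).le)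
  have hpt : ∀ ω : sphere (0 : R3) 1,
      ((levelOf p - 1 + Real.cos (Real.pi / 2 * (ω : R3) 2) : ℝ) : ℂ) *
      Complex.exp ((τ * levelOf p + c * (ω : R3) 2 + (p * (x 0 * (ω : R3) 0 + x 1 * (ω : R3) 1) +
        x 2 * (levelOf p * (ω : R3) 2)) : ℝ) * Complex.I) =
      Complex.exp ((τ * levelOf p : ℝ) * Complex.I) *
        (((levelOf p - 1 : ℝ) : ℂ) * Complex.exp ((inner ℝ (Y c) (ω : R3) : ℝ) * Complex.I) +
        ((1 / 2 : ℂ) * Complex.exp ((inner ℝ (Y (c + Real.pi / 2)) (ω : R3) : ℝ) * Complex.I) +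
        (1 / 2 : ℂ) * Complex.exp ((inner ℝ (Y (c - Real.pi / 2)) (ω : R3) : ℝ) * Complex.I))) := by
    intro ω
    have e1 : (τ * levelOf p + c * (ω : R3) 2 + (p * (x 0 * (ω : R3) 0 + x 1 * (ω : R3) 1) +
        x 2 * (levelOf p * (ω : R3) 2)) : ℝ) = τ * levelOf p + inner ℝ (Y c) (ω : R3) := by
      rw [R3_inner]; simp [hY]; ring
    have e2 : inner ℝ (Y (c + Real.pi / 2)) (ω : R3) = inner ℝ (Y c) (ω : R3) +
        Real.pi / 2 * (ω : R3) 2 := by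
      rw [R3_inner, R3_inner]; simp [hY]; ring
    have e3 : inner ℝ (Y (c - Real.pi / 2)) (ω : R3) = inner ℝ (Y c) (ω : R3) +
        -(Real.pi / 2 * (ω : R3) 2) := by
      rw [R3_inner, R3_inner]; simp [hY]; ring
    rw [e1, e2, e3]
    push_cast
    simp only [add_mul, Complex.exp_add, Complex.cos]
    ring
  simp_rw [hpt]
  rw [integral_const_mul, integral_add
    (g := fun ω : sphere (0 : R3) 1 =>
      (1 / 2 : ℂ) * Complex.exp ((inner ℝ (Y (c + Real.pi / 2)) (ω : R3) : ℝ) * Complex.I) +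
        (1 / 2 : ℂ) * Complex.exp ((inner ℝ (Y (c - Real.pi / 2)) (ω : R3) : ℝ) * Complex.I))
    ((hexp _).const_mul _)
    (((hexp _).const_mul _).add ((hexp _).const_mul _)),
    integral_add ((hexp _).const_mul _) ((hexp _).const_mul _), integral_const_mul,
    integral_const_mul, integral_const_mul]
  change _ * (_ * sphereFT _ + (_ * sphereFT _ + _ * sphereFT _)) = _
  rw [sphereFT_eq, sphereFT_eq, sphereFT_eq, hnorm, hnorm, hnorm, kernelProfile]
  push_cast
  ring

-- Pass to spheroidal, then polar coordinates. The polar factor `p²` times the `1/p` left by the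
-- weighted Jacobian is `p`, and `p dp = u du` for `u = √(1 + p²)`; the cut-off `λ⁺ ≤ R` becomes the
-- upper limit.
open Set Metric in
theorem integral_weight_mul_exp (R : ℝ) (hR : 1 ≤ R) (τ c : ℝ) (x : R3) :
    ∫ ξ, (spheroidalWeight R ξ : ℂ) * Complex.exp ((τ * lambdaPM 1 ξ + c * lambdaPM (-1) ξ +
      inner ℝ x ξ : ℝ) * Complex.I) =
    4 * Real.pi * ∫ u in (1 : ℝ)..R,
      (u : ℂ) * kernelProfile (√(x 0 ^ 2 + x 1 ^ 2)) (x 2) τ c u := by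
  have hGi : Integrable fun ξ : R3 => (spheroidalWeight R ξ : ℂ) *
      Complex.exp ((τ * lambdaPM 1 ξ + c * lambdaPM (-1) ξ + inner ℝ x ξ : ℝ) * Complex.I) := by
    have h1 := continuous_lambdaPM 1
    have h2 := continuous_lambdaPM (-1)
    refine (integrable_spheroidalWeight R).ofReal.mul_bdd (c := 1)
      (Continuous.aestronglyMeasurable (by fun_prop)) (Filter.Eventually.of_forall fun ξ =>
        (Complex.norm_exp_ofReal_mul_I _).le)
  rw [integral_spheroidal, integral_eq_integral_sphere (integrable_spheroidal hGi)]
  have h : ∀ p ∈ Ioi (0 : ℝ), (p : ℂ) ^ 2 * ∫ ω : sphere (0 : R3) 1,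
      (spheroidalJac (p • (ω : R3)) : ℂ) *
        ((spheroidalWeight R (spheroidal (p • (ω : R3))) : ℂ) *
          Complex.exp ((τ * lambdaPM 1 (spheroidal (p • (ω : R3))) +
            c * lambdaPM (-1) (spheroidal (p • (ω : R3))) +
            inner ℝ x (spheroidal (p • (ω : R3))) : ℝ) * Complex.I))
        ∂(volume : Measure R3).toSphere =
      4 * Real.pi * (|p / levelOf p| • (Iic R).indicator (fun u : ℝ =>
        (u : ℂ) * kernelProfile (√(x 0 ^ 2 + x 1 ^ 2)) (x 2) τ c u) (levelOf p)) := fun p hp => by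
    have hp : 0 < p := hp
    have hl := levelOf_pos p
    have hn : ∀ ω : sphere (0 : R3) 1, ‖p • (ω : R3)‖ = p := fun ω => by
      rw [norm_smul, norm_eq_of_mem_sphere, mul_one, Real.norm_eq_abs, abs_of_pos hp]
    have h0 : ∀ ω : sphere (0 : R3) 1, p • (ω : R3) ≠ 0 := fun ω =>
      norm_pos_iff.1 (by rw [hn]; exact hp)
    have hω : ∀ ω : sphere (0 : R3) 1, (p • (ω : R3)) 2 / p = (ω : R3) 2 := fun ω => by
      simp only [PiLp.smul_apply, smul_eq_mul]; field_simp
    have hin : ∀ ω : sphere (0 : R3) 1, inner ℝ x (spheroidal (p • (ω : R3))) =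
        p * (x 0 * (ω : R3) 0 + x 1 * (ω : R3) 1) + x 2 * (levelOf p * (ω : R3) 2) := fun ω => by
      rw [R3_inner, spheroidal_apply_zero, spheroidal_apply_one, spheroidal_apply_two (h0 ω), hn,
        hω]
      simp only [PiLp.smul_apply, smul_eq_mul]
      ring
    have hpt : ∀ ω : sphere (0 : R3) 1, (spheroidalJac (p • (ω : R3)) : ℂ) *
        ((spheroidalWeight R (spheroidal (p • (ω : R3))) : ℂ) *
          Complex.exp ((τ * lambdaPM 1 (spheroidal (p • (ω : R3))) +
            c * lambdaPM (-1) (spheroidal (p • (ω : R3))) +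
            inner ℝ x (spheroidal (p • (ω : R3))) : ℝ) * Complex.I)) =
        (if levelOf p ≤ R then (p : ℂ)⁻¹ else 0) *
        (((levelOf p - 1 + Real.cos (Real.pi / 2 * (ω : R3) 2) : ℝ) : ℂ) *
        Complex.exp ((τ * levelOf p + c * (ω : R3) 2 + (p * (x 0 * (ω : R3) 0 + x 1 * (ω : R3) 1) +
        x 2 * (levelOf p * (ω : R3) 2)) : ℝ) * Complex.I)) := fun ω => by
      rw [← mul_assoc, ← Complex.ofReal_mul, spheroidalJac_mul_weight (h0 ω),
        lambdaPM_one_spheroidal (h0 ω), lambdaPM_neg_one_spheroidal (h0 ω), hin, hn, hω]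
      split_ifs
      · push_cast; ring
      · simp
    simp_rw [hpt]
    rw [integral_const_mul, integral_sphere_profile, abs_of_pos (by positivity), Complex.real_smul]
    have hp' : (p : ℂ) ≠ 0 := by exact_mod_cast hp.ne'
    have hl' : (levelOf p : ℂ) ≠ 0 := by exact_mod_cast hl.ne'
    by_cases hpR : levelOf p ≤ R
    · rw [if_pos hpR, indicator_of_mem (show levelOf p ∈ Iic R from hpR)]
      push_cast
      field_simp
    · rw [if_neg hpR, indicator_of_notMem (show levelOf p ∉ Iic R from hpR)]
      simp
  rw [setIntegral_congr_fun measurableSet_Ioi h, integral_const_mul]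
  congr 1
  have hd : ∀ p ∈ Ioi (0 : ℝ), HasDerivWithinAt levelOf (p / levelOf p) (Ioi 0) p := fun p _ => by
    refine HasDerivAt.hasDerivWithinAt ?_
    have hl := levelOf_pos p
    convert! (((hasDerivAt_id p).pow 2).const_add 1).sqrt
      (by have h : 0 < 1 + p ^ 2 := by positivity
          exact h.ne') using 1
    simp [levelOf]
    field_simp
  have hinj : InjOn levelOf (Ioi 0) := fun p hp p' hp' h => by
    have := sq_levelOf p
    rw [h, sq_levelOf] at this
    exact (pow_left_inj₀ (le_of_lt hp) (le_of_lt hp') two_ne_zero).1 (by linarith)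
  have himg : levelOf '' Ioi 0 = Ioi 1 := by
    apply Subset.antisymm
    · rintro _ ⟨p, hp, rfl⟩
      exact one_lt_levelOf hp
    · intro u hu
      have hu : 1 < u := hu
      refine ⟨√(u ^ 2 - 1), Real.sqrt_pos.2 (by nlinarith), ?_⟩
      rw [levelOf, Real.sq_sqrt (by nlinarith), add_sub_cancel, Real.sqrt_sq (by linarith)]
  have key := integral_image_eq_integral_abs_deriv_smul measurableSet_Ioi hd hinj
    ((Iic R).indicator (fun u : ℝ =>
        (u : ℂ) * kernelProfile (√(x 0 ^ 2 + x 1 ^ 2)) (x 2) τ c u))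
  rw [← key, himg, setIntegral_indicator measurableSet_Iic, intervalIntegral.integral_of_le hR,
    Ioi_inter_Iic]

-- The length may fail to be differentiable at `u = 1`, so the estimates are proved on `[α, R]` with
-- `α > 1` and carried to `α = 1` by continuity.
open Set Filter Topology in
theorem norm_integral_le_of_forall_lt {h : ℝ → ℂ} (hc : Continuous h) {a b M : ℝ} (hab : a < b)
    (H : ∀ α, a < α → α ≤ b → ‖∫ u in α..b, h u‖ ≤ M) : ‖∫ u in a..b, h u‖ ≤ M := by
  have hcont : Continuous fun α => ∫ u in α..b, h u := by
    have : (fun α => ∫ u in α..b, h u) = fun α => -∫ u in b..α, h u :=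
      funext fun α => intervalIntegral.integral_symm _ _
    rw [this]
    exact (intervalIntegral.continuous_primitive (fun s t => hc.intervalIntegrable s t) b).neg
  have ht : Tendsto (fun α => ‖∫ u in α..b, h u‖) (𝓝[>] a) (𝓝 ‖∫ u in a..b, h u‖) :=
    (hcont.norm.tendsto a).mono_left nhdsWithin_le_nhds
  refine le_of_tendsto ht ?_
  filter_upwards [Ioc_mem_nhdsGT hab] with α hα using H α hα.1 hα.2

theorem continuous_sinc_phaseLen (X z c : ℝ) : Continuous fun u => Real.sinc (phaseLen X z c u) :=
  Real.continuous_sinc.comp continuous_phaseLen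

theorem continuous_mul_kernelProfile (X z τ c : ℝ) :
    Continuous fun u : ℝ => (u : ℂ) * kernelProfile X z τ c u := by
  have h1 := continuous_sinc_phaseLen X z c
  have h2 := continuous_sinc_phaseLen X z (c + Real.pi / 2)
  have h3 := continuous_sinc_phaseLen X z (c - Real.pi / 2)
  unfold kernelProfile
  fun_prop

theorem integral_mul_kernelProfile (X z τ c α R : ℝ) :
    ∫ u in α..R, (u : ℂ) * kernelProfile X z τ c u =
      (∫ u in α..R, Complex.exp ((τ * u : ℝ) * Complex.I) * ((u * (u - 1) : ℝ) : ℂ) *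
        (Real.sinc (phaseLen X z c u) : ℂ)) +
      ((∫ u in α..R, Complex.exp ((τ * u : ℝ) * Complex.I) * ((u * 1 : ℝ) : ℂ) *
        (Real.sinc (phaseLen X z (c + Real.pi / 2) u) : ℂ)) +
      ∫ u in α..R, Complex.exp ((τ * u : ℝ) * Complex.I) * ((u * 1 : ℝ) : ℂ) *
        (Real.sinc (phaseLen X z (c - Real.pi / 2) u) : ℂ)) / 2 := by
  have h1 := continuous_sinc_phaseLen X z c
  have h2 := continuous_sinc_phaseLen X z (c + Real.pi / 2)
  have h3 := continuous_sinc_phaseLen X z (c - Real.pi / 2)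
  rw [← intervalIntegral.integral_add, ← intervalIntegral.integral_div,
    ← intervalIntegral.integral_add]
  · refine intervalIntegral.integral_congr fun u _ => ?_
    simp only [kernelProfile]
    push_cast
    ring
  all_goals exact Continuous.intervalIntegrable (by fun_prop) _ _

/-- The case of `λ⁺`: the displacements in the three terms are `0` and `±π/2`, the range allowed by
`norm_integral_exp_sinc_le`. -/
theorem norm_integral_kernelProfile_le {X z τ R : ℝ} (hX : 0 < X) (hR : 1 < R) (hτ : τ ≠ 0) :
    ‖∫ u in (1 : ℝ)..R, (u : ℂ) * kernelProfile X z τ 0 u‖ ≤ 40 * R ^ 3 / |τ| := by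
  have hπ := Real.pi_pos
  refine norm_integral_le_of_forall_lt (continuous_mul_kernelProfile X z τ 0) hR fun α hα hαR => ?_
  rw [integral_mul_kernelProfile]
  have h1 := norm_integral_exp_sinc_le (z := z) (c := 0) (b := fun u => u - 1) (b' := fun _ => 1)
    hX (by rw [abs_zero]; positivity) hτ hα hαR (fun u => (hasDerivAt_id u).sub_const 1)
    continuous_const (fun _ _ => zero_le_one) (fun u hu => by linarith [hu.1])
    (fun u hu => by linarith [hu.2])
  have h2 : ∀ c : ℝ, |c| ≤ Real.pi / 2 → _ := fun c hc =>
    norm_integral_exp_sinc_le (z := z) (c := c) (b := fun _ => 1) (b' := fun _ => 0)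
    hX hc hτ hα hαR (fun u => hasDerivAt_const u 1)
    continuous_const (fun _ _ => le_rfl) (fun u hu => zero_le_one)
    (fun u hu => hR.le)
  have e1 := h2 (0 + Real.pi / 2) (by rw [zero_add, abs_of_pos (by positivity)])
  have e2 := h2 (0 - Real.pi / 2) (by rw [zero_sub, abs_neg, abs_of_pos (by positivity)])
  refine (norm_add_le _ _).trans ?_
  rw [norm_div, Complex.norm_ofNat]
  have := norm_add_le (∫ u in α..R, Complex.exp ((τ * u : ℝ) * Complex.I) * ((u * 1 : ℝ) : ℂ) *
        (Real.sinc (phaseLen X z (0 + Real.pi / 2) u) : ℂ))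
      (∫ u in α..R, Complex.exp ((τ * u : ℝ) * Complex.I) * ((u * 1 : ℝ) : ℂ) *
        (Real.sinc (phaseLen X z (0 - Real.pi / 2) u) : ℂ))
  have : 40 * R ^ 3 / |τ| = 2 * (20 * R ^ 3 / |τ|) := by ring
  linarith

/-- The case of `λ⁻`. For `|c| < π` boundedness of the profile by `u` is enough; for `|c| ≥ π` the
shifted displacements satisfy `|c ± π/2| ≥ |c|/2`. The constant is `24 + 48`. -/
theorem norm_integral_kernelProfile_le' {X z c R : ℝ} (hX : 0 < X) (hR : 1 < R) (hc : c ≠ 0) :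
    ‖∫ u in (1 : ℝ)..R, (u : ℂ) * kernelProfile X z 0 c u‖ ≤ 72 * R ^ 3 / |c| := by
  have hπ := Real.pi_pos
  have hc' := abs_pos.2 hc
  refine norm_integral_le_of_forall_lt (continuous_mul_kernelProfile X z 0 c) hR fun α hα hαR => ?_
  have hR3 : 0 < R ^ 3 := pow_pos (by linarith) 3
  by_cases hcπ : |c| < Real.pi
  · have hb : ∀ u ∈ Set.uIoc α R, ‖(u : ℂ) * kernelProfile X z 0 c u‖ ≤ R ^ 2 := fun u hu => by
      rw [Set.uIoc_of_le hαR] at hu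
      have hu1 : 1 < u := hα.trans hu.1
      have e1 := abs_le.1 (Real.abs_sinc_le_one (phaseLen X z c u))
      have e2 := abs_le.1 (Real.abs_sinc_le_one (phaseLen X z (c + Real.pi / 2) u))
      have e3 := abs_le.1 (Real.abs_sinc_le_one (phaseLen X z (c - Real.pi / 2) u))
      rw [kernelProfile, norm_mul, norm_mul, Complex.norm_exp_ofReal_mul_I, one_mul,
        Complex.norm_real, Complex.norm_real, Real.norm_eq_abs, Real.norm_eq_abs,
        abs_of_pos (by linarith : 0 < u)]
      have e4 : |(u - 1) * Real.sinc (phaseLen X z c u) +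
        (Real.sinc (phaseLen X z (c + Real.pi / 2) u) +
          Real.sinc (phaseLen X z (c - Real.pi / 2) u)) / 2| ≤ u := by
        rw [abs_le]
        constructor <;> nlinarith [e1.1, e1.2, e2.1, e2.2, e3.1, e3.2]
      calc u * _ ≤ R * R := mul_le_mul hu.2 (e4.trans hu.2) (abs_nonneg _) (by linarith)
        _ = R ^ 2 := by ring
    refine (intervalIntegral.norm_integral_le_of_norm_le_const hb).trans ?_
    rw [abs_of_nonneg (by linarith), le_div_iff₀ hc']
    have h4 := Real.pi_lt_four
    calc R ^ 2 * (R - α) * |c| ≤ R ^ 2 * R * 4 := by gcongr <;> linarith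
      _ ≤ 72 * R ^ 3 := by nlinarith
  · push Not at hcπ
    have hcast : ∀ (b : ℝ → ℝ) (c' : ℝ), ‖∫ u in α..R, Complex.exp ((0 * u : ℝ) * Complex.I) *
        ((b u : ℝ) : ℂ) * (Real.sinc (phaseLen X z c' u) : ℂ)‖ =
        |∫ u in α..R, b u * Real.sinc (phaseLen X z c' u)| := fun b c' => by
      rw [← Real.norm_eq_abs, ← Complex.norm_real, ← intervalIntegral.integral_ofReal]
      congr 1
      refine intervalIntegral.integral_congr fun u _ => ?_
      simp
    rw [integral_mul_kernelProfile]
    have h1 := abs_integral_sinc_le (z := z) (b := fun u => u * (u - 1))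
      (b' := fun u => 1 * (u - 1) + u * 1) (B := R ^ 2)
      hX hα hαR hc (fun u => (hasDerivAt_id u).mul ((hasDerivAt_id u).sub_const 1))
      (by fun_prop) (fun u hu => by linarith [hu.1])
      (fun u hu => mul_nonneg (by linarith [hu.1]) (by linarith [hu.1]))
      (fun u hu => by nlinarith [hu.1, hu.2])
    have h2 : ∀ c' : ℝ, |c| / 2 ≤ |c'| → |∫ u in α..R, u * 1 * Real.sinc (phaseLen X z c' u)| ≤
        48 * R ^ 3 / |c| := fun c' hc1 => by
      have h0 : 0 < |c'| := lt_of_lt_of_le (by positivity) hc1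
      refine (abs_integral_sinc_le (z := z) (b := fun u => u * 1)
        (b' := fun u => 1) (B := R) hX hα hαR (abs_pos.1 h0)
        (fun u => by simp only [mul_one]; exact hasDerivAt_id' u)
        (by fun_prop) (fun u hu => zero_le_one) (fun u hu => by linarith [hu.1])
        (fun u hu => by linarith [hu.2])).trans ?_
      rw [div_le_div_iff₀ h0 hc']
      have : R ^ 2 ≤ R ^ 3 := by nlinarith
      calc 24 * R * R * |c| ≤ 24 * R ^ 3 * (2 * |c'|) := by nlinarith
        _ = _ := by ring
    have e1 := h2 (c + Real.pi / 2) (by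
      have := abs_sub_abs_le_abs_sub c (-(Real.pi / 2))
      rw [abs_neg, abs_of_pos (by positivity : 0 < Real.pi / 2), sub_neg_eq_add] at this
      linarith)
    have e2 := h2 (c - Real.pi / 2) (by
      have := abs_sub_abs_le_abs_sub c (Real.pi / 2)
      rw [abs_of_pos (by positivity : 0 < Real.pi / 2)] at this
      linarith)
    rw [← hcast] at h1 e1 e2
    refine (norm_add_le _ _).trans ?_
    rw [norm_div, Complex.norm_ofNat]
    have := norm_add_le (∫ u in α..R, Complex.exp ((0 * u : ℝ) * Complex.I) * ((u * 1 : ℝ) : ℂ) *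
          (Real.sinc (phaseLen X z (c + Real.pi / 2) u) : ℂ))
        (∫ u in α..R, Complex.exp ((0 * u : ℝ) * Complex.I) * ((u * 1 : ℝ) : ℂ) *
          (Real.sinc (phaseLen X z (c - Real.pi / 2) u) : ℂ))
    have e3 : 72 * R ^ 3 / |c| = 24 * R ^ 2 * R / |c| + 48 * R ^ 3 / |c| := by ring
    linarith

/-- The dispersive estimate. -/
theorem norm_integral_weight_mul_exp_le {σ : ℝ} (hσ : σ = 1 ∨ σ = -1) {R t : ℝ} (hR : 1 < R)
    (ht : t ≠ 0) {x : R3} (hx : x ∈ offPlane) :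
    ‖∫ ξ, (spheroidalWeight R ξ : ℂ) *
      Complex.exp ((t * lambdaPM σ ξ + inner ℝ x ξ : ℝ) * Complex.I)‖ ≤
      288 * Real.pi * R ^ 3 / |t| := by
  have hX : 0 < √(x 0 ^ 2 + x 1 ^ 2) := by
    have : x 0 ≠ 0 := hx
    positivity
  have hπ := Real.pi_pos
  -- The constant is `4π`, from the sphere, times `72`, the larger of the two bounds for the
  -- profile.
  have key : ∀ τ c : ℝ, ‖∫ u in (1 : ℝ)..R, (u : ℂ) *
      kernelProfile (√(x 0 ^ 2 + x 1 ^ 2)) (x 2) τ c u‖ ≤ 72 * R ^ 3 / |t| →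
      ‖∫ ξ, (spheroidalWeight R ξ : ℂ) * Complex.exp ((τ * lambdaPM 1 ξ + c * lambdaPM (-1) ξ +
        inner ℝ x ξ : ℝ) * Complex.I)‖ ≤ 288 * Real.pi * R ^ 3 / |t| := fun τ c h => by
    rw [integral_weight_mul_exp R hR.le, norm_mul, norm_mul, Complex.norm_real, Complex.norm_ofNat,
      Real.norm_eq_abs, abs_of_pos hπ]
    calc 4 * Real.pi * _ ≤ 4 * Real.pi * (72 * R ^ 3 / |t|) := by gcongr
      _ = _ := by ring
  have ht' := abs_pos.2 ht
  have hR3 : 0 < R ^ 3 := pow_pos (by linarith) 3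
  rcases hσ with rfl | rfl
  · have := key t 0 ((norm_integral_kernelProfile_le hX hR ht).trans (by gcongr; norm_num))
    simpa only [zero_mul, add_zero] using this
  · have := key 0 t (norm_integral_kernelProfile_le' hX hR ht)
    simpa only [zero_mul, zero_add] using this

/-! ### Hardy-Littlewood-Sobolev inequality on the line -/

theorem lintegral_comp_abs_eq {g : ℝ → ℝ≥0∞} :
    ∫⁻ τ, g |τ| = 2 * ∫⁻ τ in Set.Ioi 0, g τ := by
  have h1 : ∫⁻ τ in Set.Ioi (0 : ℝ), g |τ| = ∫⁻ τ in Set.Ioi 0, g τ :=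
    setLIntegral_congr_fun measurableSet_Ioi fun τ hτ => by
      rw [abs_of_pos hτ]
  have h2 : ∫⁻ τ in Set.Iic (0 : ℝ), g |τ| = ∫⁻ τ in Set.Ioi 0, g τ := by
    rw [← setLIntegral_congr Iio_ae_eq_Iic]
    have := (Measure.measurePreserving_neg (volume : Measure ℝ)).setLIntegral_comp_preimage_emb
      (MeasurableEquiv.neg ℝ).measurableEmbedding (fun τ => g |τ|) (Set.Ioi 0)
    rw [← h1, ← this]
    simp
  rw [← lintegral_add_compl _ (measurableSet_Ioi (a := (0 : ℝ))), Set.compl_Ioi, h1, h2, two_mul]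

theorem lintegral_rpow_neg_near {γ ρ : ℝ} (hγ1 : γ < 1) (hρ : 0 < ρ) :
    ∫⁻ τ : ℝ, (if |τ| ≤ ρ then ENNReal.ofReal (|τ| ^ (-γ)) else 0) =
      ENNReal.ofReal (2 / (1 - γ) * ρ ^ (1 - γ)) := by
  rw [lintegral_comp_abs_eq (g := fun τ => if τ ≤ ρ then ENNReal.ofReal (τ ^ (-γ)) else 0)]
  have h0 : ∀ τ, (if τ ≤ ρ then ENNReal.ofReal (τ ^ (-γ)) else 0) =
      (Set.Iic ρ).indicator (fun τ => ENNReal.ofReal (τ ^ (-γ))) τ := fun τ => by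
    simp [Set.indicator]
  simp_rw [h0]
  rw [lintegral_indicator measurableSet_Iic, Measure.restrict_restrict measurableSet_Iic,
    Set.inter_comm, Set.Ioi_inter_Iic, ← ofReal_integral_eq_lintegral_ofReal,
    ← intervalIntegral.integral_of_le hρ.le, integral_rpow (Or.inl (by linarith)),
    Real.zero_rpow (by linarith)]
  · rw [← ENNReal.ofReal_ofNat, ← ENNReal.ofReal_mul (by norm_num)]
    congr 1
    rw [show -γ + 1 = 1 - γ by ring]; ring
  · exact (intervalIntegrable_iff_integrableOn_Ioc_of_le hρ.le).1
      (intervalIntegral.intervalIntegrable_rpow' (by linarith))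
  · filter_upwards [ae_restrict_mem measurableSet_Ioc] with τ hτ
    exact Real.rpow_nonneg hτ.1.le _

/-- The exponent `2/γ` is conjugate to `2/(2 - γ)` and reduces the tail of the kernel to that of
`|τ|⁻²`. -/
theorem lintegral_rpow_neg_far {γ ρ : ℝ} (hγ : 0 < γ) (hρ : 0 < ρ) :
    ∫⁻ τ : ℝ, (if |τ| ≤ ρ then 0 else ENNReal.ofReal (|τ| ^ (-γ))) ^ (2 / γ) =
      ENNReal.ofReal (2 / ρ) := by
  rw [lintegral_comp_abs_eq
    (g := fun τ => (if τ ≤ ρ then 0 else ENNReal.ofReal (τ ^ (-γ))) ^ (2 / γ))]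
  have h0 : ∫⁻ τ in Set.Ioi (0 : ℝ), (if τ ≤ ρ then 0 else ENNReal.ofReal (τ ^ (-γ))) ^ (2 / γ) =
      ∫⁻ τ in Set.Ioi (0 : ℝ), (Set.Ioi ρ).indicator (fun τ => ENNReal.ofReal (τ ^ (-2 : ℝ))) τ := by
    refine setLIntegral_congr_fun measurableSet_Ioi fun τ hτ => ?_
    have hτ0 : (0 : ℝ) < τ := hτ
    by_cases h : τ ≤ ρ
    · simp [h, show 0 < 2 / γ by positivity]
    · simp only [h, if_false, Set.indicator, Set.mem_Ioi, not_le.1 h, if_true]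
      rw [ENNReal.ofReal_rpow_of_nonneg (by positivity) (by positivity), ← Real.rpow_mul hτ0.le]
      congr 2
      field_simp
  rw [h0, lintegral_indicator measurableSet_Ioi, Measure.restrict_restrict measurableSet_Ioi,
    Set.Ioi_inter_Ioi, sup_of_le_left hρ.le, ← ofReal_integral_eq_lintegral_ofReal,
    integral_Ioi_rpow_of_lt (by norm_num) hρ]
  · rw [← ENNReal.ofReal_ofNat, ← ENNReal.ofReal_mul (by norm_num)]
    congr 1
    rw [show (-2 : ℝ) + 1 = -1 by norm_num, Real.rpow_neg_one]
    field_simp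
  · exact integrableOn_Ioi_rpow_of_lt (by norm_num) hρ
  · filter_upwards [ae_restrict_mem measurableSet_Ioi] with τ hτ
    exact Real.rpow_nonneg (hρ.trans hτ).le _

/-- Near the singularity the truncation `f ≤ c` and local integrability of the kernel are used; far
from it, Hölder. -/
theorem lintegral_truncated_mul_rpow_neg_le {γ : ℝ} (hγ : 0 < γ) (hγ1 : γ < 1) {f : ℝ → ℝ}
    (hf : Measurable f) (hf0 : ∀ t, 0 ≤ f t) {n : ℝ} (hn : 0 < n)
    (hfn : ∫⁻ t, ENNReal.ofReal (f t ^ (2 / (2 - γ))) ≤ ENNReal.ofReal n) {c : ℝ} (hc : 0 < c)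
    (t : ℝ) :
    ∫⁻ s, (if f s ≤ c then ENNReal.ofReal (f s) else 0) * ENNReal.ofReal (|t - s| ^ (-γ)) ≤
      ENNReal.ofReal ((2 / (1 - γ) + 2) * n ^ (1 - γ) * c ^ (γ / (2 - γ))) := by
  set p : ℝ := 2 / (2 - γ) with hp
  have h2γ : 0 < 2 - γ := by linarith
  have hp0 : 0 < p := by positivity
  -- The radius that balances the near part `c ρ^{1-γ}` and the far part `n^{1/p} ρ^{-γ/2}`.
  set ρ : ℝ := n * c ^ (-p) with hρ
  have hρ0 : 0 < ρ := by positivity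
  have hmk : Measurable fun s : ℝ => ENNReal.ofReal (|t - s| ^ (-γ)) := by fun_prop
  have hset : MeasurableSet {s : ℝ | |t - s| ≤ ρ} := measurableSet_le (by fun_prop) measurable_const
  have hsplit : ∀ s, (if f s ≤ c then ENNReal.ofReal (f s) else 0) *
      ENNReal.ofReal (|t - s| ^ (-γ)) ≤
      ENNReal.ofReal c * (if |t - s| ≤ ρ then ENNReal.ofReal (|t - s| ^ (-γ)) else 0) +
      ENNReal.ofReal (f s) * (if |t - s| ≤ ρ then 0 else ENNReal.ofReal (|t - s| ^ (-γ))) := by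
    intro s
    by_cases h1 : f s ≤ c
    · by_cases h2 : |t - s| ≤ ρ
      · simp only [h1, h2, if_true, mul_zero, add_zero]
        gcongr
      · simp [h1, h2]
    · simp [h1]
  have hnear : ∫⁻ s, (if |t - s| ≤ ρ then ENNReal.ofReal (|t - s| ^ (-γ)) else 0) =
      ENNReal.ofReal (2 / (1 - γ) * ρ ^ (1 - γ)) := by
    rw [← lintegral_rpow_neg_near hγ1 hρ0]
    exact lintegral_sub_left_eq_self
      (fun τ : ℝ => if |τ| ≤ ρ then ENNReal.ofReal (|τ| ^ (-γ)) else 0) t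
  have hfar : ∫⁻ s, (if |t - s| ≤ ρ then 0 else ENNReal.ofReal (|t - s| ^ (-γ))) ^ (2 / γ) =
      ENNReal.ofReal (2 / ρ) := by
    rw [← lintegral_rpow_neg_far hγ hρ0]
    exact lintegral_sub_left_eq_self
      (fun τ : ℝ => (if |τ| ≤ ρ then 0 else ENNReal.ofReal (|τ| ^ (-γ))) ^ (2 / γ)) t
  have hm1 : Measurable fun s : ℝ => if |t - s| ≤ ρ then ENNReal.ofReal (|t - s| ^ (-γ)) else 0 :=
    Measurable.ite hset hmk measurable_const
  have hm2 : Measurable fun s : ℝ => if |t - s| ≤ ρ then 0 else ENNReal.ofReal (|t - s| ^ (-γ)) :=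
    Measurable.ite hset measurable_const hmk
  have hconj : p.HolderConjugate (2 / γ) := by
    rw [Real.holderConjugate_iff]
    refine ⟨by rw [hp, lt_div_iff₀ h2γ]; linarith, ?_⟩
    rw [hp, inv_div, inv_div]; ring
  have hfar2 : ∫⁻ s, ENNReal.ofReal (f s) *
      (if |t - s| ≤ ρ then 0 else ENNReal.ofReal (|t - s| ^ (-γ))) ≤
      ENNReal.ofReal (n ^ (1 / p) * (2 / ρ) ^ (1 / (2 / γ))) := by
    refine (ENNReal.lintegral_mul_le_Lp_mul_Lq volume hconj hf.ennreal_ofReal.aemeasurable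
      hm2.aemeasurable).trans ?_
    rw [hfar, ENNReal.ofReal_mul (by positivity), ← ENNReal.ofReal_rpow_of_nonneg hn.le
      (by positivity), ← ENNReal.ofReal_rpow_of_nonneg (by positivity) (by positivity)]
    gcongr
    refine le_trans (le_of_eq ?_) hfn
    refine lintegral_congr fun s => ?_
    rw [ENNReal.ofReal_rpow_of_nonneg (hf0 s) hp0.le]
  refine (lintegral_mono hsplit).trans ?_
  rw [lintegral_add_left (hm1.const_mul _), lintegral_const_mul _ hm1, hnear,
    ← ENNReal.ofReal_mul hc.le]
  refine (add_le_add le_rfl hfar2).trans ?_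
  have h1γ : 0 < 1 - γ := by linarith
  rw [← ENNReal.ofReal_add (by positivity) (by positivity)]
  refine ENNReal.ofReal_le_ofReal ?_
  have e1 : c * (2 / (1 - γ) * ρ ^ (1 - γ)) = 2 / (1 - γ) * n ^ (1 - γ) * c ^ (γ / (2 - γ)) := by
    rw [hρ, Real.mul_rpow hn.le (by positivity), ← Real.rpow_mul hc.le]
    have : c ^ (γ / (2 - γ)) = c * c ^ (-p * (1 - γ)) := by
      nth_rewrite 2 [← Real.rpow_one c]
      rw [← Real.rpow_add hc]
      congr 1
      rw [hp]; field_simp; ring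
    rw [this]; ring
  have e2 : n ^ (1 / p) * (2 / ρ) ^ (1 / (2 / γ)) =
      2 ^ (γ / 2) * n ^ (1 - γ) * c ^ (γ / (2 - γ)) := by
    rw [one_div_div 2 γ, Real.div_rpow (by norm_num) hρ0.le, hρ, Real.mul_rpow hn.le (by positivity),
      ← Real.rpow_mul hc.le]
    have e3 : n ^ (1 / p) = n ^ (1 - γ) * n ^ (γ / 2) := by
      rw [← Real.rpow_add hn]; congr 1; rw [hp, one_div_div]; ring
    have e4 : c ^ (-p * (γ / 2)) = (c ^ (γ / (2 - γ)))⁻¹ := by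
      rw [← Real.rpow_neg hc.le]; congr 1; rw [hp]; field_simp
    rw [e3, e4]
    have := (Real.rpow_pos_of_pos hn (γ / 2)).ne'
    have := (Real.rpow_pos_of_pos hc (γ / (2 - γ))).ne'
    field_simp
  have e5 : (2 : ℝ) ^ (γ / 2) ≤ 2 := by
    calc (2 : ℝ) ^ (γ / 2) ≤ 2 ^ (1 : ℝ) :=
          Real.rpow_le_rpow_of_exponent_le (by norm_num) (by linarith)
      _ = 2 := by simp
  rw [e1, e2]
  have : (2 : ℝ) ^ (γ / 2) * n ^ (1 - γ) * c ^ (γ / (2 - γ)) ≤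
      2 * n ^ (1 - γ) * c ^ (γ / (2 - γ)) := by gcongr
  linarith

/-- The diagonal one-dimensional Hardy-Littlewood-Sobolev inequality. -/
theorem lintegral_lintegral_mul_rpow_neg_le {γ : ℝ} (hγ : 0 < γ) (hγ1 : γ < 1) {f : ℝ → ℝ}
    (hf : Measurable f) (hf0 : ∀ t, 0 ≤ f t) {n : ℝ} (hn : 0 < n)
    (hfn : ∫⁻ t, ENNReal.ofReal (f t ^ (2 / (2 - γ))) ≤ ENNReal.ofReal n) :
    ∫⁻ t, ∫⁻ s, ENNReal.ofReal (f t) * ENNReal.ofReal (f s) * ENNReal.ofReal (|t - s| ^ (-γ)) ≤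
      ENNReal.ofReal (2 * (2 / (1 - γ) + 2) * n ^ (2 - γ)) := by
  have h2γ : 0 < 2 - γ := by linarith
  have h1γ : 0 < 1 - γ := by linarith
  -- By symmetry it suffices to integrate over `f s ≤ f t`, where the truncated bound applies at
  -- height `c = f t`; then `f(t) · f(t)^{γ/(2-γ)} = f(t)^{2/(2-γ)}` is integrable by hypothesis.
  set G : ℝ → ℝ → ℝ≥0∞ := fun t s => ENNReal.ofReal (f t) *
    ((if f s ≤ f t then ENNReal.ofReal (f s) else 0) * ENNReal.ofReal (|t - s| ^ (-γ))) with hG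
  have hGm : Measurable (Function.uncurry G) := by
    refine Measurable.mul (by fun_prop) (Measurable.mul (Measurable.ite ?_ (by fun_prop)
      measurable_const) (by fun_prop))
    exact measurableSet_le (by fun_prop) (by fun_prop)
  have hsym : ∀ t s, ENNReal.ofReal (f t) * ENNReal.ofReal (f s) *
      ENNReal.ofReal (|t - s| ^ (-γ)) ≤ G t s + G s t := by
    intro t s
    rcases le_total (f s) (f t) with h | h
    · refine le_add_right (le_of_eq ?_)
      simp only [hG, h, if_true, mul_assoc]
    · refine le_add_left (le_of_eq ?_)
      simp only [hG, h, if_true, abs_sub_comm s t]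
      ring
  have hGle : ∫⁻ t, ∫⁻ s, G t s ≤ ENNReal.ofReal ((2 / (1 - γ) + 2) * n ^ (2 - γ)) := by
    have hpt : ∀ t, ∫⁻ s, G t s ≤ ENNReal.ofReal ((2 / (1 - γ) + 2) * n ^ (1 - γ)) *
        ENNReal.ofReal (f t ^ (2 / (2 - γ))) := by
      intro t
      rcases (hf0 t).eq_or_lt with h | h
      · simp [hG, ← h]
      · simp only [hG]
        rw [lintegral_const_mul' _ _ ENNReal.ofReal_ne_top]
        refine (mul_le_mul_right (lintegral_truncated_mul_rpow_neg_le hγ hγ1 hf hf0 hn hfn h t)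
          _).trans (le_of_eq ?_)
        rw [← ENNReal.ofReal_mul h.le, ← ENNReal.ofReal_mul (by positivity)]
        congr 1
        have : f t ^ (2 / (2 - γ)) = f t * f t ^ (γ / (2 - γ)) := by
          nth_rewrite 2 [← Real.rpow_one (f t)]
          rw [← Real.rpow_add h]
          congr 1
          field_simp; ring
        rw [this]; ring
    refine (lintegral_mono hpt).trans ?_
    rw [lintegral_const_mul' _ _ ENNReal.ofReal_ne_top]
    refine (mul_le_mul_right hfn _).trans (le_of_eq ?_)
    rw [← ENNReal.ofReal_mul (by positivity)]
    congr 1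
    rw [show 2 - γ = (1 - γ) + 1 by ring, Real.rpow_add hn, Real.rpow_one]; ring
  calc _ ≤ ∫⁻ t, ∫⁻ s, (G t s + G s t) := lintegral_mono fun t => lintegral_mono fun s => hsym t s
    _ = (∫⁻ t, ∫⁻ s, G t s) + ∫⁻ t, ∫⁻ s, G s t := by
      rw [← lintegral_add_left (f := fun t => ∫⁻ s, G t s) hGm.lintegral_prod_right']
      refine lintegral_congr fun t => ?_
      rw [lintegral_add_left]
      exact hGm.comp measurable_prodMk_left
    _ = (∫⁻ t, ∫⁻ s, G t s) + ∫⁻ t, ∫⁻ s, G t s := by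
      congr 1
      exact (lintegral_lintegral_swap hGm.aemeasurable).symm
    _ ≤ _ := by
      refine (add_le_add hGle hGle).trans (le_of_eq ?_)
      rw [← ENNReal.ofReal_add (by positivity) (by positivity)]
      congr 1; ring

/-! ### Interpolation by real methods -/

/-- Bounded measurable functions supported in a set of finite measure. -/
structure BddFinSupp {α : Type*} [MeasurableSpace α] (μ : Measure α) (F : α → ℂ) : Prop where
  meas : Measurable F
  bdd : ∃ M, ∀ x, ‖F x‖ ≤ M
  fin : μ (Function.support F) < ∞

section BddFinSupp

variable {α : Type*} [MeasurableSpace α] {μ : Measure α} {F : α → ℂ}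

theorem BddFinSupp.indicator (hF : BddFinSupp μ F) {S : Set α} (hS : MeasurableSet S) :
    BddFinSupp μ (S.indicator F) := by
  obtain ⟨M, hM⟩ := hF.bdd
  exact ⟨hF.meas.indicator hS, ⟨M, fun x => (norm_indicator_le_norm_self _ _).trans (hM x)⟩,
    (measure_mono (Set.support_indicator.trans_subset Set.inter_subset_right)).trans_lt hF.fin⟩

theorem BddFinSupp.memLp (hF : BddFinSupp μ F) (p : ℝ≥0∞) : MemLp F p μ := by
  obtain ⟨M, hM⟩ := hF.bdd
  have hs : MeasurableSet (Function.support F) := measurableSet_support hF.meas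
  have h1 : MemLp ((Function.support F).indicator fun _ => (M : ℂ)) p μ :=
    memLp_indicator_const p hs _ (Or.inr hF.fin.ne)
  refine h1.of_le hF.meas.aestronglyMeasurable (.of_forall fun x => ?_)
  by_cases hx : x ∈ Function.support F
  · rw [Set.indicator_of_mem hx, Complex.norm_real]
    exact (hM x).trans (le_abs_self M)
  · rw [Function.notMem_support.1 hx]; simp

theorem BddFinSupp.integrable (hF : BddFinSupp μ F) : Integrable F μ :=
  memLp_one_iff_integrable.1 (hF.memLp 1)

theorem ofReal_norm_sub_le_of_add {T : (α → ℂ) → α → ℂ} {F : α → ℂ} (hF : BddFinSupp μ F)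
    (hadd : ∀ F G, BddFinSupp μ F → BddFinSupp μ G → ∀ x, T (F + G) x = T F x + T G x)
    {S : Set α} (hS : MeasurableSet S) (x : α) :
    ‖T F x‖ ≤ ‖T (S.indicator F) x‖ + ‖T (Sᶜ.indicator F) x‖ := by
  nth_rewrite 1 [← Set.indicator_self_add_compl S F]
  rw [hadd _ _ (hF.indicator hS) (hF.indicator hS.compl)]
  exact norm_add_le _ _

/-- Interpolation between an `L¹ → L^∞` bound and an `L²` bound. -/
theorem lintegral_rpow_norm_le_of_interpolation [SFinite μ] {T : (α → ℂ) → α → ℂ} {a b : ℝ}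
    (ha : 0 < a) (hb : 0 ≤ b)
    (hadd : ∀ F G, BddFinSupp μ F → BddFinSupp μ G → ∀ x, T (F + G) x = T F x + T G x)
    (hmeas : ∀ F, BddFinSupp μ F → AEMeasurable (T F) μ)
    (h1 : ∀ F, BddFinSupp μ F → ∀ x,
      ENNReal.ofReal ‖T F x‖ ≤ ENNReal.ofReal a * ∫⁻ y, ENNReal.ofReal ‖F y‖ ∂μ)
    (h2 : ∀ F, BddFinSupp μ F → ∫⁻ x, ENNReal.ofReal (‖T F x‖ ^ 2) ∂μ ≤
      ENNReal.ofReal b * ∫⁻ y, ENNReal.ofReal (‖F y‖ ^ 2) ∂μ)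
    {q : ℝ} (hq : 2 < q) (hF : BddFinSupp μ F) {n : ℝ} (hn : 0 < n)
    (hFn : ∫⁻ y, ENNReal.ofReal (‖F y‖ ^ (q / (q - 1))) ∂μ ≤ ENNReal.ofReal n) :
    ∫⁻ x, ENNReal.ofReal (‖T F x‖ ^ q) ∂μ ≤
      ENNReal.ofReal (4 * q / (q - 2) * b * (2 * a) ^ (q - 2) * n ^ (q - 1)) := by
  have hq1 : 0 < q - 1 := by linarith
  have hq2 : 0 < q - 2 := by linarith
  have hq0 : 0 < q := by linarith
  have hnF : Measurable fun x => ‖F x‖ := hF.meas.norm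
  -- At level `t`, `F` is cut where `t |F|^{1/(q-1)} = 2an`. The `L¹ → L^∞` bound makes the image of
  -- the large part at most `t/2` everywhere, so only the image of the small part can exceed `t/2`,
  -- and Chebyshev with the `L²` bound measures that set.
  have hkey : ∀ t : ℝ, 0 < t → μ {x | t < ‖T F x‖} ≤ ENNReal.ofReal (4 * b / t ^ 2) *
      ∫⁻ y, (if t * ‖F y‖ ^ (1 / (q - 1)) ≤ 2 * a * n then ENNReal.ofReal (‖F y‖ ^ 2) else 0) ∂μ := by
    intro t ht
    set S : Set α := {y | t * ‖F y‖ ^ (1 / (q - 1)) ≤ 2 * a * n} with hSdef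
    have hS : MeasurableSet S := measurableSet_le (by fun_prop) measurable_const
    have hbig : ∀ x, ‖T (Sᶜ.indicator F) x‖ ≤ t / 2 := by
      intro x
      have hle : ∫⁻ y, ENNReal.ofReal ‖Sᶜ.indicator F y‖ ∂μ ≤ ENNReal.ofReal (t / (2 * a)) := by
        calc _ ≤ ∫⁻ y, ENNReal.ofReal (t / (2 * a * n)) *
              ENNReal.ofReal (‖F y‖ ^ (q / (q - 1))) ∂μ := by
              refine lintegral_mono fun y => ?_
              rw [← ENNReal.ofReal_mul (by positivity)]
              refine ENNReal.ofReal_le_ofReal ?_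
              by_cases hy : y ∈ S
              · rw [Set.indicator_of_notMem (by simpa using hy)]; simp; positivity
              · rw [Set.indicator_of_mem (by simpa using hy)]
                have hy' : 2 * a * n < t * ‖F y‖ ^ (1 / (q - 1)) := not_le.1 hy
                have hF0 : 0 < ‖F y‖ := by
                  rcases (norm_nonneg (F y)).eq_or_lt with h | h
                  · rw [← h, Real.zero_rpow (by positivity), mul_zero] at hy'
                    exact absurd hy' (not_lt.2 (by positivity))
                  · exact h
                have he : ‖F y‖ ^ (q / (q - 1)) = ‖F y‖ * ‖F y‖ ^ (1 / (q - 1)) := by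
                  nth_rewrite 2 [← Real.rpow_one ‖F y‖]
                  rw [← Real.rpow_add hF0]
                  congr 1
                  field_simp; ring
                rw [he, div_mul_eq_mul_div, le_div_iff₀ (by positivity)]
                nlinarith
          _ ≤ ENNReal.ofReal (t / (2 * a * n)) * ENNReal.ofReal n := by
              rw [lintegral_const_mul' _ _ ENNReal.ofReal_ne_top]
              gcongr
          _ = _ := by
              rw [← ENNReal.ofReal_mul (by positivity)]
              congr 1
              field_simp
      have := (h1 _ (hF.indicator hS.compl) x).trans (mul_le_mul_right hle _)
      rw [← ENNReal.ofReal_mul ha.le, ENNReal.ofReal_le_ofReal_iff (by positivity)] at this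
      refine this.trans (le_of_eq ?_)
      field_simp
    have hsub : {x | t < ‖T F x‖} ⊆ {x | ENNReal.ofReal (t ^ 2 / 4) ≤
        ENNReal.ofReal (‖T (S.indicator F) x‖ ^ 2)} := by
      intro x hx
      have hx' : t < ‖T F x‖ := hx
      have h3 := ofReal_norm_sub_le_of_add hF hadd hS x
      have h4 := hbig x
      refine ENNReal.ofReal_le_ofReal ?_
      nlinarith [norm_nonneg (T (S.indicator F) x)]
    refine (measure_mono hsub).trans ?_
    have hm : AEMeasurable (fun x => ENNReal.ofReal (‖T (S.indicator F) x‖ ^ 2)) μ :=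
      ((hmeas _ (hF.indicator hS)).norm.pow_const 2).ennreal_ofReal
    have hS2 : ∫⁻ y, ENNReal.ofReal (‖S.indicator F y‖ ^ 2) ∂μ =
        ∫⁻ y, (if t * ‖F y‖ ^ (1 / (q - 1)) ≤ 2 * a * n then ENNReal.ofReal (‖F y‖ ^ 2)
          else 0) ∂μ := by
      refine lintegral_congr fun y => ?_
      by_cases hy : y ∈ S
      · rw [Set.indicator_of_mem hy]; exact (if_pos hy).symm
      · rw [Set.indicator_of_notMem hy]; rw [norm_zero, zero_pow two_ne_zero, ENNReal.ofReal_zero]; exact (if_neg hy).symm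
    refine (meas_ge_le_lintegral_div hm (by positivity) ENNReal.ofReal_ne_top).trans ?_
    rw [ENNReal.div_eq_inv_mul, ← ENNReal.ofReal_inv_of_pos (by positivity), ← hS2]
    refine (mul_le_mul_right (h2 _ (hF.indicator hS)) _).trans (le_of_eq ?_)
    rw [← mul_assoc, ← ENNReal.ofReal_mul (by positivity)]
    congr 2
    field_simp
  rw [lintegral_rpow_eq_lintegral_meas_lt_mul μ (.of_forall fun x => norm_nonneg _)
    (hmeas F hF).norm (by linarith)]
  have hstep : ∫⁻ t in Set.Ioi (0 : ℝ), μ {x | t < ‖T F x‖} * ENNReal.ofReal (t ^ (q - 1)) ≤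
      ∫⁻ t in Set.Ioi (0 : ℝ), ∫⁻ y, (if t * ‖F y‖ ^ (1 / (q - 1)) ≤ 2 * a * n then
        ENNReal.ofReal (4 * b * t ^ (q - 3)) * ENNReal.ofReal (‖F y‖ ^ 2) else 0) ∂μ := by
    refine setLIntegral_mono' measurableSet_Ioi fun t ht => ?_
    have ht' : (0 : ℝ) < t := ht
    refine (mul_le_mul_left (hkey t ht') _).trans (le_of_eq ?_)
    rw [mul_right_comm, ← ENNReal.ofReal_mul (by positivity),
      ← lintegral_const_mul' _ _ ENNReal.ofReal_ne_top]
    refine lintegral_congr fun y => ?_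
    rw [mul_ite, mul_zero]
    congr 3
    rw [show q - 1 = (q - 3) + 2 by ring, Real.rpow_add ht', Real.rpow_ofNat]
    field_simp
  -- After Tonelli, the levels met by a given `y` end at `2an / |F y|^{1/(q-1)}`; the integral of
  -- `t^{q-3}` converges at `0` because `q > 2`.
  have hinner : ∀ y, ∫⁻ t in Set.Ioi (0 : ℝ), (if t * ‖F y‖ ^ (1 / (q - 1)) ≤ 2 * a * n then
        ENNReal.ofReal (4 * b * t ^ (q - 3)) * ENNReal.ofReal (‖F y‖ ^ 2) else 0) =
      ENNReal.ofReal (4 * b / (q - 2) * (2 * a * n) ^ (q - 2)) *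
        ENNReal.ofReal (‖F y‖ ^ (q / (q - 1))) := by
    intro y
    rcases (norm_nonneg (F y)).eq_or_lt with h | h
    · rw [← h, Real.zero_rpow (div_pos hq0 hq1).ne']; simp
    set c : ℝ := ‖F y‖ ^ (1 / (q - 1)) with hc
    have hc0 : 0 < c := by positivity
    set L : ℝ := 2 * a * n / c with hL
    have hL0 : 0 < L := by positivity
    have e1 : ∫⁻ t in Set.Ioi (0 : ℝ), (if t * c ≤ 2 * a * n then
        ENNReal.ofReal (4 * b * t ^ (q - 3)) * ENNReal.ofReal (‖F y‖ ^ 2) else 0) =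
        ∫⁻ t in Set.Ioc 0 L, ENNReal.ofReal (4 * b * t ^ (q - 3)) *
          ENNReal.ofReal (‖F y‖ ^ 2) := by
      rw [← Set.Ioi_inter_Iic, Set.inter_comm, ← Measure.restrict_restrict measurableSet_Iic,
        ← lintegral_indicator measurableSet_Iic]
      refine lintegral_congr fun t => ?_
      simp only [Set.indicator, Set.mem_Iic, hL, le_div_iff₀ hc0]
    rw [e1, lintegral_mul_const' _ _ ENNReal.ofReal_ne_top, ← ofReal_integral_eq_lintegral_ofReal,
      integral_const_mul, ← intervalIntegral.integral_of_le hL0.le,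
      integral_rpow (Or.inl (by linarith)), Real.zero_rpow (by linarith), sub_zero,
      show q - 3 + 1 = q - 2 by ring, ← ENNReal.ofReal_mul (by positivity), ← ENNReal.ofReal_mul (by positivity)]
    · congr 1
      have e2 : ‖F y‖ ^ 2 = ‖F y‖ ^ (q / (q - 1)) * c ^ (q - 2) := by
        rw [hc, ← Real.rpow_mul h.le, ← Real.rpow_add h, ← Real.rpow_ofNat]
        congr 1
        field_simp; ring
      rw [e2, hL, Real.div_rpow (by positivity) hc0.le]
      have := (Real.rpow_pos_of_pos hc0 (q - 2)).ne'
      field_simp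
    · refine Integrable.const_mul ?_ _
      exact (intervalIntegrable_iff_integrableOn_Ioc_of_le hL0.le).1
        (intervalIntegral.intervalIntegrable_rpow' (by linarith))
    · filter_upwards [ae_restrict_mem measurableSet_Ioc] with τ hτ
      have := Real.rpow_nonneg hτ.1.le (q - 3)
      simp only [Pi.zero_apply]
      positivity
  have hmm : Measurable (Function.uncurry fun (t : ℝ) y =>
      if t * ‖F y‖ ^ (1 / (q - 1)) ≤ 2 * a * n then
        ENNReal.ofReal (4 * b * t ^ (q - 3)) * ENNReal.ofReal (‖F y‖ ^ 2) else 0) := by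
    refine Measurable.ite (measurableSet_le ?_ measurable_const) ?_ measurable_const
    · exact measurable_fst.mul ((hnF.comp measurable_snd).pow_const _)
    · exact ((measurable_fst.pow_const _).const_mul _).ennreal_ofReal.mul
        ((hnF.comp measurable_snd).pow_const 2).ennreal_ofReal
  refine (mul_le_mul_right hstep _).trans ?_
  rw [lintegral_lintegral_swap hmm.aemeasurable]
  simp_rw [hinner]
  rw [lintegral_const_mul' _ _ ENNReal.ofReal_ne_top]
  refine (mul_le_mul_right (mul_le_mul_right hFn _) _).trans (le_of_eq ?_)
  rw [← ENNReal.ofReal_mul (by positivity), ← ENNReal.ofReal_mul (by positivity)]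
  congr 1
  rw [show q - 1 = (q - 2) + 1 by ring, Real.rpow_add hn, Real.rpow_one,
    Real.mul_rpow (by positivity) hn.le]
  field_simp

end BddFinSupp

/-! ### Fourier integrals and multipliers on `L¹ ∩ L²` -/

section Fourier

theorem integral_fourierInv_mul_eq {f g : R3 → ℂ} (hf : Integrable f) (hg : Integrable g) :
    ∫ x, (𝓕⁻ f) x * g x = ∫ x, f x * (𝓕⁻ g) x := by
  have h := VectorFourier.integral_fourierIntegral_smul_eq_flip (L := -innerₗ R3)
    (μ := volume) (ν := volume) Real.continuous_fourierChar continuous_inner.neg hf hg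
  have hL : (-innerₗ R3).flip = -innerₗ R3 := by
    ext x y; simp [real_inner_comm]
  rw [hL] at h
  exact h

theorem norm_fourierInv_le {f : R3 → ℂ} (x : R3) : ‖(𝓕⁻ f) x‖ ≤ ∫ y, ‖f y‖ :=
  VectorFourier.norm_fourierIntegral_le_integral_norm _ _ _ _ _

theorem norm_fourier_le {f : R3 → ℂ} (x : R3) : ‖(𝓕 f) x‖ ≤ ∫ y, ‖f y‖ :=
  VectorFourier.norm_fourierIntegral_le_integral_norm _ _ _ _ _

theorem continuous_fourierInv {f : R3 → ℂ} (hf : Integrable f) : Continuous (𝓕⁻ f : R3 → ℂ) :=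
  VectorFourier.fourierIntegral_continuous (L := -innerₗ R3) Real.continuous_fourierChar
    continuous_inner.neg hf

theorem continuous_fourier {f : R3 → ℂ} (hf : Integrable f) : Continuous (𝓕 f : R3 → ℂ) :=
  VectorFourier.fourierIntegral_continuous (L := innerₗ R3) Real.continuous_fourierChar
    continuous_inner hf

theorem fourier_add_of_integrable {f g : R3 → ℂ} (hf : Integrable f) (hg : Integrable g) :
    (𝓕 (f + g) : R3 → ℂ) = 𝓕 f + 𝓕 g :=
  VectorFourier.fourierIntegral_add (L := innerₗ R3) Real.continuous_fourierChar
    continuous_inner hf hg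

theorem fourierInv_add_of_integrable {f g : R3 → ℂ} (hf : Integrable f) (hg : Integrable g) :
    (𝓕⁻ (f + g) : R3 → ℂ) = 𝓕⁻ f + 𝓕⁻ g :=
  VectorFourier.fourierIntegral_add (L := -innerₗ R3) Real.continuous_fourierChar
    continuous_inner.neg hf hg

theorem fourierInv_conj (f : R3 → ℂ) (x : R3) :
    (𝓕⁻ (fun y => starRingEnd ℂ (f y))) x = starRingEnd ℂ ((𝓕 f) x) := by
  rw [Real.fourierInv_eq', Real.fourier_eq', ← integral_conj]
  refine integral_congr_ae (.of_forall fun y => ?_)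
  simp only [smul_eq_mul, map_mul, ← Complex.exp_conj, Complex.conj_ofReal, Complex.conj_I]
  congr 2
  push_cast; ring

/-- On `L¹ ∩ L²` the `L²` inverse Fourier transform is given by the Fourier integral. -/
theorem fourierInv_toLp_ae_eq {m : R3 → ℂ} (h1 : Integrable m) (h2 : MemLp m 2) :
    ((𝓕⁻ (h2.toLp m) : Lp ℂ 2 (volume : Measure R3)) : R3 → ℂ) =ᵐ[volume] (𝓕⁻ m : R3 → ℂ) := by
  set h : Lp ℂ 2 (volume : Measure R3) := 𝓕⁻ (h2.toLp m) with hh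
  refine ae_eq_of_integral_contDiff_smul_eq ((Lp.memLp h).locallyIntegrable (by norm_num))
    (continuous_fourierInv h1).locallyIntegrable ?_
  intro g hg hgc
  have hg₁ : HasCompactSupport (Complex.ofRealCLM ∘ g) := hgc.comp_left rfl
  have hg₂ : ContDiff ℝ (⊤ : ℕ∞) (Complex.ofRealCLM ∘ g) := by fun_prop
  set φ : 𝓢(R3, ℂ) := hg₁.toSchwartzMap hg₂ with hφ
  have hφg : ∀ x, φ x = (g x : ℂ) := fun x => rfl
  have e1 : ∫ x, g x • h x = ∫ x, φ x • h x := by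
    refine integral_congr_ae (.of_forall fun x => ?_)
    simp [hφg]
  have e2 : ∫ x, g x • (𝓕⁻ m) x = ∫ x, φ x * (𝓕⁻ m) x := by
    refine integral_congr_ae (.of_forall fun x => ?_)
    simp [hφg]
  rw [e1, e2, ← integral_fourierInv_mul_eq φ.integrable h1,
    ← Lp.toTemperedDistribution_apply, hh, ← Lp.fourierInv_toTemperedDistribution_eq,
    TemperedDistribution.fourierInv_apply, Lp.toTemperedDistribution_apply]
  refine integral_congr_ae ?_
  filter_upwards [h2.coeFn_toLp] with x hx
  rw [hx, smul_eq_mul, SchwartzMap.fourierInv_coe]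

theorem eLpNorm_fourierInv_eq {m : R3 → ℂ} (h1 : Integrable m) (h2 : MemLp m 2) :
    eLpNorm (𝓕⁻ m : R3 → ℂ) 2 volume = eLpNorm m 2 volume := by
  rw [← eLpNorm_congr_ae (fourierInv_toLp_ae_eq h1 h2)]
  have h : ‖(𝓕⁻ (h2.toLp m) : Lp ℂ 2 (volume : Measure R3))‖ = ‖h2.toLp m‖ := by
    rw [← Lp.norm_fourier_eq, fourier_fourierInv_eq]
  rw [Lp.norm_def, Lp.norm_def, ENNReal.toReal_eq_toReal_iff' (Lp.eLpNorm_ne_top _)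
    (Lp.eLpNorm_ne_top _)] at h
  rw [h, eLpNorm_congr_ae h2.coeFn_toLp]

theorem lintegral_ofReal_norm_sq_eq (f : R3 → ℂ) :
    ∫⁻ x, ENNReal.ofReal (‖f x‖ ^ 2) = eLpNorm f 2 volume ^ 2 := by
  have h := eLpNorm_nnreal_pow_eq_lintegral (f := f) (μ := volume) (p := 2) two_ne_zero
  simp only [NNReal.coe_ofNat, ENNReal.coe_ofNat, ENNReal.rpow_ofNat] at h
  rw [h]
  refine lintegral_congr fun x => ?_
  rw [ENNReal.ofReal_pow (norm_nonneg _), ofReal_norm]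

theorem lintegral_fourierInv_sq_eq {m : R3 → ℂ} (h1 : Integrable m) (h2 : MemLp m 2) :
    ∫⁻ x, ENNReal.ofReal (‖(𝓕⁻ m) x‖ ^ 2) = ∫⁻ x, ENNReal.ofReal (‖m x‖ ^ 2) := by
  rw [lintegral_ofReal_norm_sq_eq, lintegral_ofReal_norm_sq_eq, eLpNorm_fourierInv_eq h1 h2]

theorem lintegral_fourier_sq_eq {m : R3 → ℂ} (h1 : Integrable m) (h2 : MemLp m 2) :
    ∫⁻ x, ENNReal.ofReal (‖(𝓕 m) x‖ ^ 2) = ∫⁻ x, ENNReal.ofReal (‖m x‖ ^ 2) := by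
  rw [← lintegral_fourierInv_sq_eq h1 h2, ← lintegral_neg_eq_self]
  simp_rw [Real.fourierInv_eq_fourier_neg]

end Fourier

/-- The Fourier multiplier with symbol `w`, given by Fourier integrals. -/
def multiplier (w : R3 → ℂ) (F : R3 → ℂ) : R3 → ℂ := 𝓕⁻ fun ξ => w ξ * (𝓕 F) ξ

section Multiplier

variable {w : R3 → ℂ} {F G : R3 → ℂ}

theorem integrable_mul_fourier (hw : Integrable w) (hF : Integrable F) :
    Integrable fun ξ => w ξ * (𝓕 F) ξ :=
  hw.mul_bdd (continuous_fourier hF).aestronglyMeasurable (.of_forall fun ξ => norm_fourier_le ξ)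

theorem multiplier_add (hw : Integrable w) (hF : Integrable F) (hG : Integrable G) (x : R3) :
    multiplier w (F + G) x = multiplier w F x + multiplier w G x := by
  unfold multiplier
  rw [fourier_add_of_integrable hF hG, ← Pi.add_apply (𝓕⁻ _ : R3 → ℂ),
    ← fourierInv_add_of_integrable (integrable_mul_fourier hw hF) (integrable_mul_fourier hw hG)]
  refine congrFun (congrArg _ (funext fun ξ => ?_)) x
  simp [mul_add]

theorem multiplier_eq_integral (hw : Integrable w) (hF : Integrable F) (x : R3) :
    multiplier w F x = ∫ y, F y * (𝓕⁻ w) (x - y) := by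
  have h := integral_fourierInv_mul_eq (f := fun ξ => w ξ * (Real.fourierChar (inner ℝ ξ x) : ℂ)) (g := fun y => F (-y))
    (by
      refine hw.mul_bdd (c := 1) ?_ (.of_forall fun ξ => (Circle.norm_coe _).le)
      exact (Continuous.aestronglyMeasurable (by fun_prop)))
    hF.comp_neg
  have e1 : multiplier w F x = ∫ ξ, w ξ * (Real.fourierChar (inner ℝ ξ x) : ℂ) * (𝓕⁻ fun y => F (-y)) ξ := by
    rw [multiplier, Real.fourierInv_eq]
    refine integral_congr_ae (.of_forall fun ξ => ?_)
    simp only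
    rw [Real.fourierInv_eq_fourier_comp_neg]
    simp only [neg_neg, Circle.smul_def, smul_eq_mul]
    ring
  rw [e1, ← h, ← integral_neg_eq_self]
  refine integral_congr_ae (.of_forall fun y => ?_)
  simp only [neg_neg]
  rw [mul_comm]
  congr 1
  rw [Real.fourierInv_eq, Real.fourierInv_eq]
  refine integral_congr_ae (.of_forall fun ξ => ?_)
  simp only [Circle.smul_def, smul_eq_mul]
  rw [sub_eq_add_neg, inner_add_right, AddChar.map_add_eq_mul, Circle.coe_mul]
  ring

/-- The kernel bound is needed only almost everywhere, since it enters under a convolution integral;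
the conclusion still holds at every point. -/
theorem ofReal_norm_multiplier_le (hw : Integrable w) (hF : Integrable F) {a : ℝ}
    (hK : ∀ᵐ x, ‖(𝓕⁻ w) x‖ ≤ a) (x : R3) :
    ENNReal.ofReal ‖multiplier w F x‖ ≤ ENNReal.ofReal a * ∫⁻ y, ENNReal.ofReal ‖F y‖ := by
  rw [multiplier_eq_integral hw hF, ofReal_norm]
  refine (enorm_integral_le_lintegral_enorm _).trans ?_
  rw [← lintegral_const_mul' _ _ ENNReal.ofReal_ne_top]
  have hK' : ∀ᵐ y, ‖(𝓕⁻ w) (x - y)‖ ≤ a :=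
    (quasiMeasurePreserving_sub_left_of_right_invariant volume x).ae hK
  refine lintegral_mono_ae ?_
  filter_upwards [hK'] with y hy
  rw [enorm_mul, ofReal_norm, mul_comm, ← ofReal_norm (((𝓕⁻ w : R3 → ℂ)) (x - y))]
  gcongr

theorem memLp_two_mul_fourier (hw : Integrable w) {c : ℝ} (hwc : ∀ ξ, ‖w ξ‖ ≤ c)
    (hF : Integrable F) (hF2 : MemLp F 2) :
    MemLp (fun ξ => w ξ * (𝓕 F) ξ) 2 := by
  have h1 : MemLp (𝓕 F : R3 → ℂ) 2 := by
    refine ⟨(continuous_fourier hF).aestronglyMeasurable, ?_⟩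
    have h3 := lintegral_fourier_sq_eq hF hF2
    rw [lintegral_ofReal_norm_sq_eq, lintegral_ofReal_norm_sq_eq] at h3
    have h4 : eLpNorm (𝓕 F : R3 → ℂ) 2 volume ^ 2 < ∞ := by
      rw [h3]; exact ENNReal.pow_lt_top hF2.2
    exact (ENNReal.pow_lt_top_iff.1 h4).resolve_right two_ne_zero
  refine (h1.const_mul (c : ℂ)).of_le (hw.1.mul h1.1) (.of_forall fun ξ => ?_)
  rw [norm_mul, norm_mul, Complex.norm_real]
  gcongr
  exact (hwc ξ).trans (le_abs_self c)

theorem lintegral_multiplier_sq_le (hw : Integrable w) {c : ℝ} (hwc : ∀ ξ, ‖w ξ‖ ≤ c)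
    (hF : Integrable F) (hF2 : MemLp F 2) :
    ∫⁻ x, ENNReal.ofReal (‖multiplier w F x‖ ^ 2) ≤
      ENNReal.ofReal (c ^ 2) * ∫⁻ y, ENNReal.ofReal (‖F y‖ ^ 2) := by
  unfold multiplier
  rw [lintegral_fourierInv_sq_eq (integrable_mul_fourier hw hF)
    (memLp_two_mul_fourier hw hwc hF hF2), ← lintegral_fourier_sq_eq hF hF2,
    ← lintegral_const_mul' _ _ ENNReal.ofReal_ne_top]
  refine lintegral_mono fun ξ => ?_
  rw [← ENNReal.ofReal_mul (by positivity)]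
  refine ENNReal.ofReal_le_ofReal ?_
  rw [norm_mul, mul_pow]
  gcongr
  exact hwc ξ

theorem integral_mul_fourier_mul_conj (hw : Integrable w) (hF : Integrable F)
    (hG : Integrable G) :
    ∫ ξ, w ξ * (𝓕 F) ξ * starRingEnd ℂ ((𝓕 G) ξ) =
      ∫ x, multiplier w F x * starRingEnd ℂ (G x) := by
  have hG' : Integrable fun x => starRingEnd ℂ (G x) :=
    Complex.conjCLE.toContinuousLinearMap.integrable_comp hG
  rw [multiplier, integral_fourierInv_mul_eq (integrable_mul_fourier hw hF) hG']
  simp_rw [fourierInv_conj]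

/-- The `L^{q'}` bound of the bilinear form of a multiplier whose kernel is bounded by `a`. -/
theorem norm_integral_mul_fourier_mul_conj_le (hw : Integrable w) (hw2 : ∀ ξ, ‖w ξ‖ ≤ 2) {a : ℝ}
    (ha : 0 < a) (hK : ∀ᵐ x, ‖(𝓕⁻ w) x‖ ≤ a) {q : ℝ} (hq : 2 < q)
    (hF : BddFinSupp volume F) (hG : BddFinSupp volume G) {b c : ℝ} (hb : 0 < b) (hc : 0 < c)
    (hFb : ∫⁻ x, ENNReal.ofReal (‖F x‖ ^ (q / (q - 1))) ≤ ENNReal.ofReal (b ^ (q / (q - 1))))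
    (hGc : ∫⁻ x, ENNReal.ofReal (‖G x‖ ^ (q / (q - 1))) ≤ ENNReal.ofReal (c ^ (q / (q - 1)))) :
    ‖∫ ξ, w ξ * (𝓕 F) ξ * starRingEnd ℂ ((𝓕 G) ξ)‖ ≤
      (16 * q / (q - 2) * (2 * a) ^ (q - 2)) ^ (1 / q) * b * c := by
  have hq0 : 0 < q := by linarith
  have hq1 : 0 < q - 1 := by linarith
  have hq2 : 0 < q - 2 := by linarith
  -- The `L²` constant is `2²`, from the bound `2` on the symbol; with the `4` of the interpolation
  -- lemma it makes the `16`.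
  have hT := lintegral_rpow_norm_le_of_interpolation (μ := volume) (T := multiplier w) ha
    (by norm_num : (0 : ℝ) ≤ 2 ^ 2)
    (fun F G hF hG x => multiplier_add hw hF.integrable hG.integrable x)
    (fun F hF => (continuous_fourierInv
      (integrable_mul_fourier hw hF.integrable)).aemeasurable)
    (fun F hF x => ofReal_norm_multiplier_le hw hF.integrable hK x)
    (fun F hF => lintegral_multiplier_sq_le hw hw2 hF.integrable (hF.memLp 2)) hq hF
    (by positivity : 0 < b ^ (q / (q - 1))) hFb
  have hconj : q.HolderConjugate (q / (q - 1)) := Real.HolderConjugate.conjExponent (by linarith)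
  have hTm : Continuous (multiplier w F) :=
    continuous_fourierInv (integrable_mul_fourier hw hF.integrable)
  rw [integral_mul_fourier_mul_conj hw hF.integrable hG.integrable,
    ← ENNReal.ofReal_le_ofReal_iff (by positivity)]
  rw [ofReal_norm]
  refine (enorm_integral_le_lintegral_enorm _).trans ?_
  have e1 : ∀ x, ‖multiplier w F x * starRingEnd ℂ (G x)‖ₑ =
      ENNReal.ofReal ‖multiplier w F x‖ * ENNReal.ofReal ‖G x‖ := fun x => by
    rw [enorm_mul, ofReal_norm, ofReal_norm]
    congr 1
    rw [← ofReal_norm, RCLike.norm_conj, ofReal_norm]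
  simp_rw [e1]
  refine (ENNReal.lintegral_mul_le_Lp_mul_Lq volume hconj hTm.norm.measurable.ennreal_ofReal.aemeasurable
    hG.meas.norm.ennreal_ofReal.aemeasurable).trans ?_
  simp_rw [ENNReal.ofReal_rpow_of_nonneg (norm_nonneg _) hq0.le,
    ENNReal.ofReal_rpow_of_nonneg (norm_nonneg _) (by positivity : 0 ≤ q / (q - 1))]
  calc _ ≤ ENNReal.ofReal (4 * q / (q - 2) * 2 ^ 2 * (2 * a) ^ (q - 2) *
        (b ^ (q / (q - 1))) ^ (q - 1)) ^ (1 / q) *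
        ENNReal.ofReal (c ^ (q / (q - 1))) ^ (1 / (q / (q - 1))) := by gcongr
    _ = _ := by
      rw [ENNReal.ofReal_rpow_of_nonneg (by positivity) (by positivity),
        ENNReal.ofReal_rpow_of_nonneg (by positivity) (by positivity),
        ← ENNReal.ofReal_mul (by positivity), ← Real.rpow_mul hb.le, ← Real.rpow_mul hc.le,
        mul_one_div_cancel (by positivity), Real.rpow_one, div_mul_cancel₀ _ hq1.ne',
        Real.mul_rpow (by positivity) (by positivity), ← Real.rpow_mul hb.le,
        mul_one_div_cancel hq0.ne', Real.rpow_one]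
      congr 4
      ring

end Multiplier

/-! ### The TT* argument -/

section Duality

theorem integrable_indicator_Icc (n c : ℝ) :
    Integrable ((Set.Icc (-n) n).indicator fun _ : ℝ => c) :=
  (integrable_indicator_iff measurableSet_Icc).2 (integrableOn_const (by simp))

/-- The square is a double time integral of `g t · conj (g s)`. The time cut-off makes everything
absolutely integrable, so the frequency integral can be taken inside. -/
theorem ofReal_integral_mul_norm_sq_le {w : R3 → ℝ} (hw : Integrable w)
    (hw0 : ∀ ξ, 0 ≤ w ξ) {g : ℝ → R3 → ℂ} (hg : Measurable (Function.uncurry g)) {M n : ℝ}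
    (hgM : ∀ t ξ, ‖g t ξ‖ ≤ (Set.Icc (-n) n).indicator (fun _ => M) t) :
    ∫⁻ ξ, ENNReal.ofReal (w ξ * ‖∫ t, g t ξ‖ ^ 2) ≤
      ∫⁻ t, ∫⁻ s, ‖∫ ξ, (w ξ : ℂ) * g t ξ * starRingEnd ℂ (g s ξ)‖ₑ := by
  set I : ℝ → ℝ := (Set.Icc (-n) n).indicator fun _ => M with hI
  have hIint : Integrable I := integrable_indicator_Icc n M
  have hI0 : ∀ t, 0 ≤ I t := fun t => (norm_nonneg _).trans (hgM t 0)
  set H : R3 → ℝ × ℝ → ℂ := fun ξ z => (w ξ : ℂ) * g z.1 ξ * starRingEnd ℂ (g z.2 ξ) with hH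
  have hHm : AEStronglyMeasurable (Function.uncurry H)
      ((volume : Measure R3).prod (volume : Measure (ℝ × ℝ))) := by
    refine AEStronglyMeasurable.mul (AEStronglyMeasurable.mul ?_ ?_) ?_
    · exact (Complex.continuous_ofReal.comp_aestronglyMeasurable hw.1).comp_fst
    · exact (hg.comp ((measurable_fst.comp measurable_snd).prodMk
        measurable_fst)).aestronglyMeasurable
    · exact (Complex.continuous_conj.measurable.comp (hg.comp
        ((measurable_snd.comp measurable_snd).prodMk measurable_fst))).aestronglyMeasurable
  have hHint : Integrable (Function.uncurry H)
      ((volume : Measure R3).prod (volume : Measure (ℝ × ℝ))) := by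
    refine (hw.mul_prod (hIint.mul_prod hIint)).mono' hHm (.of_forall fun z => ?_)
    simp only [Function.uncurry, hH, norm_mul, RCLike.norm_conj, Complex.norm_real,
      Real.norm_eq_abs, abs_of_nonneg (hw0 _), mul_assoc]
    gcongr
    · exact hw0 _
    · exact hI0 _
    · exact hgM _ _
    · exact hgM _ _
  have hinner : ∀ ξ, ((w ξ * ‖∫ t, g t ξ‖ ^ 2 : ℝ) : ℂ) = ∫ z, H ξ z := by
    intro ξ
    simp only [hH, mul_assoc]
    rw [integral_const_mul, Measure.volume_eq_prod,
      integral_prod_mul (fun t => g t ξ) (fun s => starRingEnd ℂ (g s ξ)), integral_conj,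
      Complex.mul_conj, Complex.normSq_eq_norm_sq]
    push_cast; rfl
  have hreal : Integrable fun ξ => w ξ * ‖∫ t, g t ξ‖ ^ 2 := by
    have h1 := hHint.integral_prod_left
    have h2 : Integrable fun ξ => ((w ξ * ‖∫ t, g t ξ‖ ^ 2 : ℝ) : ℂ) :=
      h1.congr (.of_forall fun ξ => (hinner ξ).symm)
    exact h2.re.congr (.of_forall fun ξ => Complex.ofReal_re _)
  rw [← ofReal_integral_eq_lintegral_ofReal hreal
    (.of_forall fun ξ => mul_nonneg (hw0 ξ) (by positivity))]
  have hsw : ((∫ ξ, w ξ * ‖∫ t, g t ξ‖ ^ 2 : ℝ) : ℂ) = ∫ z, ∫ ξ, H ξ z := by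
    rw [← integral_complex_ofReal, ← integral_integral_swap hHint]
    exact integral_congr_ae (.of_forall hinner)
  have hnn : 0 ≤ ∫ ξ, w ξ * ‖∫ t, g t ξ‖ ^ 2 :=
    integral_nonneg fun ξ => mul_nonneg (hw0 ξ) (by positivity)
  calc ENNReal.ofReal (∫ ξ, w ξ * ‖∫ t, g t ξ‖ ^ 2)
      = ‖((∫ ξ, w ξ * ‖∫ t, g t ξ‖ ^ 2 : ℝ) : ℂ)‖ₑ := by
        rw [← ofReal_norm, Complex.norm_real, Real.norm_eq_abs, abs_of_nonneg hnn]
    _ ≤ ∫⁻ z, ‖∫ ξ, H ξ z‖ₑ := by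
        rw [hsw]; exact enorm_integral_le_lintegral_enorm _
    _ = _ := by
        rw [Measure.volume_eq_prod, lintegral_prod]
        exact (hHint.integral_prod_right.1).enorm

/-- Cauchy-Schwarz, after `|Γ|² ≤ 2 w |Γ|²` on the support of `m`. Here the lower bound on the
weight is used, so the weight never has to be a multiplier equal to 1. -/
theorem enorm_integral_mul_conj_le {w : R3 → ℝ} (hwm : AEMeasurable w)
    {m Γ : R3 → ℂ} (hm : AEStronglyMeasurable m) (hΓ : AEMeasurable Γ)
    (hmw : ∀ᵐ ξ, m ξ ≠ 0 → 1 / 2 ≤ w ξ) :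
    ‖∫ ξ, m ξ * starRingEnd ℂ (Γ ξ)‖ₑ ≤
      eLpNorm m 2 volume * (2 * ∫⁻ ξ, ENNReal.ofReal (w ξ * ‖Γ ξ‖ ^ 2)) ^ (1 / 2 : ℝ) := by
  refine (enorm_integral_le_lintegral_enorm _).trans ?_
  have h1 : ∀ᵐ ξ, ‖m ξ * starRingEnd ℂ (Γ ξ)‖ₑ ≤
      ‖m ξ‖ₑ * (2 * ENNReal.ofReal (w ξ * ‖Γ ξ‖ ^ 2)) ^ (1 / 2 : ℝ) := by
    filter_upwards [hmw] with ξ hξ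
    rw [enorm_mul]
    by_cases h0 : m ξ = 0
    · simp [h0]
    gcongr
    rw [← ENNReal.ofReal_ofNat, ← ENNReal.ofReal_mul (by norm_num), ← ofReal_norm, RCLike.norm_conj]
    have h2 := hξ h0
    rw [ENNReal.ofReal_rpow_of_nonneg (by positivity) (by norm_num), ← Real.sqrt_eq_rpow]
    refine ENNReal.ofReal_le_ofReal (Real.le_sqrt_of_sq_le ?_)
    nlinarith [sq_nonneg ‖Γ ξ‖]
  refine (lintegral_mono_ae h1).trans ?_
  refine (ENNReal.lintegral_mul_le_Lp_mul_Lq volume Real.HolderConjugate.two_two hm.enorm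
    (by fun_prop)).trans (le_of_eq ?_)
  congr 1
  · rw [eLpNorm_eq_lintegral_rpow_enorm_toReal (by norm_num) (by norm_num)]
    simp
  · congr 1
    rw [← lintegral_const_mul' _ _ (by norm_num)]
    refine lintegral_congr fun ξ => ?_
    rw [← ENNReal.rpow_mul]; norm_num

end Duality

/-! ### The evolution as a Fourier integral, and its pairing with test functions -/

/-- The free evolution with phase `p` and amplitude `m` in frequency, as a Fourier integral. -/
def wave (p : R3 → ℝ) (m : R3 → ℂ) (t : ℝ) : R3 → ℂ :=
  𝓕⁻ fun ξ => Complex.exp ((t * p ξ : ℝ) * Complex.I) * m ξ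

section Wave

variable {p w : R3 → ℝ} {m : R3 → ℂ}

theorem integrable_exp_mul (hp : Continuous p) (hm : Integrable m) (t : ℝ) :
    Integrable fun ξ => Complex.exp ((t * p ξ : ℝ) * Complex.I) * m ξ :=
  hm.bdd_mul (c := 1) (Continuous.aestronglyMeasurable (by fun_prop))
    (.of_forall fun ξ => (Complex.norm_exp_ofReal_mul_I _).le)

theorem norm_wave_le (t : ℝ) (x : R3) : ‖wave p m t x‖ ≤ ∫ ξ, ‖m ξ‖ := by
  refine norm_fourierInv_le x |>.trans (le_of_eq ?_)
  simp_rw [norm_mul, Complex.norm_exp_ofReal_mul_I, one_mul]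

theorem measurable_uncurry_fourier {G : ℝ → R3 → ℂ} (hG : Measurable (Function.uncurry G)) :
    Measurable (Function.uncurry fun t ξ => (𝓕 (G t)) ξ) := by
  have h : StronglyMeasurable (Function.uncurry fun (z : ℝ × R3) (x : R3) =>
      Complex.exp ((-2 * Real.pi * inner ℝ x z.2 : ℝ) * Complex.I) * G z.1 x) := by
    refine Measurable.stronglyMeasurable (Measurable.mul ?_ ?_)
    · exact Continuous.measurable (by fun_prop)
    · exact hG.comp ((measurable_fst.comp measurable_fst).prodMk measurable_snd)
  have h2 := (h.integral_prod_right (ν := (volume : Measure R3))).measurable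
  convert h2 using 1
  ext z
  simp only [Function.uncurry, Real.fourier_eq', smul_eq_mul]

/-- The space-time pairing of the evolution with a test function, controlled through the dispersive
estimate and the Hardy-Littlewood-Sobolev inequality. -/
theorem enorm_integral_wave_mul_conj_le (hp : Continuous p) (hw : Integrable w)
    (hw0 : ∀ ξ, 0 ≤ w ξ) (hw2 : ∀ ξ, w ξ ≤ 2) {A : ℝ} (hA : 0 < A)
    (hK : ∀ τ : ℝ, τ ≠ 0 → ∀ᵐ x,
      ‖(𝓕⁻ fun ξ => Complex.exp ((τ * p ξ : ℝ) * Complex.I) * (w ξ : ℂ)) x‖ ≤ A / |τ|)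
    (hm : Integrable m) (hmw : ∀ᵐ ξ, m ξ ≠ 0 → 1 / 2 ≤ w ξ)
    {q : ℝ} (hq : 2 < q) {G : ℝ → R3 → ℂ} (hG : Measurable (Function.uncurry G)) {M n : ℝ}
    (hGM : ∀ t x, ‖G t x‖ ≤ M) (hGn : ∀ t x, t ∉ Set.Icc (-n) n ∨ x ∉ Metric.closedBall 0 n →
      G t x = 0)
    {f : ℝ → ℝ} (hf : Measurable f) (hf0 : ∀ t, 0 ≤ f t) (hfG0 : ∀ t x, f t = 0 → G t x = 0)
    (hfG : ∀ t, ∫⁻ x, ENNReal.ofReal (‖G t x‖ ^ (q / (q - 1))) ≤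
      ENNReal.ofReal (f t ^ (q / (q - 1)))) {X : ℝ} (hX : 0 < X)
    (hfX : ∫⁻ t, ENNReal.ofReal (f t ^ (2 / (1 + 2 / q))) ≤ ENNReal.ofReal X) :
    ‖∫ t, ∫ x, wave p m t x * starRingEnd ℂ (G t x)‖ₑ ≤ eLpNorm m 2 volume *
      ENNReal.ofReal (2 * ((16 * q / (q - 2) * (2 * A) ^ (q - 2)) ^ (1 / q) *
        (2 * (q + 2) * X ^ (1 + 2 / q)))) ^ (1 / 2 : ℝ) := by
  have hq0 : 0 < q := by linarith
  have hq2 : 0 < q - 2 := by linarith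
  have hM0 : 0 ≤ M := (norm_nonneg _).trans (hGM 0 0)
  set V : ℝ := (volume (Metric.closedBall (0 : R3) n)).toReal with hV
  have hGt : ∀ t, Measurable (G t) := fun t => hG.comp measurable_prodMk_left
  have hGfin : ∀ t, BddFinSupp volume (G t) := fun t => by
    refine ⟨hGt t, ⟨M, hGM t⟩, (measure_mono fun x hx => ?_).trans_lt
      (measure_closedBall_lt_top (x := (0 : R3)) (r := n))⟩
    by_contra h
    exact hx (hGn t x (Or.inr h))
  have hG1 : ∀ t, ∫ x, ‖G t x‖ ≤ M * V := fun t => by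
    calc ∫ x, ‖G t x‖ ≤ ∫ x, (Metric.closedBall (0 : R3) n).indicator (fun _ => M) x := by
          refine integral_mono (hGfin t).integrable.norm ((integrable_indicator_iff
            measurableSet_closedBall).2 (integrableOn_const measure_closedBall_lt_top.ne))
            fun x => ?_
          by_cases h : x ∈ Metric.closedBall (0 : R3) n
          · rw [Set.indicator_of_mem h]; exact hGM t x
          · rw [Set.indicator_of_notMem h, hGn t x (Or.inr h)]; simp
      _ = M * V := by
          rw [integral_indicator measurableSet_closedBall, setIntegral_const, smul_eq_mul,
            mul_comm]; rfl
  set g : ℝ → R3 → ℂ := fun t ξ =>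
    Complex.exp ((-t * p ξ : ℝ) * Complex.I) * (𝓕 (G t)) ξ with hg
  have hgm : Measurable (Function.uncurry g) := by
    refine Measurable.mul ?_ (measurable_uncurry_fourier hG)
    exact Continuous.measurable (by fun_prop)
  have hgM : ∀ t ξ, ‖g t ξ‖ ≤ (Set.Icc (-n) n).indicator (fun _ => M * V) t := by
    intro t ξ
    simp only [hg]
    rw [norm_mul, Complex.norm_exp_ofReal_mul_I, one_mul]
    by_cases h : t ∈ Set.Icc (-n) n
    · rw [Set.indicator_of_mem h]; exact (norm_fourier_le ξ).trans (hG1 t)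
    · rw [Set.indicator_of_notMem h]
      refine (norm_fourier_le ξ).trans (le_of_eq ?_)
      simp [hGn t _ (Or.inl h)]
  -- the pairing in frequency
  have hpair : ∫ t, ∫ x, wave p m t x * starRingEnd ℂ (G t x) =
      ∫ ξ, m ξ * starRingEnd ℂ (∫ t, g t ξ) := by
    have e1 : ∀ t, ∫ x, wave p m t x * starRingEnd ℂ (G t x) =
        ∫ ξ, m ξ * starRingEnd ℂ (g t ξ) := by
      intro t
      have hG' : Integrable fun x => starRingEnd ℂ (G t x) :=
        Complex.conjCLE.toContinuousLinearMap.integrable_comp (hGfin t).integrable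
      rw [wave, integral_fourierInv_mul_eq (integrable_exp_mul hp hm t) hG']
      refine integral_congr_ae (.of_forall fun ξ => ?_)
      simp only [hg]
      rw [fourierInv_conj, map_mul, ← Complex.exp_conj, map_mul, Complex.conj_ofReal,
        Complex.conj_I]
      push_cast
      rw [show -(t : ℂ) * (p ξ : ℂ) * -Complex.I = t * p ξ * Complex.I by ring]
      ring
    simp_rw [e1]
    rw [integral_integral_swap]
    · refine integral_congr_ae (.of_forall fun ξ => ?_)
      simp only
      rw [integral_const_mul, integral_conj]
    · refine ((integrable_indicator_Icc n (M * V)).mul_prod hm.norm).mono' ?_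
        (.of_forall fun z => ?_)
      · exact hm.1.comp_snd.mul (Complex.continuous_conj.measurable.comp hgm).aestronglyMeasurable
      · simp only [Function.uncurry, norm_mul, RCLike.norm_conj]
        rw [mul_comm]
        gcongr
        exact hgM _ _
  have hΓm : AEMeasurable fun ξ => ∫ t, g t ξ :=
    (hgm.stronglyMeasurable.integral_prod_left (μ := volume)).aemeasurable
  rw [hpair]
  refine (enorm_integral_mul_conj_le hw.1.aemeasurable hm.1 hΓm hmw).trans ?_
  gcongr
  rw [ENNReal.ofReal_mul (by norm_num), ENNReal.ofReal_ofNat]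
  gcongr
  refine (ofReal_integral_mul_norm_sq_le hw hw0 hgm hgM).trans ?_
  set κ : ℝ := (16 * q / (q - 2) * (2 * A) ^ (q - 2)) ^ (1 / q) with hκ
  have hκ0 : 0 ≤ κ := by positivity
  -- The decay `1/|τ|` enters the interpolated bound with power `(q - 2)/q`.
  set γ : ℝ := 1 - 2 / q with hγ
  have h2q : 2 / q < 1 := by rw [div_lt_one hq0]; exact hq
  have h2q0 : 0 < 2 / q := by positivity
  have hbil : ∀ t, ∀ᵐ s, ‖∫ ξ, (w ξ : ℂ) * g t ξ * starRingEnd ℂ (g s ξ)‖ₑ ≤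
      ENNReal.ofReal κ * (ENNReal.ofReal (f t) * ENNReal.ofReal (f s) *
        ENNReal.ofReal (|t - s| ^ (-γ))) := by
    intro t
    -- The diagonal `s = t`, where no dispersive bound is available, is a null set.
    filter_upwards [compl_mem_ae_iff.2 (measure_singleton t)] with s hs
    have hs' : s ≠ t := hs
    have hts : s - t ≠ 0 := sub_ne_zero.2 hs'
    have e1 : ∀ ξ, (w ξ : ℂ) * g t ξ * starRingEnd ℂ (g s ξ) =
        Complex.exp (((s - t) * p ξ : ℝ) * Complex.I) * (w ξ : ℂ) * (𝓕 (G t)) ξ *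
          starRingEnd ℂ ((𝓕 (G s)) ξ) := by
      intro ξ
      simp only [hg]
      rw [map_mul, ← Complex.exp_conj, map_mul, Complex.conj_ofReal, Complex.conj_I]
      rw [show (((s - t) * p ξ : ℝ) : ℂ) * Complex.I = ((-t * p ξ : ℝ) : ℂ) * Complex.I +
        ((-s * p ξ : ℝ) : ℂ) * -Complex.I by push_cast; ring, Complex.exp_add]
      ring
    simp_rw [e1]
    rw [← ENNReal.ofReal_mul (hf0 t), ← ENNReal.ofReal_mul (mul_nonneg (hf0 t) (hf0 s)),
      ← ENNReal.ofReal_mul hκ0, ← ofReal_norm]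
    refine ENNReal.ofReal_le_ofReal ?_
    rcases (hf0 t).eq_or_lt with h | ht
    · have h0 : ∀ ξ, (𝓕 (G t)) ξ = 0 := fun ξ => by
        rw [show G t = 0 from funext fun x => hfG0 t x h.symm, Real.fourier_eq]; simp
      simp [h0, ← h]
    rcases (hf0 s).eq_or_lt with h | hs0
    · have h0 : ∀ ξ, (𝓕 (G s)) ξ = 0 := fun ξ => by
        rw [show G s = 0 from funext fun x => hfG0 s x h.symm, Real.fourier_eq]; simp
      simp [h0, ← h]
    have hτ : 0 < |s - t| := abs_pos.2 hts
    have hwc : Integrable fun ξ => (w ξ : ℂ) := hw.ofReal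
    refine (norm_integral_mul_fourier_mul_conj_le (integrable_exp_mul hp hwc (s - t))
      (fun ξ => ?_) (div_pos hA hτ) (hK (s - t) hts) hq (hGfin t) (hGfin s) ht hs0 (hfG t)
      (hfG s)).trans (le_of_eq ?_)
    · rw [norm_mul, Complex.norm_exp_ofReal_mul_I, one_mul, Complex.norm_real, Real.norm_eq_abs,
        abs_of_nonneg (hw0 ξ)]
      exact hw2 ξ
    · have : (16 * q / (q - 2) * (2 * (A / |s - t|)) ^ (q - 2)) ^ (1 / q) =
          κ * |t - s| ^ (-γ) := by
        rw [← mul_div_assoc, Real.div_rpow (by positivity) hτ.le, ← mul_div_assoc,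
          Real.div_rpow (by positivity) (by positivity), ← hκ, ← Real.rpow_mul hτ.le,
          abs_sub_comm t s, Real.rpow_neg hτ.le, div_eq_mul_inv]
        congr 3
        rw [hγ]; field_simp
      rw [this]; ring
  refine (lintegral_mono fun t => lintegral_mono_ae (hbil t)).trans ?_
  simp_rw [lintegral_const_mul' (ENNReal.ofReal κ) _ ENNReal.ofReal_ne_top]
  rw [ENNReal.ofReal_mul hκ0]
  gcongr
  have h2γ : 2 - γ = 1 + 2 / q := by rw [hγ]; ring
  have := lintegral_lintegral_mul_rpow_neg_le (γ := γ) (by rw [hγ]; linarith)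
    (by rw [hγ]; linarith) hf hf0 hX (by rw [h2γ]; exact hfX)
  rw [h2γ] at this
  refine this.trans (le_of_eq ?_)
  congr 2
  rw [hγ]; field_simp; ring

end Wave

/-! ### Strichartz estimate on the sharp line -/

section Strichartz

variable {p w : R3 → ℝ} {m : R3 → ℂ}

theorem continuous_uncurry_wave (hp : Continuous p) (hm : Integrable m) :
    Continuous (Function.uncurry (wave p m)) := by
  have h : (Function.uncurry (wave p m)) = fun z : ℝ × R3 => ∫ ξ,
      Complex.exp ((2 * Real.pi * inner ℝ ξ z.2 : ℝ) * Complex.I) *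
        (Complex.exp ((z.1 * p ξ : ℝ) * Complex.I) * m ξ) := by
    ext z
    simp only [Function.uncurry, wave, Real.fourierInv_eq', smul_eq_mul]
  rw [h]
  refine continuous_of_dominated (bound := fun ξ => ‖m ξ‖) (fun z => ?_) (fun z => ?_) hm.norm ?_
  · exact (Continuous.aestronglyMeasurable (by fun_prop)).mul
      (integrable_exp_mul hp hm z.1).1
  · refine .of_forall fun ξ => ?_
    rw [norm_mul, norm_mul, Complex.norm_exp_ofReal_mul_I, Complex.norm_exp_ofReal_mul_I]
    simp
  · exact .of_forall fun ξ => by fun_prop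

theorem continuous_wave (hp : Continuous p) (hm : Integrable m) (t : ℝ) :
    Continuous (wave p m t) :=
  (continuous_uncurry_wave hp hm).uncurry_left t

/-- The Strichartz estimate on a bounded region of space-time. -/
theorem ofReal_setIntegral_wave_le (hp : Continuous p) (hw : Integrable w)
    (hw0 : ∀ ξ, 0 ≤ w ξ) (hw2 : ∀ ξ, w ξ ≤ 2) {A : ℝ} (hA : 0 < A)
    (hK : ∀ τ : ℝ, τ ≠ 0 → ∀ᵐ x,
      ‖(𝓕⁻ fun ξ => Complex.exp ((τ * p ξ : ℝ) * Complex.I) * (w ξ : ℂ)) x‖ ≤ A / |τ|)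
    (hm : Integrable m) (hmw : ∀ᵐ ξ, m ξ ≠ 0 → 1 / 2 ≤ w ξ)
    {q r : ℝ} (hq : 2 < q) (hr : r = 2 * q / (q - 2)) {n : ℝ} (hn : 0 < n) {j : ℝ → ℝ}
    (hj : ∀ t, j t = ∫ x in Metric.closedBall (0 : R3) n, ‖wave p m t x‖ ^ q)
    {S : Set ℝ} (hS : S = {t | t ∈ Set.Icc (-n) n ∧ 1 / n ≤ j t}) :
    ∫⁻ t in S, ENNReal.ofReal (j t ^ (r / q)) ≤ (eLpNorm m 2 volume *
      ENNReal.ofReal (2 * ((16 * q / (q - 2) * (2 * A) ^ (q - 2)) ^ (1 / q) *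
        (2 * (q + 2)))) ^ (1 / 2 : ℝ)) ^ r := by
  have hq0 : 0 < q := by linarith
  have hq1 : 0 < q - 1 := by linarith
  have hq2 : 0 < q - 2 := by linarith
  have hr0 : 0 < r := by rw [hr]; positivity
  set B : Set R3 := Metric.closedBall (0 : R3) n with hB
  have hBm : MeasurableSet B := measurableSet_closedBall
  have hBfin : volume B < ∞ := measure_closedBall_lt_top
  set N : ℝ := ∫ ξ, ‖m ξ‖ with hN
  have hN0 : 0 ≤ N := integral_nonneg fun _ => norm_nonneg _
  have huc := continuous_uncurry_wave hp hm
  have hut := continuous_wave hp hm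
  have huq : Measurable (Function.uncurry fun t x => ‖wave p m t x‖ ^ q) :=
    (huc.norm.rpow_const fun _ => Or.inr hq0.le).measurable
  have hutq : ∀ t, IntegrableOn (fun x => ‖wave p m t x‖ ^ q) B := fun t => by
    refine ((hut t).norm.rpow_const fun _ => Or.inr hq0.le).continuousOn.integrableOn_compact
      (isCompact_closedBall _ _)
  have hjm : Measurable j := by
    have h := (huq.stronglyMeasurable.integral_prod_right (ν := volume.restrict B)).measurable
    convert h using 1
    ext t; exact hj t
  have hj0 : ∀ t, 0 ≤ j t := fun t => by
    rw [hj]; exact integral_nonneg fun x => by positivity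
  have hjle : ∀ t, j t ≤ N ^ q * (volume B).toReal := fun t => by
    rw [hj]
    have := setIntegral_mono_on (hutq t) (integrableOn_const (C := N ^ q) hBfin.ne) hBm
      fun x _ => Real.rpow_le_rpow (norm_nonneg _) (norm_wave_le t x) hq0.le
    refine this.trans (le_of_eq ?_)
    rw [setIntegral_const, smul_eq_mul, mul_comm]; rfl
  have hSm : MeasurableSet S := by
    rw [hS]
    exact measurableSet_Icc.inter (measurableSet_le measurable_const hjm)
  have hSj : ∀ t ∈ S, 0 < j t := fun t ht => by
    rw [hS] at ht
    exact lt_of_lt_of_le (by positivity) ht.2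
  have hSI : S ⊆ Set.Icc (-n) n := fun t ht => by rw [hS] at ht; exact ht.1
  have hjint : IntegrableOn (fun t => j t ^ (r / q)) S := by
    refine Measure.integrableOn_of_bounded (M := (N ^ q * (volume B).toReal) ^ (r / q))
      ((measure_mono hSI).trans_lt (by simp)).ne
      (hjm.pow_const _).aestronglyMeasurable (.of_forall fun t => ?_)
    rw [Real.norm_eq_abs, abs_of_nonneg (Real.rpow_nonneg (hj0 t) _)]
    exact Real.rpow_le_rpow (hj0 t) (hjle t) (by positivity)
  set X : ℝ := ∫ t in S, j t ^ (r / q) with hX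
  have hXl : ∫⁻ t in S, ENNReal.ofReal (j t ^ (r / q)) = ENNReal.ofReal X :=
    (ofReal_integral_eq_lintegral_ofReal hjint
      (.of_forall fun t => Real.rpow_nonneg (hj0 t) _)).symm
  rw [hXl]
  have hX0 : 0 ≤ X := integral_nonneg fun t => Real.rpow_nonneg (hj0 t) _
  rcases hX0.eq_or_lt with h0 | hXpos
  · rw [← h0]; simp
  -- The extremal function for the duality of `L^r L^q`: its pairing with the evolution is `X`, its
  -- `L^{q'}` norm at time `t` is `j^{(r-1)/q}`, and the `r'`-th power of the latter is again
  -- `j^{r/q}`, where `r' = 2/(1 + 2/q)`.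
  set G : ℝ → R3 → ℂ := fun t x => (S ×ˢ B).indicator
    (fun z => ((‖wave p m z.1 z.2‖ ^ (q - 2) * j z.1 ^ ((r - q) / q) : ℝ) : ℂ) *
      wave p m z.1 z.2) (t, x) with hG
  have hGin : ∀ t ∈ S, ∀ x ∈ B, G t x =
      ((‖wave p m t x‖ ^ (q - 2) * j t ^ ((r - q) / q) : ℝ) : ℂ) * wave p m t x :=
    fun t ht x hx => Set.indicator_of_mem (Set.mk_mem_prod ht hx) _
  have hGoutS : ∀ t ∉ S, ∀ x, G t x = 0 := fun t ht x =>
    Set.indicator_of_notMem (fun h => ht h.1) _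
  have hGoutB : ∀ t, ∀ x ∉ B, G t x = 0 := fun t x hx =>
    Set.indicator_of_notMem (fun h => hx h.2) _
  have hGm : Measurable (Function.uncurry G) := by
    refine Measurable.indicator (Measurable.mul (Measurable.mul ?_ ?_).complex_ofReal
      huc.measurable) (hSm.prod hBm)
    · exact (huc.norm.rpow_const fun _ => Or.inr hq2.le).measurable
    · exact (hjm.comp measurable_fst).pow_const _
  -- The exponent may be negative; the restriction `j ≥ 1/n` in `S` keeps the power bounded.
  have hjpow : ∃ J, ∀ t ∈ S, j t ^ ((r - q) / q) ≤ J := by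
    rcases le_total 0 ((r - q) / q) with h | h
    · exact ⟨_, fun t ht => Real.rpow_le_rpow (hj0 t) (hjle t) h⟩
    · refine ⟨(1 / n) ^ ((r - q) / q), fun t ht => ?_⟩
      rw [hS] at ht
      exact Real.rpow_le_rpow_of_nonpos (by positivity) ht.2 h
  obtain ⟨J, hJ⟩ := hjpow
  have hnormG : ∀ t ∈ S, ∀ x ∈ B, ‖G t x‖ = ‖wave p m t x‖ ^ (q - 1) * j t ^ ((r - q) / q) := by
    intro t ht x hx
    have h1 : 0 ≤ j t ^ ((r - q) / q) := Real.rpow_nonneg (hj0 t) _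
    rw [hGin t ht x hx, norm_mul, Complex.norm_real, Real.norm_eq_abs,
      abs_of_nonneg (by positivity), show q - 1 = (q - 2) + 1 by ring,
      Real.rpow_add' (norm_nonneg _) (by linarith), Real.rpow_one]
    ring
  set f : ℝ → ℝ := S.indicator fun t => j t ^ ((r - 1) / q) with hf
  have key := enorm_integral_wave_mul_conj_le (n := n) (M := N ^ (q - 1) * |J|) (G := G) (f := f)
    (X := X) hp hw hw0 hw2 hA hK hm hmw hq hGm ?_ ?_ ((hjm.pow_const _).indicator hSm) ?_ ?_ ?_
    hXpos ?_
  · have hpair : ∫ t, ∫ x, wave p m t x * starRingEnd ℂ (G t x) = (X : ℂ) := by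
      have e1 : ∀ t, ∫ x, wave p m t x * starRingEnd ℂ (G t x) =
          S.indicator (fun t => ((j t ^ (r / q) : ℝ) : ℂ)) t := by
        intro t
        by_cases ht : t ∈ S
        · rw [Set.indicator_of_mem ht]
          have e2 : ∀ x, wave p m t x * starRingEnd ℂ (G t x) =
              B.indicator (fun x => ((‖wave p m t x‖ ^ q * j t ^ ((r - q) / q) : ℝ) : ℂ)) x := by
            intro x
            by_cases hx : x ∈ B
            · rw [Set.indicator_of_mem hx, hGin t ht x hx, map_mul, Complex.conj_ofReal,
                mul_left_comm, Complex.mul_conj, Complex.normSq_eq_norm_sq,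
                show q = (q - 2) + 2 by ring, Real.rpow_add' (norm_nonneg _) (by linarith),
                Real.rpow_ofNat]
              push_cast
              rw [show q - 2 + 2 = q by ring]; ring
            · rw [Set.indicator_of_notMem hx, hGoutB t x hx]; simp
          simp_rw [e2]
          rw [integral_indicator hBm, integral_complex_ofReal, integral_mul_const, ← hj,
            mul_comm]
          congr 1
          nth_rewrite 2 [← Real.rpow_one (j t)]
          rw [← Real.rpow_add (hSj t ht)]
          congr 1
          field_simp; ring
        · rw [Set.indicator_of_notMem ht]
          simp [hGoutS t ht]
      simp_rw [e1]
      rw [integral_indicator hSm, integral_complex_ofReal]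
    rw [hpair] at key
    have e3 : ‖(X : ℂ)‖ₑ = ENNReal.ofReal X := by
      rw [← ofReal_norm, Complex.norm_real, Real.norm_eq_abs, abs_of_nonneg hX0]
    rw [e3] at key
    have h12 : 0 < 1 + 2 / q := by positivity
    rw [← mul_assoc, ← mul_assoc, ENNReal.ofReal_mul (by positivity),
      ENNReal.mul_rpow_of_nonneg _ _ (by norm_num), ← mul_assoc,
      ENNReal.ofReal_rpow_of_nonneg (p := 1 / 2) (Real.rpow_nonneg hX0 _) (by norm_num),
      ← Real.rpow_mul hX0] at key
    rw [← ENNReal.rpow_inv_le_iff hr0]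
    -- The pairing bound reads `X ≤ E · X^{1/r'}`. Truncation made `X` finite and it is positive
    -- here, so `X^{1/r'}` can be divided out, leaving `X^{1/r} ≤ E`.
    have e4 : ENNReal.ofReal X = ENNReal.ofReal X ^ r⁻¹ *
        ENNReal.ofReal (X ^ ((1 + 2 / q) * (1 / 2))) := by
      rw [ENNReal.ofReal_rpow_of_pos hXpos, ← ENNReal.ofReal_mul (by positivity),
        ← Real.rpow_add hXpos]
      congr 1
      nth_rewrite 1 [← Real.rpow_one X]
      congr 1
      rw [hr, inv_div]; field_simp; ring
    rw [e4, ENNReal.mul_le_mul_iff_left (by positivity) ENNReal.ofReal_ne_top] at key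
    rw [← mul_assoc 2]
    exact key
  · intro t x
    by_cases h : t ∈ S ∧ x ∈ B
    · rw [hnormG t h.1 x h.2]
      have := norm_wave_le (p := p) (m := m) t x
      have h1 := Real.rpow_nonneg (hj0 t) ((r - q) / q)
      gcongr
      exact (hJ t h.1).trans (le_abs_self J)
    · rw [show G t x = 0 from Set.indicator_of_notMem (fun h' => h ⟨h'.1, h'.2⟩) _, norm_zero]
      positivity
  · rintro t x (h | h)
    · exact hGoutS t (fun h' => h (hSI h')) x
    · exact hGoutB t x h
  · intro t
    exact Set.indicator_nonneg (fun t _ => Real.rpow_nonneg (hj0 t) _) t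
  · intro t x h
    by_cases ht : t ∈ S
    · rw [hf, Set.indicator_of_mem ht] at h
      exact absurd h (Real.rpow_pos_of_pos (hSj t ht) _).ne'
    · exact hGoutS t ht x
  · intro t
    by_cases ht : t ∈ S
    · have e1 : ∀ x, ENNReal.ofReal (‖G t x‖ ^ (q / (q - 1))) = B.indicator (fun x =>
          ENNReal.ofReal (‖wave p m t x‖ ^ q * j t ^ ((r - q) / (q - 1)))) x := by
        intro x
        by_cases hx : x ∈ B
        · rw [Set.indicator_of_mem hx, hnormG t ht x hx,
            Real.mul_rpow (by positivity) (Real.rpow_nonneg (hj0 t) _),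
            ← Real.rpow_mul (norm_nonneg _), ← Real.rpow_mul (hj0 t)]
          congr 3
          · field_simp
          · field_simp
        · rw [Set.indicator_of_notMem hx, hGoutB t x hx, norm_zero,
            Real.zero_rpow (by positivity), ENNReal.ofReal_zero]
      simp_rw [e1]
      rw [lintegral_indicator hBm, ← ofReal_integral_eq_lintegral_ofReal ((hutq t).mul_const _)
        (.of_forall fun x => mul_nonneg (by positivity) (Real.rpow_nonneg (hj0 t) _)),
        integral_mul_const, ← hj, hf, Set.indicator_of_mem ht, ← Real.rpow_mul (hj0 t)]
      refine le_of_eq ?_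
      congr 1
      nth_rewrite 1 [← Real.rpow_one (j t)]
      rw [← Real.rpow_add (hSj t ht)]
      congr 1
      field_simp; ring
    · have : ∀ x, ENNReal.ofReal (‖G t x‖ ^ (q / (q - 1))) = 0 := fun x => by
        rw [hGoutS t ht, norm_zero, Real.zero_rpow (by positivity), ENNReal.ofReal_zero]
      simp [this]
  · rw [← hXl, ← lintegral_indicator hSm]
    refine lintegral_mono fun t => ?_
    by_cases ht : t ∈ S
    · rw [hf, Set.indicator_of_mem ht, Set.indicator_of_mem ht, ← Real.rpow_mul (hj0 t)]
      refine le_of_eq ?_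
      congr 2
      rw [hr]; field_simp; ring
    · rw [hf, Set.indicator_of_notMem ht, Set.indicator_of_notMem ht,
        Real.zero_rpow (by positivity), ENNReal.ofReal_zero]

theorem lintegral_lintegral_wave_rpow_le (hp : Continuous p) (hw : Integrable w)
    (hw0 : ∀ ξ, 0 ≤ w ξ) (hw2 : ∀ ξ, w ξ ≤ 2) {A : ℝ} (hA : 0 < A)
    (hK : ∀ τ : ℝ, τ ≠ 0 → ∀ᵐ x,
      ‖(𝓕⁻ fun ξ => Complex.exp ((τ * p ξ : ℝ) * Complex.I) * (w ξ : ℂ)) x‖ ≤ A / |τ|)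
    (hm : Integrable m) (hmw : ∀ᵐ ξ, m ξ ≠ 0 → 1 / 2 ≤ w ξ)
    {q r : ℝ} (hq : 2 < q) (hr : r = 2 * q / (q - 2)) :
    ∫⁻ t, (∫⁻ x, ENNReal.ofReal (‖wave p m t x‖ ^ q)) ^ (r / q) ≤ (eLpNorm m 2 volume *
      ENNReal.ofReal (2 * ((16 * q / (q - 2) * (2 * A) ^ (q - 2)) ^ (1 / q) *
        (2 * (q + 2)))) ^ (1 / 2 : ℝ)) ^ r := by
  have hq0 : 0 < q := by linarith
  have hq2 : 0 < q - 2 := by linarith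
  have hr0 : 0 < r := by rw [hr]; positivity
  set E : ℝ≥0∞ := (eLpNorm m 2 volume *
      ENNReal.ofReal (2 * ((16 * q / (q - 2) * (2 * A) ^ (q - 2)) ^ (1 / q) *
        (2 * (q + 2)))) ^ (1 / 2 : ℝ)) ^ r with hE
  have hut := continuous_wave hp hm
  have huqc : ∀ t, Continuous fun x => ‖wave p m t x‖ ^ q := fun t =>
    (hut t).norm.rpow_const fun _ => Or.inr hq0.le
  set j : ℕ → ℝ → ℝ := fun n t =>
    ∫ x in Metric.closedBall (0 : R3) (n + 1 : ℝ), ‖wave p m t x‖ ^ q with hj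
  set S : ℕ → Set ℝ := fun n =>
    {t | t ∈ Set.Icc (-(n + 1 : ℝ)) (n + 1) ∧ 1 / (n + 1 : ℝ) ≤ j n t} with hS
  have hjm : ∀ n, Measurable (j n) := fun n => by
    have huq : Measurable (Function.uncurry fun t x => ‖wave p m t x‖ ^ q) :=
      ((continuous_uncurry_wave hp hm).norm.rpow_const fun _ => Or.inr hq0.le).measurable
    have h := (huq.stronglyMeasurable.integral_prod_right
      (ν := volume.restrict (Metric.closedBall (0 : R3) (n + 1 : ℝ)))).measurable
    exact h
  have hSm : ∀ n, MeasurableSet (S n) := fun n =>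
    measurableSet_Icc.inter (measurableSet_le measurable_const (hjm n))
  have hbound : ∀ n : ℕ, ∫⁻ t, (S n).indicator (fun t => ENNReal.ofReal (j n t ^ (r / q))) t ≤ E :=
    fun n => by
      rw [lintegral_indicator (hSm n)]
      exact ofReal_setIntegral_wave_le hp hw hw0 hw2 hA hK hm hmw hq hr
        (by positivity : (0 : ℝ) < n + 1) (fun t => rfl) rfl
  have hjl : ∀ n t, ENNReal.ofReal (j n t) = ∫⁻ x, (Metric.closedBall (0 : R3) (n + 1 : ℝ)).indicator
      (fun x => ENNReal.ofReal (‖wave p m t x‖ ^ q)) x := fun n t => by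
    rw [lintegral_indicator measurableSet_closedBall, hj]
    exact ofReal_integral_eq_lintegral_ofReal ((huqc t).continuousOn.integrableOn_compact
      (isCompact_closedBall _ _)) (.of_forall fun x => by positivity)
  have hlim : ∀ t, Filter.Tendsto (fun n => ENNReal.ofReal (j n t)) Filter.atTop
      (nhds (∫⁻ x, ENNReal.ofReal (‖wave p m t x‖ ^ q))) := fun t => by
    simp_rw [hjl]
    refine lintegral_tendsto_of_tendsto_of_monotone
      (fun n => ((huqc t).measurable.ennreal_ofReal.indicator measurableSet_closedBall).aemeasurable)
      (.of_forall fun x => ?_) (.of_forall fun x => ?_)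
    · intro a b hab
      refine Set.indicator_le_indicator_of_subset (Metric.closedBall_subset_closedBall ?_)
        (fun _ => zero_le) x
      have : (a : ℝ) ≤ b := by exact_mod_cast hab
      linarith
    · refine tendsto_const_nhds.congr' ?_
      obtain ⟨k, hk⟩ := exists_nat_ge ‖x‖
      filter_upwards [Filter.eventually_ge_atTop k] with n hn
      have : (k : ℝ) ≤ n := by exact_mod_cast hn
      rw [Set.indicator_of_mem]
      simp only [Metric.mem_closedBall, dist_zero_right]
      linarith
  -- The truncations by balls and by `S` disappear in the limit: if the full norm at time `t` is
  -- positive, `j n t` eventually exceeds a fixed constant and hence `1/(n + 1)`. Fatou's lemma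
  -- concludes.
  have hpt : ∀ t, (∫⁻ x, ENNReal.ofReal (‖wave p m t x‖ ^ q)) ^ (r / q) ≤
      Filter.liminf (fun n => (S n).indicator (fun t => ENNReal.ofReal (j n t ^ (r / q))) t)
        Filter.atTop := by
    intro t
    rcases eq_or_ne (∫⁻ x, ENNReal.ofReal (‖wave p m t x‖ ^ q)) 0 with h0 | h0
    · rw [h0, ENNReal.zero_rpow_of_pos (by positivity)]
      exact zero_le
    obtain ⟨c, hc0, hc⟩ := ENNReal.lt_iff_exists_nnreal_btwn.1 (pos_iff_ne_zero.2 h0)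
    have hc0' : (0 : ℝ) < c := by exact_mod_cast hc0
    have hev : ∀ᶠ n : ℕ in Filter.atTop, ENNReal.ofReal (j n t) ^ (r / q) =
        (S n).indicator (fun t => ENNReal.ofReal (j n t ^ (r / q))) t := by
      obtain ⟨k, hk⟩ := exists_nat_ge |t|
      obtain ⟨l, hl⟩ := exists_nat_ge (1 / (c : ℝ))
      filter_upwards [Filter.eventually_ge_atTop k, Filter.eventually_ge_atTop l,
        (hlim t).eventually_const_lt hc] with n hnk hnl hnc
      have h1 : (k : ℝ) ≤ n := by exact_mod_cast hnk
      have h2 : (l : ℝ) ≤ n := by exact_mod_cast hnl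
      have h3 : (c : ℝ) ≤ j n t := by
        have := hnc.le
        rw [← ENNReal.ofReal_coe_nnreal, ENNReal.ofReal_le_ofReal_iff'] at this
        rcases this with h | h
        · exact h
        · linarith
      rw [Set.indicator_of_mem, ENNReal.ofReal_rpow_of_nonneg (by linarith) (by positivity)]
      have h4 := abs_le.1 (hk.trans h1)
      refine ⟨⟨by linarith, by linarith⟩, le_trans ?_ h3⟩
      rw [div_le_iff₀ (by positivity)]
      have h5 := (div_le_iff₀ hc0').1 (hl.trans h2)
      nlinarith
    refine le_of_eq (Filter.Tendsto.liminf_eq ?_).symm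
    exact (((ENNReal.continuous_rpow_const (y := r / q)).tendsto _).comp (hlim t)).congr' hev
  calc _ ≤ ∫⁻ t, Filter.liminf (fun n => (S n).indicator
        (fun t => ENNReal.ofReal (j n t ^ (r / q))) t) Filter.atTop := lintegral_mono hpt
    _ ≤ Filter.liminf (fun n => ∫⁻ t, (S n).indicator
        (fun t => ENNReal.ofReal (j n t ^ (r / q))) t) Filter.atTop :=
      lintegral_liminf_le fun n => ((hjm n).pow_const _).ennreal_ofReal.indicator (hSm n)
    _ ≤ E := by
      refine Filter.liminf_le_of_le ?_ fun b hb => ?_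
      · isBoundedDefault
      · obtain ⟨n, hn⟩ := hb.exists
        exact hn.trans (hbound n)

/-- The sharp-admissible Strichartz estimate for a phase with kernel decay `A / |t|`. -/
theorem mixedNorm_wave_le (hp : Continuous p) (hw : Integrable w)
    (hw0 : ∀ ξ, 0 ≤ w ξ) (hw2 : ∀ ξ, w ξ ≤ 2) {A : ℝ} (hA : 0 < A)
    (hK : ∀ τ : ℝ, τ ≠ 0 → ∀ᵐ x,
      ‖(𝓕⁻ fun ξ => Complex.exp ((τ * p ξ : ℝ) * Complex.I) * (w ξ : ℂ)) x‖ ≤ A / |τ|)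
    (hm : Integrable m) (hmw : ∀ᵐ ξ, m ξ ≠ 0 → 1 / 2 ≤ w ξ)
    {q r : ℝ} (hq : 2 < q) (hr : r = 2 * q / (q - 2)) :
    mixedNorm (ENNReal.ofReal q) (ENNReal.ofReal r) (wave p m) ≤ ENNReal.ofReal
      ((2 * ((16 * q / (q - 2) * 2 ^ (q - 2)) ^ (1 / q) * (2 * (q + 2)))) ^ (1 / 2 : ℝ) *
        A ^ (1 / r)) * eLpNorm m 2 volume := by
  have hq0 : 0 < q := by linarith
  have hq2 : 0 < q - 2 := by linarith
  have hr0 : 0 < r := by rw [hr]; positivity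
  have key := lintegral_lintegral_wave_rpow_le hp hw hw0 hw2 hA hK hm hmw hq hr
  have e1 : ∀ t, eLpNorm (wave p m t) (ENNReal.ofReal q) volume =
      (∫⁻ x, ENNReal.ofReal (‖wave p m t x‖ ^ q)) ^ (1 / q) := fun t => by
    rw [eLpNorm_eq_lintegral_rpow_enorm_toReal (by simpa using hq0) ENNReal.ofReal_ne_top,
      ENNReal.toReal_ofReal hq0.le]
    congr 1
    refine lintegral_congr fun x => ?_
    rw [← ofReal_norm, ENNReal.ofReal_rpow_of_nonneg (norm_nonneg _) hq0.le]
  unfold mixedNorm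
  simp_rw [e1]
  rw [eLpNorm_eq_lintegral_rpow_enorm_toReal (by simpa using hr0) ENNReal.ofReal_ne_top,
    ENNReal.toReal_ofReal hr0.le, one_div r, ENNReal.rpow_inv_le_iff hr0]
  have e2 : ∀ t, ‖(∫⁻ x, ENNReal.ofReal (‖wave p m t x‖ ^ q)) ^ (1 / q)‖ₑ ^ r =
      (∫⁻ x, ENNReal.ofReal (‖wave p m t x‖ ^ q)) ^ (r / q) := fun t => by
    rw [enorm_eq_self, ← ENNReal.rpow_mul, one_div_mul_eq_div]
  simp_rw [e2]
  refine key.trans (le_of_eq ?_)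
  congr 1
  rw [mul_comm, ENNReal.ofReal_rpow_of_nonneg (by positivity) (by norm_num)]
  congr 2
  -- The power of `A` is isolated; after the square root it is `(q - 2)/(2q) = 1/r`.
  have e3 : 2 * ((16 * q / (q - 2) * (2 * A) ^ (q - 2)) ^ (1 / q) * (2 * (q + 2))) =
      2 * ((16 * q / (q - 2) * 2 ^ (q - 2)) ^ (1 / q) * (2 * (q + 2))) *
        A ^ ((q - 2) * (1 / q)) := by
    rw [Real.mul_rpow (by norm_num) hA.le, ← mul_assoc (16 * q / (q - 2)),
      Real.mul_rpow (by positivity) (by positivity), ← Real.rpow_mul hA.le]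
    ring
  rw [e3, Real.mul_rpow (by positivity) (by positivity), ← Real.rpow_mul hA.le]
  congr 2
  rw [hr]; field_simp

end Strichartz

/-! ### Application to `λ^±` -/

section Spheroidal

/-- Rescaling frequencies by `2π` turns the kernel into that of the dispersive estimate; the factor
`(2π)⁻³ ≤ 1` is discarded. -/
theorem norm_fourierInv_exp_mul_spheroidalWeight_le {σ : ℝ} (hσ : σ = 1 ∨ σ = -1) {R τ : ℝ}
    (hR : 1 < R) (hτ : τ ≠ 0) : ∀ᵐ x : R3,
      ‖(𝓕⁻ fun ξ : R3 => Complex.exp ((τ * lambdaPM σ ((2 * Real.pi) • ξ) : ℝ) * Complex.I) *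
        ((spheroidalWeight R ((2 * Real.pi) • ξ) : ℝ) : ℂ)) x‖ ≤ 288 * Real.pi * R ^ 3 / |τ| := by
  filter_upwards [ae_mem_offPlane] with x hx
  have e1 : (𝓕⁻ fun ξ : R3 => Complex.exp ((τ * lambdaPM σ ((2 * Real.pi) • ξ) : ℝ) * Complex.I) *
        ((spheroidalWeight R ((2 * Real.pi) • ξ) : ℝ) : ℂ)) x =
      ∫ ξ : R3, (fun η : R3 => (spheroidalWeight R η : ℂ) *
        Complex.exp ((τ * lambdaPM σ η + inner ℝ x η : ℝ) * Complex.I)) ((2 * Real.pi) • ξ) := by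
    rw [Real.fourierInv_eq']
    refine integral_congr_ae (.of_forall fun ξ => ?_)
    simp only [smul_eq_mul]
    rw [real_inner_smul_right, real_inner_comm x ξ, Complex.ofReal_add, add_mul, Complex.exp_add]
    ring
  have hπ : 1 ≤ 2 * Real.pi := by linarith [Real.pi_gt_three]
  have e2 := Measure.integral_comp_smul volume (fun η : R3 => (spheroidalWeight R η : ℂ) *
    Complex.exp ((τ * lambdaPM σ η + inner ℝ x η : ℝ) * Complex.I)) (2 * Real.pi)
  rw [e1, e2, finrank_R3, norm_smul, Real.norm_eq_abs]
  refine le_trans ?_ (norm_integral_weight_mul_exp_le hσ hR hτ hx)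
  refine mul_le_of_le_one_left (norm_nonneg _) ?_
  rw [abs_abs, abs_of_nonneg (by positivity)]
  exact inv_le_one_of_one_le₀ (one_le_pow₀ hπ)

theorem ae_smul_mem_offPlane : ∀ᵐ ξ : R3, (2 * Real.pi) • ξ ∈ offPlane := by
  filter_upwards [ae_mem_offPlane] with ξ hξ
  have hξ' : ξ 0 ≠ 0 := hξ
  change ((2 * Real.pi) • ξ) 0 ≠ 0
  simp [hξ', Real.pi_ne_zero]

/-- Frequency-localized sharp-admissible Strichartz estimate for `e^{itλ^±(D)}`. -/
theorem mixedNorm_wave_lambdaPM_le {σ : ℝ} (hσ : σ = 1 ∨ σ = -1) {q r : ℝ} (hq : 2 < q)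
    (hr : r = 2 * q / (q - 2)) {R : ℝ} (hR : 1 < R) {m : R3 → ℂ} (hm : Integrable m)
    (hmR : ∀ ξ, m ξ ≠ 0 → 1 + ‖(2 * Real.pi) • ξ‖ ≤ R) :
    mixedNorm (ENNReal.ofReal q) (ENNReal.ofReal r)
        (wave (fun ξ => lambdaPM σ ((2 * Real.pi) • ξ)) m) ≤
      ENNReal.ofReal ((2 * ((16 * q / (q - 2) * 2 ^ (q - 2)) ^ (1 / q) * (2 * (q + 2)))) ^
        (1 / 2 : ℝ) * (288 * Real.pi * R ^ 3) ^ (1 / r)) * eLpNorm m 2 volume := by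
  have hπ := Real.pi_pos
  have hR0 : 0 < R := by linarith
  refine mixedNorm_wave_le (w := fun ξ => spheroidalWeight R ((2 * Real.pi) • ξ))
    ((continuous_lambdaPM σ).comp (continuous_const_smul _))
    ((integrable_spheroidalWeight R).comp_smul (by positivity))
    (fun ξ => spheroidalWeight_nonneg _ _) (fun ξ => spheroidalWeight_le _ _) (by positivity)
    (fun τ hτ => norm_fourierInv_exp_mul_spheroidalWeight_le hσ hR hτ) hm ?_ hq hr
  filter_upwards [ae_smul_mem_offPlane] with ξ hξ h0
  exact half_le_spheroidalWeight hξ ((lambdaPM_one_le _).trans (hmR ξ h0))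

end Spheroidal

/-! ### Frequency support of the Littlewood-Paley pieces -/

section FrequencySupport

variable {φ₀ : 𝓢(R3, ℝ)} {j : ℤ}

theorem hasTemperateGrowth_dyadicSymbol (φ₀ : 𝓢(R3, ℝ)) (j : ℤ) :
    Function.HasTemperateGrowth fun ξ : R3 => (dyadicSymbol φ₀ j ((2 * Real.pi) • ξ) : ℂ) := by
  have h1 : Function.HasTemperateGrowth fun ξ : R3 => (2 : ℝ) ^ (-j) • (2 * Real.pi) • ξ :=
    (((2 : ℝ) ^ (-j)) • ((2 * Real.pi) • ContinuousLinearMap.id ℝ R3)).hasTemperateGrowth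
  exact Function.HasTemperateGrowth.comp Function.Complex.hasTemperateGrowth_ofReal
    (Function.HasTemperateGrowth.comp φ₀.hasTemperateGrowth h1)

theorem dyadicSymbol_eq_zero (hφ₀ : IsLittlewoodPaley φ₀) {ξ : R3}
    (hξ : (2 : ℝ) ^ (j + 1) < ‖ξ‖) : dyadicSymbol φ₀ j ξ = 0 := by
  by_contra h
  have h1 : (2 : ℝ) ^ (-j) • ξ ∈ tsupport (φ₀ : R3 → ℝ) := subset_tsupport _ h
  have h2 := (hφ₀.tsupport_subset h1).2
  rw [norm_smul, Real.norm_eq_abs, abs_of_pos (by positivity), zpow_neg,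
    inv_mul_le_iff₀ (by positivity), ← zpow_add_one₀ (by norm_num)] at h2
  linarith

/-- Tested against functions supported in `|2πξ| > 2^{j+1}`, the Fourier transform of `g` vanishes
because the dyadic symbol annihilates them. -/
theorem fourier_ae_eq_zero_of_lpProj (hφ₀ : IsLittlewoodPaley φ₀) {f : 𝓢'(R3, ℂ)}
    {g : Lp (α := R3) ℂ 2} (hg : lpProj φ₀ j f = Lp.toTemperedDistribution g) :
    ∀ᵐ ξ : R3, (2 : ℝ) ^ (j + 1) < ‖(2 * Real.pi) • ξ‖ → (𝓕 g : Lp ℂ 2 (volume : Measure R3)) ξ = 0 := by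
  have hU : IsOpen {ξ : R3 | (2 : ℝ) ^ (j + 1) < ‖(2 * Real.pi) • ξ‖} :=
    isOpen_lt continuous_const (by fun_prop)
  refine hU.ae_eq_zero_of_integral_contDiff_smul_eq_zero
    (((Lp.memLp (𝓕 g : Lp ℂ 2 (volume : Measure R3))).locallyIntegrable (by norm_num)).locallyIntegrableOn _) ?_
  intro ψ hψ hψc hψU
  have hψ₁ : HasCompactSupport (Complex.ofRealCLM ∘ ψ) := hψc.comp_left rfl
  have hψ₂ : ContDiff ℝ (⊤ : ℕ∞) (Complex.ofRealCLM ∘ ψ) := by fun_prop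
  set Ψ : 𝓢(R3, ℂ) := hψ₁.toSchwartzMap hψ₂ with hΨ
  have hΨψ : ∀ x, Ψ x = (ψ x : ℂ) := fun x => rfl
  have e1 : ∫ ξ, ψ ξ • (𝓕 g : Lp ℂ 2 (volume : Measure R3)) ξ = Lp.toTemperedDistribution (𝓕 g) Ψ := by
    rw [Lp.toTemperedDistribution_apply]
    refine integral_congr_ae (.of_forall fun ξ => ?_)
    simp [hΨψ]
  have e2 : SchwartzMap.smulLeftCLM ℂ
      (fun ξ : R3 => (dyadicSymbol φ₀ j ((2 * Real.pi) • ξ) : ℂ)) Ψ = 0 := by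
    ext ξ
    rw [SchwartzMap.smulLeftCLM_apply_apply (hasTemperateGrowth_dyadicSymbol φ₀ j), hΨψ]
    by_cases h : ξ ∈ tsupport ψ
    · rw [dyadicSymbol_eq_zero hφ₀ (hψU h)]; simp
    · rw [image_eq_zero_of_notMem_tsupport h]; simp
  rw [e1, ← Lp.fourier_toTemperedDistribution_eq, ← hg, lpProj,
    TemperedDistribution.fourierMultiplierCLM_apply, fourier_fourierInv_eq,
    TemperedDistribution.smulLeftCLM_apply_apply, e2, map_zero]

/-- An `L²` function with bounded frequency support has an integrable, square integrable and
boundedly supported representative of its Fourier transform. -/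
theorem exists_fourier_representative (hφ₀ : IsLittlewoodPaley φ₀) {f : 𝓢'(R3, ℂ)}
    {g : Lp (α := R3) ℂ 2} (hg : lpProj φ₀ j f = Lp.toTemperedDistribution g) :
    ∃ m : R3 → ℂ, Integrable m ∧ MemLp m 2 ∧ m =ᵐ[volume] (𝓕 g : Lp ℂ 2 (volume : Measure R3)) ∧
      (∀ ξ, m ξ ≠ 0 → ‖(2 * Real.pi) • ξ‖ ≤ (2 : ℝ) ^ (j + 1)) ∧
      eLpNorm m 2 volume = eLpNorm g 2 volume := by
  have hπ := Real.pi_pos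
  set B : Set R3 := {ξ | ‖(2 * Real.pi) • ξ‖ ≤ (2 : ℝ) ^ (j + 1)} with hB
  have hBm : MeasurableSet B := measurableSet_le (by fun_prop) measurable_const
  have hBsub : B ⊆ Metric.closedBall 0 ((2 : ℝ) ^ (j + 1)) := by
    intro ξ hξ
    have hξ' : ‖(2 * Real.pi) • ξ‖ ≤ (2 : ℝ) ^ (j + 1) := hξ
    rw [norm_smul, Real.norm_eq_abs, abs_of_pos (by positivity)] at hξ'
    rw [mem_closedBall_zero_iff]
    nlinarith [norm_nonneg ξ, Real.pi_gt_three]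
  have hBfin : volume B ≠ ∞ := ((measure_mono hBsub).trans_lt measure_closedBall_lt_top).ne
  have hL := Lp.memLp (𝓕 g : Lp ℂ 2 (volume : Measure R3))
  have hae : B.indicator (𝓕 g : Lp ℂ 2 (volume : Measure R3)) =ᵐ[volume] (𝓕 g : Lp ℂ 2 (volume : Measure R3)) := by
    filter_upwards [fourier_ae_eq_zero_of_lpProj hφ₀ hg] with ξ hξ
    by_cases h : ξ ∈ B
    · rw [Set.indicator_of_mem h]
    · rw [Set.indicator_of_notMem h, hξ (not_le.1 h)]
  refine ⟨B.indicator (𝓕 g : Lp ℂ 2 (volume : Measure R3)), ?_, hL.indicator hBm, hae, fun ξ h => ?_, ?_⟩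
  · have : IsFiniteMeasure (volume.restrict B) := ⟨by simpa using hBfin.lt_top⟩
    exact (integrable_indicator_iff hBm).2 ((hL.restrict B).integrable (by norm_num))
  · by_contra h'
    exact h (Set.indicator_of_notMem (s := B) h' _)
  · rw [eLpNorm_congr_ae hae]
    have h := Lp.norm_fourier_eq g
    rwa [Lp.norm_def, Lp.norm_def, ENNReal.toReal_eq_toReal_iff' (Lp.eLpNorm_ne_top _)
      (Lp.eLpNorm_ne_top _)] at h

/-- At each time the evolution is only an `L²` class; the Fourier integral supplies a representative
continuous in `(t, x)`. -/
theorem evolution_ae_eq_wave {g : Lp (α := R3) ℂ 2} {m : R3 → ℂ} (hm : Integrable m)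
    (hm2 : MemLp m 2) (hmg : m =ᵐ[volume] (𝓕 g : Lp ℂ 2 (volume : Measure R3))) (σ t : ℝ) :
    evolution σ t g =ᵐ[volume] wave (fun ξ => lambdaPM σ ((2 * Real.pi) • ξ)) m t := by
  have hp : Continuous fun ξ : R3 => lambdaPM σ ((2 * Real.pi) • ξ) :=
    (continuous_lambdaPM σ).comp (continuous_const_smul _)
  have h1 := integrable_exp_mul hp hm t
  have h2 : MemLp (fun ξ : R3 => Complex.exp ((t * lambdaPM σ ((2 * Real.pi) • ξ) : ℝ) *
      Complex.I) * m ξ) 2 := by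
    refine hm2.of_le h1.1 (.of_forall fun ξ => ?_)
    rw [norm_mul, Complex.norm_exp_ofReal_mul_I, one_mul]
  have h3 : (memLp_flowSymbol_mul σ t (𝓕 g)).toLp _ = h2.toLp _ := by
    refine MemLp.toLp_congr _ _ ?_
    filter_upwards [hmg] with ξ hξ
    rw [← hξ, flowSymbol]
    congr 2
    push_cast; ring
  rw [evolution, h3]
  exact fourierInv_toLp_ae_eq h1 h2

end FrequencySupport

/-! ### Measurability in time of the spatial norm -/

section Measurability

/-- For `q = ∞` this presents the norm as a supremum of continuous functions of time, hence as lower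
semicontinuous. -/
theorem eLpNorm_top_eq_iSup {u : R3 → ℂ} (hu : Continuous u) :
    eLpNorm u ∞ volume = ⨆ x, ‖u x‖ₑ := by
  rw [eLpNorm_exponent_top]
  refine le_antisymm (essSup_le_of_ae_le _ (.of_forall fun x => le_iSup (fun x => ‖u x‖ₑ) x))
    (iSup_le fun x => ?_)
  have hd : Dense {x | ‖u x‖ₑ ≤ eLpNormEssSup u volume} :=
    Measure.dense_of_ae (ae_le_eLpNormEssSup (f := u))
  have hc : IsClosed {x | ‖u x‖ₑ ≤ eLpNormEssSup u volume} :=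
    isClosed_le hu.enorm continuous_const
  have : x ∈ closure {x | ‖u x‖ₑ ≤ eLpNormEssSup u volume} := hd x
  rwa [hc.closure_eq] at this

theorem measurable_eLpNorm_of_continuous {u : ℝ → R3 → ℂ}
    (hu : Continuous (Function.uncurry u)) (q : ℝ≥0∞) :
    Measurable fun t => eLpNorm (u t) q volume := by
  have hut : ∀ t, Continuous (u t) := fun t => hu.uncurry_left t
  rcases eq_or_ne q 0 with rfl | h0
  · simp
  rcases eq_or_ne q ∞ with rfl | htop
  · simp_rw [eLpNorm_top_eq_iSup (hut _)]
    exact (lowerSemicontinuous_iSup fun x =>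
      ((hu.comp (Continuous.prodMk_left x)).enorm).lowerSemicontinuous).measurable
  · simp_rw [eLpNorm_eq_lintegral_rpow_enorm_toReal h0 htop]
    have h : Measurable (Function.uncurry fun t x => ‖u t x‖ₑ ^ q.toReal) :=
      (hu.enorm.measurable).pow_const _
    exact h.lintegral_prod_right'.pow_const _

end Measurability

/-! ### Bernstein's inequality -/

section Bernstein

/-- Provides the reproducing kernel: the Fourier transform of a smooth bump equal to 1 on the unit
ball. -/
theorem exists_schwartz_fourierInv_eq_one :
    ∃ K : 𝓢(R3, ℂ), ∀ ξ : R3, ‖ξ‖ ≤ 1 → (𝓕⁻ (K : R3 → ℂ)) ξ = 1 := by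
  let b : ContDiffBump (0 : R3) := ⟨1, 2, by norm_num, by norm_num⟩
  have h₁ : HasCompactSupport (Complex.ofRealCLM ∘ b) := b.hasCompactSupport.comp_left rfl
  have h₂ : ContDiff ℝ (⊤ : ℕ∞) (Complex.ofRealCLM ∘ b) :=
    Complex.ofRealCLM.contDiff.comp b.contDiff
  set χ : 𝓢(R3, ℂ) := h₁.toSchwartzMap h₂ with hχ
  refine ⟨𝓕 χ, fun ξ hξ => ?_⟩
  rw [← SchwartzMap.fourierInv_coe, fourierInv_fourier_eq]
  have : χ ξ = (b ξ : ℂ) := rfl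
  rw [this, b.one_of_mem_closedBall (by simpa using hξ)]
  simp

theorem lintegral_comp_smul_eq {F : R3 → ℝ≥0∞} (hF : Measurable F) {a : ℝ} (ha : 0 < a) :
    ∫⁻ y, F (a • y) = ENNReal.ofReal ((a ^ 3)⁻¹) * ∫⁻ y, F y := by
  rw [← lintegral_map hF (measurable_const_smul a), Measure.map_addHaar_smul volume ha.ne',
    lintegral_smul_measure, finrank_R3, abs_of_pos (by positivity), smul_eq_mul]

theorem integrable_dilate {K : R3 → ℂ} (hK : Integrable K) {a : ℝ} (ha : 0 < a) (x : R3) :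
    Integrable fun y => (a ^ 3 : ℂ) * K (a • (y - x)) :=
  ((hK.comp_smul ha.ne').comp_sub_right x).const_mul _

theorem fourierInv_dilate {K : R3 → ℂ} {a : ℝ} (ha : 0 < a) (x ξ : R3) :
    (𝓕⁻ fun y => (a ^ 3 : ℂ) * K (a • (y - x))) ξ =
      Complex.exp ((2 * Real.pi * inner ℝ ξ x : ℝ) * Complex.I) * (𝓕⁻ K) (a⁻¹ • ξ) := by
  rw [Real.fourierInv_eq', Real.fourierInv_eq']
  set Ψ : R3 → ℂ := fun z => Complex.exp ((2 * Real.pi * inner ℝ (a⁻¹ • z + x) ξ : ℝ) *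
    Complex.I) * ((a ^ 3 : ℂ) * K z) with hΨ
  have e1 : ∀ y, Complex.exp ((2 * Real.pi * inner ℝ y ξ : ℝ) * Complex.I) •
      ((a ^ 3 : ℂ) * K (a • (y - x))) = (fun z => Ψ (a • z)) (y - x) := fun y => by
    simp only [hΨ, smul_eq_mul]
    rw [smul_smul, inv_mul_cancel₀ ha.ne', one_smul, sub_add_cancel]
  simp_rw [e1]
  rw [integral_sub_right_eq_self (fun z => Ψ (a • z)) x, Measure.integral_comp_smul volume Ψ a,
    finrank_R3, abs_of_pos (by positivity), ← integral_smul, ← integral_const_mul]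
  refine integral_congr_ae (.of_forall fun z => ?_)
  simp only [hΨ, smul_eq_mul, Complex.real_smul]
  rw [inner_add_left, real_inner_smul_left, real_inner_smul_right, real_inner_comm ξ x, mul_add,
    Complex.ofReal_add, add_mul, Complex.exp_add]
  have : (a : ℂ) ≠ 0 := by exact_mod_cast ha.ne'
  push_cast
  field_simp

/-- On `|ξ| ≤ a` the inverse transform of the kernel dilated by `a` and centred at `x` is the
character `e^{2πi x·ξ}`, so pairing with it evaluates a band-limited function at `x`. -/
theorem fourierInv_eq_integral_mul_dilate {K : 𝓢(R3, ℂ)}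
    (hK : ∀ ξ : R3, ‖ξ‖ ≤ 1 → (𝓕⁻ (K : R3 → ℂ)) ξ = 1) {a : ℝ} (ha : 0 < a) {m : R3 → ℂ}
    (hm : Integrable m) (hma : ∀ ξ, m ξ ≠ 0 → ‖ξ‖ ≤ a) (x : R3) :
    (𝓕⁻ m) x = ∫ y, (𝓕⁻ m) y * ((a ^ 3 : ℂ) * K (a • (y - x))) := by
  rw [integral_fourierInv_mul_eq hm (integrable_dilate K.integrable ha x), Real.fourierInv_eq']
  refine integral_congr_ae (.of_forall fun ξ => ?_)
  simp only [smul_eq_mul]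
  rw [fourierInv_dilate ha]
  by_cases h : m ξ = 0
  · simp [h]
  · rw [hK, mul_one, mul_comm]
    rw [norm_smul, Real.norm_eq_abs, abs_of_pos (by positivity), inv_mul_le_iff₀ ha, mul_one]
    exact hma ξ h

/-- Bernstein's inequality with the supremum norm on the left. -/
theorem exists_enorm_fourierInv_le {q : ℝ} (hq : 1 < q) :
    ∃ C : ℝ, 0 < C ∧ ∀ a : ℝ, 0 < a → ∀ m : R3 → ℂ, Integrable m →
      (∀ ξ, m ξ ≠ 0 → ‖ξ‖ ≤ a) → ∀ x, ‖(𝓕⁻ m) x‖ₑ ≤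
        ENNReal.ofReal (C * a ^ (3 / q)) * eLpNorm (𝓕⁻ m : R3 → ℂ) (ENNReal.ofReal q) volume := by
  have hq0 : 0 < q := by linarith
  obtain ⟨K, hK⟩ := exists_schwartz_fourierInv_eq_one
  set q' : ℝ := q / (q - 1) with hq'
  have hconj : q.HolderConjugate q' := Real.HolderConjugate.conjExponent hq
  have hq'0 : 0 < q' := hconj.symm.pos
  set N : ℝ≥0∞ := (∫⁻ y, ‖K y‖ₑ ^ q') ^ (1 / q') with hN
  have hNfin : N ≠ ∞ := by
    have h1 : eLpNorm K (ENNReal.ofReal q') volume = N := by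
      rw [eLpNorm_eq_lintegral_rpow_enorm_toReal (by simpa using hq'0) ENNReal.ofReal_ne_top,
        ENNReal.toReal_ofReal hq'0.le]
    rw [← h1]
    exact (K.memLp _ _).2.ne
  refine ⟨N.toReal + 1, by positivity, fun a ha m hm hma x => ?_⟩
  have hu := continuous_fourierInv hm
  have hKc : Measurable fun y => ‖K y‖ₑ ^ q' := (K.continuous.enorm.measurable).pow_const _
  rw [fourierInv_eq_integral_mul_dilate hK ha hm hma x]
  refine (enorm_integral_le_lintegral_enorm _).trans ?_
  simp_rw [enorm_mul ((𝓕⁻ m) _)]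
  refine (ENNReal.lintegral_mul_le_Lp_mul_Lq volume hconj hu.enorm.measurable.aemeasurable
    (by fun_prop)).trans ?_
  rw [eLpNorm_eq_lintegral_rpow_enorm_toReal (by simpa using hq0) ENNReal.ofReal_ne_top,
    ENNReal.toReal_ofReal hq0.le, mul_comm]
  gcongr
  have ea : ‖(a ^ 3 : ℂ)‖ₑ = ENNReal.ofReal (a ^ 3) := by
    rw [← ofReal_norm, norm_pow, Complex.norm_real, Real.norm_eq_abs, abs_of_pos ha]
  have e1 : ∫⁻ y, ‖(a ^ 3 : ℂ) * K (a • (y - x))‖ₑ ^ q' =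
      ENNReal.ofReal ((a ^ 3) ^ q' * (a ^ 3)⁻¹) * ∫⁻ y, ‖K y‖ₑ ^ q' := by
    simp_rw [enorm_mul, ea, ENNReal.mul_rpow_of_nonneg _ _ hq'0.le]
    rw [lintegral_const_mul' _ _ (by finiteness),
      lintegral_sub_right_eq_self (fun y => ‖K (a • y)‖ₑ ^ q') x, lintegral_comp_smul_eq hKc ha,
      ENNReal.ofReal_rpow_of_pos (by positivity), ← mul_assoc, ← ENNReal.ofReal_mul (by positivity)]
  rw [e1, ENNReal.mul_rpow_of_nonneg _ _ (by positivity), ← hN,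
    ENNReal.ofReal_rpow_of_pos (by positivity)]
  -- The dilated kernel has `L^{q'}` norm of order `a^{3(1 - 1/q')} = a^{3/q}`.
  have e2 : ((a ^ 3) ^ q' * (a ^ 3)⁻¹) ^ (1 / q') = a ^ (3 / q) := by
    rw [← Real.rpow_neg_one (a ^ 3), ← Real.rpow_add (by positivity),
      ← Real.rpow_mul (by positivity), ← Real.rpow_natCast, ← Real.rpow_mul ha.le]
    congr 1
    have : q - 1 ≠ 0 := by linarith
    rw [hq']; push_cast; field_simp; ring
  rw [e2, mul_comm (N.toReal + 1), ENNReal.ofReal_mul (by positivity)]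
  gcongr
  exact (ENNReal.ofReal_toReal hNfin).symm.le.trans (ENNReal.ofReal_le_ofReal (by linarith))

/-- From `|u|^s ≤ ‖u‖_∞^{s - q₀} |u|^{q₀}`. For `q = ∞` the inverse exponent is `0`, and the same
formula covers that case. -/
theorem eLpNorm_le_of_enorm_le {u : R3 → ℂ} (hu : AEStronglyMeasurable u) {q₀ : ℝ} (hq₀ : 0 < q₀)
    {q : ℝ≥0∞} (hq : ENNReal.ofReal q₀ ≤ q) {D : ℝ} (hD : 0 < D)
    (h : ∀ x, ‖u x‖ₑ ≤ ENNReal.ofReal D * eLpNorm u (ENNReal.ofReal q₀) volume) :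
    eLpNorm u q volume ≤ ENNReal.ofReal (D ^ (1 - q₀ * (q⁻¹).toReal)) *
      eLpNorm u (ENNReal.ofReal q₀) volume := by
  rcases eq_or_ne q ∞ with rfl | htop
  · simp only [ENNReal.inv_top, ENNReal.toReal_zero, mul_zero, sub_zero, Real.rpow_one]
    rw [eLpNorm_exponent_top]
    exact essSup_le_of_ae_le _ (.of_forall h)
  set s : ℝ := q.toReal with hs
  have hq₀s : q₀ ≤ s := (ENNReal.ofReal_le_iff_le_toReal htop).1 hq
  have hs0 : 0 < s := hq₀.trans_le hq₀s
  have hq0 : q ≠ 0 := fun h0 => by rw [hs, h0] at hs0; simp at hs0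
  set N : ℝ≥0∞ := eLpNorm u (ENNReal.ofReal q₀) volume with hN
  have hNq : ∫⁻ x, ‖u x‖ₑ ^ q₀ = N ^ q₀ := by
    rw [hN, eLpNorm_eq_lintegral_rpow_enorm_toReal (by simpa using hq₀) ENNReal.ofReal_ne_top,
      ENNReal.toReal_ofReal hq₀.le, ← ENNReal.rpow_mul, one_div_mul_cancel hq₀.ne',
      ENNReal.rpow_one]
  have h1 : ∫⁻ x, ‖u x‖ₑ ^ s ≤ (ENNReal.ofReal D * N) ^ (s - q₀) * N ^ q₀ := by
    rw [← hNq, ← lintegral_const_mul'' _ (hu.enorm.pow_const _)]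
    refine lintegral_mono fun x => ?_
    calc ‖u x‖ₑ ^ s = ‖u x‖ₑ ^ (s - q₀) * ‖u x‖ₑ ^ q₀ := by
          rw [← ENNReal.rpow_add_of_nonneg _ _ (by linarith) hq₀.le, sub_add_cancel]
      _ ≤ _ := by
          gcongr
          exact h x
  rw [eLpNorm_eq_lintegral_rpow_enorm_toReal hq0 htop, ← hs]
  refine (ENNReal.rpow_le_rpow h1 (by positivity)).trans (le_of_eq ?_)
  rw [ENNReal.mul_rpow_of_nonneg _ _ (by positivity), ← ENNReal.rpow_mul, ← ENNReal.rpow_mul,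
    ENNReal.mul_rpow_of_nonneg _ _ (mul_nonneg (by linarith) (by positivity)), mul_assoc,
    ← ENNReal.rpow_add_of_nonneg _ _ (mul_nonneg (by linarith) (by positivity)) (by positivity),
    ENNReal.ofReal_rpow_of_pos hD, ENNReal.toReal_inv, ← hs]
  congr 2
  · congr 1
    field_simp
  · rw [show (s - q₀) * (1 / s) + q₀ * (1 / s) = 1 by field_simp; ring, ENNReal.rpow_one]

/-- Bernstein's inequality. -/
theorem exists_eLpNorm_fourierInv_le {q₀ : ℝ} (hq₀ : 1 < q₀) {q : ℝ≥0∞}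
    (hq : ENNReal.ofReal q₀ ≤ q) :
    ∃ C : ℝ, 0 < C ∧ ∀ a : ℝ, 0 < a → ∀ m : R3 → ℂ, Integrable m →
      (∀ ξ, m ξ ≠ 0 → ‖ξ‖ ≤ a) → eLpNorm (𝓕⁻ m : R3 → ℂ) q volume ≤
        ENNReal.ofReal (C * a ^ (3 * (1 / q₀ - (q⁻¹).toReal))) *
          eLpNorm (𝓕⁻ m : R3 → ℂ) (ENNReal.ofReal q₀) volume := by
  have hq₀0 : 0 < q₀ := by linarith
  obtain ⟨C, hC, h⟩ := exists_enorm_fourierInv_le hq₀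
  refine ⟨C ^ (1 - q₀ * (q⁻¹).toReal), by positivity, fun a ha m hm hma => ?_⟩
  refine (eLpNorm_le_of_enorm_le (continuous_fourierInv hm).aestronglyMeasurable hq₀0 hq
    (by positivity) (h a ha m hm hma)).trans (le_of_eq ?_)
  rw [Real.mul_rpow hC.le (by positivity), ← Real.rpow_mul ha.le]
  congr 4
  field_simp

end Bernstein

/-! ### Estimates for the evolution, and the conclusion -/

section Evolution

variable {φ₀ : 𝓢(R3, ℝ)}

theorem mixedNorm_le_mul {u v : ℝ → R3 → ℂ} {q q₀ r : ℝ≥0∞} {B : ℝ}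
    (h : ∀ t, eLpNorm (u t) q volume ≤ ENNReal.ofReal B * eLpNorm (v t) q₀ volume) :
    mixedNorm q r u ≤ ENNReal.ofReal B * mixedNorm q₀ r v := by
  refine (eLpNorm_le_nnreal_smul_eLpNorm_of_ae_le_mul' (c := B.toNNReal)
    (g := fun t => eLpNorm (v t) q₀ volume) (.of_forall fun t => ?_) r).trans (le_of_eq ?_)
  · exact h t
  · rfl

/-- Bernstein's inequality along the evolution of a function with frequencies `|ξ| ≤ 2^{j+1}`. -/
theorem exists_eLpNorm_wave_le {q₀ : ℝ} (hq₀ : 1 < q₀) {q : ℝ≥0∞} (hq : ENNReal.ofReal q₀ ≤ q) :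
    ∃ C : ℝ, 0 < C ∧ ∀ (j : ℤ) (p : R3 → ℝ) (m : R3 → ℂ), Continuous p → Integrable m →
      (∀ ξ, m ξ ≠ 0 → ‖(2 * Real.pi) • ξ‖ ≤ (2 : ℝ) ^ (j + 1)) → ∀ t,
        eLpNorm (wave p m t) q volume ≤
          ENNReal.ofReal (C * (2 : ℝ) ^ (3 * (1 / q₀ - (q⁻¹).toReal) * (j : ℝ))) *
            eLpNorm (wave p m t) (ENNReal.ofReal q₀) volume := by
  obtain ⟨C, hC, h⟩ := exists_eLpNorm_fourierInv_le hq₀ hq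
  refine ⟨C, hC, fun j p m hp hm hmj t => ?_⟩
  -- The radius is `2^j`: in the variable of the Fourier integral `|2πξ| ≤ 2^{j+1}`, and `2π ≥ 2`.
  refine (h ((2 : ℝ) ^ j) (by positivity) _ (integrable_exp_mul hp hm t) fun ξ hξ => ?_).trans
    (le_of_eq ?_)
  · have h1 := hmj ξ (right_ne_zero_of_mul hξ)
    rw [norm_smul, Real.norm_eq_abs, abs_of_pos (by positivity), zpow_add_one₀ (by norm_num)] at h1
    nlinarith [norm_nonneg ξ, Real.pi_gt_three]
  · rw [← Real.rpow_intCast, ← Real.rpow_mul (by norm_num), mul_comm (j : ℝ)]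
    rfl

theorem eLpNorm_two_wave {p : R3 → ℝ} {m : R3 → ℂ} (hp : Continuous p) (hm : Integrable m)
    (hm2 : MemLp m 2) (t : ℝ) : eLpNorm (wave p m t) 2 volume = eLpNorm m 2 volume := by
  have h1 := integrable_exp_mul hp hm t
  have h0 : ∀ ξ, ‖Complex.exp ((t * p ξ : ℝ) * Complex.I) * m ξ‖ = ‖m ξ‖ := fun ξ => by
    rw [norm_mul, Complex.norm_exp_ofReal_mul_I, one_mul]
  rw [wave, eLpNorm_fourierInv_eq h1 (hm2.of_le h1.1 (.of_forall fun ξ => (h0 ξ).le))]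
  exact eLpNorm_congr_norm_ae (.of_forall h0)

theorem continuous_lambdaPM_smul (σ : ℝ) :
    Continuous fun ξ : R3 => lambdaPM σ ((2 * Real.pi) • ξ) :=
  (continuous_lambdaPM σ).comp (continuous_const_smul _)

theorem aemeasurable_eLpNorm_evolution (hφ₀ : IsLittlewoodPaley φ₀) {j : ℤ} {f : 𝓢'(R3, ℂ)}
    {g : Lp (α := R3) ℂ 2} (hg : lpProj φ₀ j f = Lp.toTemperedDistribution g) (σ : ℝ) (q : ℝ≥0∞) :
    AEMeasurable (fun t : ℝ => eLpNorm (evolution σ t g) q volume) volume := by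
  obtain ⟨m, hm, hm2, hmg, -, -⟩ := exists_fourier_representative hφ₀ hg
  simp_rw [fun t => eLpNorm_congr_ae (p := q) (evolution_ae_eq_wave hm hm2 hmg σ t)]
  exact (measurable_eLpNorm_of_continuous
    (continuous_uncurry_wave (continuous_lambdaPM_smul σ) hm) q).aemeasurable

/-- Bernstein from `L²`, whose norm is conserved; no dispersion is needed. -/
theorem exists_mixedNorm_top_evolution_le (hφ₀ : IsLittlewoodPaley φ₀) {q : ℝ≥0∞} (hq : 2 ≤ q) :
    ∃ C : ℝ, 0 < C ∧ ∀ (σ : ℝ) (j : ℤ) (f : 𝓢'(R3, ℂ)) (g : Lp (α := R3) ℂ 2),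
      lpProj φ₀ j f = Lp.toTemperedDistribution g →
        mixedNorm q ∞ (fun t => evolution σ t g) ≤
          ENNReal.ofReal (C * (2 : ℝ) ^ (3 * (1 / 2 - (q⁻¹).toReal) * (j : ℝ))) *
            eLpNorm g 2 volume := by
  obtain ⟨C, hC, h⟩ := exists_eLpNorm_wave_le (q₀ := 2) (by norm_num) (q := q) (by simpa using hq)
  refine ⟨C, hC, fun σ j f g hg => ?_⟩
  obtain ⟨m, hm, hm2, hmg, hmj, hmn⟩ := exists_fourier_representative hφ₀ hg
  have hp := continuous_lambdaPM_smul σ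
  unfold mixedNorm
  simp_rw [fun t => eLpNorm_congr_ae (p := q) (evolution_ae_eq_wave hm hm2 hmg σ t)]
  rw [eLpNorm_exponent_top]
  refine essSup_le_of_ae_le _ (.of_forall fun t => ?_)
  simp only [enorm_eq_self]
  refine (h j _ m hp hm hmj t).trans (le_of_eq ?_)
  rw [ENNReal.ofReal_ofNat, eLpNorm_two_wave hp hm hm2, hmn]

/-- Bernstein from `q` down to `q₀`, then the sharp-line estimate for `(q₀, r)`. The last power of 2
is the `R^{3/r}` of the dispersive constant. -/
theorem exists_mixedNorm_evolution_le (hφ₀ : IsLittlewoodPaley φ₀) {q : ℝ≥0∞} {q₀ r : ℝ}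
    (hq₀ : 2 < q₀) (hr : r = 2 * q₀ / (q₀ - 2)) (hq : ENNReal.ofReal q₀ ≤ q) :
    ∃ C : ℝ, 0 < C ∧ ∀ σ : ℝ, (σ = 1 ∨ σ = -1) →
      ∀ (j : ℤ) (f : 𝓢'(R3, ℂ)) (g : Lp (α := R3) ℂ 2),
      lpProj φ₀ j f = Lp.toTemperedDistribution g →
        mixedNorm q (ENNReal.ofReal r) (fun t => evolution σ t g) ≤
          ENNReal.ofReal (C * (2 : ℝ) ^ (3 * (1 / q₀ - (q⁻¹).toReal) * (j : ℝ)) *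
            (2 : ℝ) ^ (3 / r * max (j : ℝ) 0)) * eLpNorm g 2 volume := by
  have hπ := Real.pi_pos
  have hq₀2 : 0 < q₀ - 2 := by linarith
  obtain ⟨C, hC, h⟩ := exists_eLpNorm_wave_le (q₀ := q₀) (by linarith) hq
  set D : ℝ := (2 * ((16 * q₀ / (q₀ - 2) * 2 ^ (q₀ - 2)) ^ (1 / q₀) * (2 * (q₀ + 2)))) ^
    (1 / 2 : ℝ) with hD
  have hD0 : 0 < D := by positivity
  refine ⟨C * D * (288 * Real.pi * 64) ^ (1 / r), by positivity, fun σ hσ j f g hg => ?_⟩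
  obtain ⟨m, hm, hm2, hmg, hmj, hmn⟩ := exists_fourier_representative hφ₀ hg
  have hp := continuous_lambdaPM_smul σ
  set M : ℝ := (2 : ℝ) ^ (max (j : ℝ) 0) with hM
  have hM1 : 1 ≤ M := Real.one_le_rpow (by norm_num) (le_max_right _ _)
  have hjM : (2 : ℝ) ^ j ≤ M := by
    rw [← Real.rpow_intCast]
    exact Real.rpow_le_rpow_of_exponent_le (by norm_num) (le_max_left _ _)
  -- `1 + 2^{j+1} ≤ 3M`, so the cut-off `R = 4M` contains all frequencies; its cube gives the `64`.
  have hR : ∀ ξ, m ξ ≠ 0 → 1 + ‖(2 * Real.pi) • ξ‖ ≤ 4 * M := fun ξ hξ => by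
    have := hmj ξ hξ
    rw [zpow_add_one₀ (by norm_num)] at this
    linarith
  have e1 : mixedNorm q (ENNReal.ofReal r) (fun t => evolution σ t g) =
      mixedNorm q (ENNReal.ofReal r) (wave (fun ξ => lambdaPM σ ((2 * Real.pi) • ξ)) m) := by
    unfold mixedNorm
    simp_rw [fun t => eLpNorm_congr_ae (p := q) (evolution_ae_eq_wave hm hm2 hmg σ t)]
  rw [e1]
  refine (mixedNorm_le_mul (h j _ m hp hm hmj)).trans ?_
  refine (mul_le_mul_right (mixedNorm_wave_lambdaPM_le hσ hq₀ hr (by linarith) hm hR) _).trans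
    (le_of_eq ?_)
  rw [hmn, ← mul_assoc, ← ENNReal.ofReal_mul (by positivity), ← hD,
    show 288 * Real.pi * (4 * M) ^ 3 = 288 * Real.pi * 64 * M ^ 3 by ring,
    Real.mul_rpow (by positivity) (by positivity)]
  have e2 : (M ^ 3) ^ (1 / r) = (2 : ℝ) ^ (3 / r * max (j : ℝ) 0) := by
    rw [hM, ← Real.rpow_natCast, ← Real.rpow_mul (by positivity), ← Real.rpow_mul (by positivity)]
    congr 1
    push_cast; ring
  rw [e2]
  congr 2
  ring

end Evolution

/-- If `Δ_j f` is the element `g` of `L²(ℝ³)`, then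
`Δ_j e^{i t λ^±(D)} f = 𝓕⁻¹ [e^{i t λ^±(ξ)} φ_j(ξ) 𝓕 f(ξ)]` is `evolution σ t g`. -/
theorem lemma3p6 (φ₀ : 𝓢(R3, ℝ)) (hφ₀ : IsLittlewoodPaley φ₀)
    (q r : ℝ≥0∞) (hq : 2 ≤ q) (hr : 2 ≤ r) (hqr : q⁻¹ + r⁻¹ ≤ 2⁻¹)
    (hne : (q, r) ≠ (∞, 2)) :
    ∃ C : ℝ, 0 < C ∧ ∀ σ : ℝ, (σ = 1 ∨ σ = -1) →
      ∀ (j : ℤ) (f : 𝓢'(R3, ℂ)) (g : Lp (α := R3) ℂ 2),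
        lpProj φ₀ j f = Lp.toTemperedDistribution g →
        AEMeasurable (fun t : ℝ => eLpNorm (evolution σ t g) q volume) volume ∧
        (j ≤ 0 →
          mixedNorm q r (fun t => evolution σ t g) ≤
            ENNReal.ofReal
              (C * (2 : ℝ) ^ (3 * (1 / 2 - (q⁻¹).toReal - (r⁻¹).toReal) * (j : ℝ))) *
              eLpNorm g 2 volume) ∧
        (0 < j →
          mixedNorm q r (fun t => evolution σ t g) ≤
            ENNReal.ofReal (C * (2 : ℝ) ^ (3 * (1 / 2 - (q⁻¹).toReal) * (j : ℝ))) *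
              eLpNorm g 2 volume) := by
  rcases eq_or_ne r ∞ with rfl | hr'
  · obtain ⟨C, hC, h⟩ := exists_mixedNorm_top_evolution_le hφ₀ hq
    refine ⟨C, hC, fun σ _ j f g hg => ⟨aemeasurable_eLpNorm_evolution hφ₀ hg σ q, fun _ => ?_,
      fun _ => h σ j f g hg⟩⟩
    -- With `1/r = 0` the two exponents coincide.
    simpa using h σ j f g hg
  -- `r = 2` would force `1/q = 0`, the excluded endpoint.
  have hr2 : 2 < r := by
    refine lt_of_le_of_ne hr fun h => hne ?_
    rw [← h] at hqr ⊢
    have h1 : q⁻¹ = 0 := by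
      have h2 : q⁻¹ + 2⁻¹ ≤ 0 + 2⁻¹ := by simpa using hqr
      exact nonpos_iff_eq_zero.1 ((ENNReal.add_le_add_iff_right (by simp)).1 h2)
    rw [ENNReal.inv_eq_zero.1 h1]
  set ρ : ℝ := r.toReal with hρ
  have hrρ : r = ENNReal.ofReal ρ := (ENNReal.ofReal_toReal hr').symm
  have hρ2 : 2 < ρ := by
    rwa [hrρ, ← ENNReal.ofReal_ofNat, ENNReal.ofReal_lt_ofReal_iff_of_nonneg (by norm_num)] at hr2
  have hρ2' : 0 < ρ - 2 := by linarith
  have hρ0 : 0 < ρ := by linarith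
  -- The exponent on the sharp line `1/q₀ + 1/r = 1/2`; the admissibility condition says exactly `q₀
  -- ≤ q`.
  set q₀ : ℝ := 2 * ρ / (ρ - 2) with hq₀
  have hq₀2 : q₀ - 2 = 4 / (ρ - 2) := by rw [hq₀]; field_simp; ring
  have hq₀pos : 0 < q₀ - 2 := by rw [hq₀2]; positivity
  have hinv : 1 / q₀ = 1 / 2 - 1 / ρ := by rw [hq₀]; field_simp
  have hrinv : (r⁻¹).toReal = 1 / ρ := by rw [ENNReal.toReal_inv, one_div]
  have hle : ENNReal.ofReal q₀ ≤ q := by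
    rw [← ENNReal.inv_le_inv]
    have h1 : (ENNReal.ofReal q₀)⁻¹ + r⁻¹ = 2⁻¹ := by
      rw [hrρ, ← ENNReal.ofReal_ofNat, ← ENNReal.ofReal_inv_of_pos (by linarith),
        ← ENNReal.ofReal_inv_of_pos hρ0, ← ENNReal.ofReal_inv_of_pos (by norm_num),
        ← ENNReal.ofReal_add (by positivity) (by positivity)]
      congr 1
      rw [← one_div, hinv]; ring
    rw [← h1] at hqr
    exact (ENNReal.add_le_add_iff_right (ENNReal.inv_ne_top.2
      (fun h0 => by rw [h0] at hr; simp at hr))).1 hqr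
  obtain ⟨C, hC, h⟩ := exists_mixedNorm_evolution_le hφ₀ (q := q) (q₀ := q₀) (r := ρ)
    (by linarith) (by rw [hq₀2, hq₀]; field_simp; norm_num) hle
  refine ⟨C, hC, fun σ hσ j f g hg => ⟨aemeasurable_eLpNorm_evolution hφ₀ hg σ q, fun hj => ?_,
    fun hj => ?_⟩⟩
  · have h1 := h σ hσ j f g hg
    have hj' : (j : ℝ) ≤ 0 := by exact_mod_cast hj
    rw [max_eq_right hj', mul_zero, Real.rpow_zero, mul_one, ← hrρ, hinv] at h1
    rw [hrinv, sub_right_comm]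
    exact h1
  · have h1 := h σ hσ j f g hg
    have hj' : 0 ≤ (j : ℝ) := by exact_mod_cast hj.le
    -- The dispersive loss `3/r` cancels the `-3/r` in Bernstein's exponent `3(1/2 - 1/r - 1/q)`.
    rw [max_eq_left hj', ← hrρ, mul_assoc C, ← Real.rpow_add (by norm_num), hinv] at h1
    convert h1 using 5
    ring

end
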